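/- **Setting.** Let $V$ be a set of $n$ vertices and let $p,q\in[0,1]$ with $0<p+q\le 1$. The *edge-Markovian graph* $\mathcal G(n,p,q)=(G_t)_{t\ge 0}$ starts from an arbitrary fixed graph $G_0$ on $V$. For each unordered pair $e$ of distinct vertices, the indicator $Y_t(e)$ of $e\in E(G_t)$ is a Markov chain on $\{0,1\}$ with transition matrix $\begin{pmatrix}1-p&p\\ q&1-q\end{pmatrix}$, and these chains are independent for different $e$. For a graph $G$ on $V$, the *lazy Metropolis walk* has the transition matrix $P_{\mathrm{LM}}(G)$ with $P_{\mathrm{LM}}(G)(u,v)=\frac{1}{2\max\{\deg(G,u),\deg(G,v)\}}$ if $\{u,v\}\in E(G)$, $P_{\mathrm{LM}}(G)(u,u)=1-\sum_{w\in N(G,u)}\frac{1}{2\max\{\deg(G,u),\deg(G,w)\}}$, and $P_{\mathrm{LM}}(G)(u,v)=0$ otherwise. For a sequence $\mathcal P=(P_t)_{t\ge 1}$ of transition matrices on $V$, a walk $(X_t)_{t\ge0}$ according to $\mathcal P$ makes its step from $X_{t-1}$ to $X_t$ with $P_t$. Consider $k$ independent such walks. - $t_{\mathrm{hit}}^{(k)}(\mathcal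 P)$ is the maximum, over all initial positions in $V^k$ and all targets $w\in V$, of the expected first time by which some walk has visited $w$. - $t_{\mathrm{cov}}^{(k)}(\mathcal P)$ is the maximum, over all initial positions in $V^k$, of the expected first time by which every vertex has been visited by some walk. - $t_{\mathrm{coal}}(\mathcal P)$ is the maximum, over all initial positions in $V^n$ of $n$ coalescing walks according to $\mathcal P$ (walkers at the same vertex merge and move together from then on, and distinct walkers move independently), of the expected first time at which only one vertex is occupied. **Theorem 1.7.** There are absolute constants $K>0$, $\delta>0$ and $n_0$ such that the following holds. Let $c\ge 1$, $n\ge n_0$ and $k\ge 1$. Let $p,q\in[0,1]$ satisfy $0<p+q\le 1$ and $\frac{p}{p+q}\ge 32(c+1)\frac{\log n}{n}$, and let $G_0$ be any graph on $n$ vertices. Let $(G_t)_{t\ge0}$ be the edge-Markovian graph $\mathcal G(n,p,q)$ started at $G_0$, and let $\mathcal P=(P_{\mathrm{LM}}(G_t))_{t\ge 1}$. Then, with probability at least $1-n^{-\delta}$ over $(G_t)_{t\ge0}$, all three of the following bounds hold (the expectations on their left-hand sides are over the walks only, for the given realization of the graphs): $$t_{\mathrm{hit}}^{(k)}(\mathcal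 P)\le K\left(\frac{\max\{1,q/p\}}{p+q}+\log n+\frac nk\right),$$ $$t_{\mathrm{cov}}^{(k)}(\mathcal P)\le K\left(\frac{\max\{1,q/p\}}{p+q}+\log n+\frac{n\log n}{k}\right),$$ $$t_{\mathrm{coal}}(\mathcal P)\le K\left(\frac{\max\{1,q/p\}}{p+q}+n\right).$$ -/

import Mathlib

open MeasureTheory ProbabilityTheory
open scoped ENNReal unitInterval

namespace DynamicWalk

noncomputable section

/-! ### Time-inhomogeneous Markov chains with given transition matrices -/

/-- The law on `ℕ → S` of the Markov chain started at `x` whose step from time `t` to time `t + 1`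
is made with the Markov kernel `κ t` (Ionescu-Tulcea). -/
def chainLaw {S : Type*} [MeasurableSpace S] (κ : ℕ → Kernel S S) [∀ t, IsMarkovKernel (κ t)]
    (x : S) : Measure (ℕ → S) :=
  Kernel.traj (X := fun _ => S)
    (fun t => (κ t).comap (fun h : (i : Finset.Iic t) → S => h ⟨t, Finset.mem_Iic.2 le_rfl⟩)
      (measurable_pi_apply _)) 0 (fun _ => x)

instance {S : Type*} [MeasurableSpace S] (κ : ℕ → Kernel S S) [∀ t, IsMarkovKernel (κ t)]
    (x : S) : IsProbabilityMeasure (chainLaw κ x) := by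
  unfold chainLaw; infer_instance

section Stochastic

variable {V : Type*} [Fintype V] [DecidableEq V]

/-- The row `P(u, ·)` of a stochastic matrix, as a probability mass function on `V`. -/
def rowPMF (P : Matrix.rowStochastic ℝ V) (u : V) : PMF V :=
  PMF.ofFintype (fun v => ENNReal.ofReal (P.1 u v)) (by
    rw [← ENNReal.ofReal_sum_of_nonneg
      (fun v _ => Matrix.nonneg_of_mem_rowStochastic P.2),
      Matrix.sum_row_of_mem_rowStochastic P.2, ENNReal.ofReal_one])

variable [MeasurableSpace V] [MeasurableSingletonClass V]

/-- The Markov kernel `u ↦ P(u, ·)` of a stochastic matrix. -/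
def stepKernel (P : Matrix.rowStochastic ℝ V) : Kernel V V :=
  Kernel.ofFunOfCountable fun u => (rowPMF P u).toMeasure

instance (P : Matrix.rowStochastic ℝ V) : IsMarkovKernel (stepKernel P) :=
  ⟨fun u => PMF.toMeasure.isProbabilityMeasure (rowPMF P u)⟩

/-- The law of the random walk `X₀ = x, X₁, X₂, …` according to `(P_t)_{t ≥ 1}`: the step from
`X_{t-1}` to `X_t` is made with `P_t`. The value `P 0` is not used. -/
def walkLaw (P : ℕ → Matrix.rowStochastic ℝ V) (x : V) : Measure (ℕ → V) :=
  chainLaw (fun t => stepKernel (P (t + 1))) x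

instance (P : ℕ → Matrix.rowStochastic ℝ V) (x : V) : IsProbabilityMeasure (walkLaw P x) := by
  unfold walkLaw; infer_instance

/-! ### Hitting, cover and coalescing times -/

/-- `inf {t ≥ 0 : A t}`, with value `∞` if there is no such `t`. -/
def firstTime (A : ℕ → Prop) : ℝ≥0∞ := ⨅ (t : ℕ) (_ : A t), (t : ℝ≥0∞)

/-- The law of `k` independent walks according to `(P_t)_{t ≥ 1}`, the `i`-th one started
at `x i`. A sample point `X` gives the position `X i t` of walk `i` at time `t`. -/
def walksLaw (P : ℕ → Matrix.rowStochastic ℝ V) {k : ℕ} (x : Fin k → V) :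
    Measure (Fin k → ℕ → V) :=
  Measure.pi fun i => walkLaw P (x i)

/-- The expected hitting time `t_hit^{(k)}` of `k` independent walks, for the worst initial
positions and the worst target. -/
def hitTime (P : ℕ → Matrix.rowStochastic ℝ V) (k : ℕ) : ℝ≥0∞ :=
  ⨆ (x : Fin k → V) (w : V),
    ∫⁻ X, firstTime (fun t => ∃ i, ∃ s ≤ t, X i s = w) ∂(walksLaw P x)

/-- The expected cover time `t_cov^{(k)}` of `k` independent walks, for the worst initial
positions. -/
def coverTime (P : ℕ → Matrix.rowStochastic ℝ V) (k : ℕ) : ℝ≥0∞ :=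
  ⨆ x : Fin k → V,
    ∫⁻ X, firstTime (fun t => ∀ w : V, ∃ i, ∃ s ≤ t, X i s = w) ∂(walksLaw P x)

/-- The walker of smallest index among those at the same vertex as walker `a`. -/
def leader {m : ℕ} (x : Fin m → V) (a : Fin m) : Fin m :=
  (Finset.univ.filter fun b => x b = x a).min' ⟨a, by simp⟩

/-- One step of `m` coalescing walks: every walker of smallest index at its vertex moves according
to `P`, these moves being independent, and each other walker copies the move of the walker of
smallest index at its vertex. -/
def coalKernel (P : Matrix.rowStochastic ℝ V) (m : ℕ) : Kernel (Fin m → V) (Fin m → V) :=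
  Kernel.ofFunOfCountable fun x =>
    (Measure.pi fun b => (rowPMF P (x b)).toMeasure).map fun ξ a => ξ (leader x a)

instance (P : Matrix.rowStochastic ℝ V) (m : ℕ) : IsMarkovKernel (coalKernel P m) := by
  refine ⟨fun x => ?_⟩
  have : ∀ b, IsProbabilityMeasure (rowPMF P (x b)).toMeasure :=
    fun b => PMF.toMeasure.isProbabilityMeasure _
  exact Measure.isProbabilityMeasure_map
    (measurable_pi_lambda _ fun a => measurable_pi_apply _).aemeasurable

/-- The expected coalescing time `t_coal` of `m` coalescing walks according to `(P_t)_{t ≥ 1}`,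
for the worst initial positions: the expectation of the first time at which the set of occupied
vertices has exactly one element. The coalescing time of `(P_t)_{t ≥ 1}` is the case
`m = |V|`. -/
def coalTime (P : ℕ → Matrix.rowStochastic ℝ V) (m : ℕ) : ℝ≥0∞ :=
  ⨆ x : Fin m → V,
    ∫⁻ C, firstTime (fun t => (Finset.univ.image (C t)).card = 1)
      ∂(chainLaw (fun t => coalKernel (P (t + 1)) m) x)

end Stochastic

/-! ### The lazy Metropolis walk -/

section Metropolis

variable {V : Type*} [Fintype V] [DecidableEq V]

open scoped Classical in
/-- The transition matrix `P_LM(G)` of the lazy Metropolis walk on `G`. -/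
def metropolisMatrix (G : SimpleGraph V) : Matrix V V ℝ := fun u v =>
  if G.Adj u v then 1 / (2 * max (G.degree u : ℝ) (G.degree v))
  else if u = v then
    1 - ∑ w ∈ G.neighborFinset u, 1 / (2 * max (G.degree u : ℝ) (G.degree w))
  else 0

theorem metropolisMatrix_mem (G : SimpleGraph V) :
    metropolisMatrix G ∈ Matrix.rowStochastic ℝ V := by
  classical
  rw [Matrix.mem_rowStochastic_iff_sum]
  constructor
  · intro u v
    unfold metropolisMatrix
    split_ifs with h1 h2
    · positivity
    · have hle : ∑ w ∈ G.neighborFinset u, 1 / (2 * max (G.degree u : ℝ) (G.degree w)) ≤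
          ∑ w ∈ G.neighborFinset u, 1 / (G.degree u : ℝ) := by
        refine Finset.sum_le_sum fun w hw => ?_
        have hpos : 0 < G.degree u :=
          (G.degree_pos_iff_exists_adj u).2 ⟨w, (G.mem_neighborFinset u w).1 hw⟩
        have hpos' : (0 : ℝ) < G.degree u := by exact_mod_cast hpos
        refine one_div_le_one_div_of_le hpos' ?_
        have := le_max_left (G.degree u : ℝ) (G.degree w)
        linarith
      have h1' : ∑ w ∈ G.neighborFinset u, 1 / (G.degree u : ℝ) ≤ 1 := by
        rw [Finset.sum_const, G.card_neighborFinset_eq_degree, nsmul_eq_mul, mul_one_div]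
        exact div_self_le_one _
      linarith
    · exact le_rfl
  · intro u
    have hsplit : ∀ v, metropolisMatrix G u v =
        (if v ∈ G.neighborFinset u then 1 / (2 * max (G.degree u : ℝ) (G.degree v)) else 0) +
        (if u = v then
          1 - ∑ w ∈ G.neighborFinset u, 1 / (2 * max (G.degree u : ℝ) (G.degree w)) else 0) := by
      intro v
      unfold metropolisMatrix
      by_cases h : G.Adj u v
      · have hne : u ≠ v := h.ne
        simp [h, hne]
      · simp [h]
    rw [Finset.sum_congr rfl fun v _ => hsplit v, Finset.sum_add_distrib]
    rw [Finset.sum_ite_mem, Finset.univ_inter, Finset.sum_ite_eq, if_pos (Finset.mem_univ u)]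
    ring

/-- `P_LM(G)` as a stochastic matrix. -/
def metropolis (G : SimpleGraph V) : Matrix.rowStochastic ℝ V :=
  ⟨metropolisMatrix G, metropolisMatrix_mem G⟩

end Metropolis

/-! ### The edge-Markovian graph -/

/-- The two-state transition matrix of one potential edge; state `0` means absent, state `1`
means present. -/
def edgeMatrix (p q : I) : Matrix.rowStochastic ℝ (Fin 2) :=
  ⟨!![1 - (p : ℝ), (p : ℝ); (q : ℝ), 1 - (q : ℝ)], by
    rw [Matrix.mem_rowStochastic_iff_sum]
    constructor
    · intro i j
      have h1 := p.2.1
      have h2 := p.2.2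
      have h3 := q.2.1
      have h4 := q.2.2
      fin_cases i <;> fin_cases j <;> simp [h1, h2, h3, h4]
    · intro i
      fin_cases i <;> simp [Fin.sum_univ_two]⟩

section EdgeMarkovian

variable {V : Type*} [Fintype V] [DecidableEq V]

/-- The set of potential edges: unordered pairs of distinct vertices. -/
abbrev Pair (V : Type*) : Type _ := {e : Sym2 V // ¬ e.IsDiag}

open scoped Classical in
/-- The law of the edge-Markovian graph with parameters `p, q` and initial graph `G₀`, as the law
of the family of edge indicators `(Y_t(e))`: the chains `(Y_t(e))_{t ≥ 0}` of the different pairs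
`e` are independent Markov chains with transition matrix `edgeMatrix p q`, started at
`1` if `e` is an edge of `G₀` and at `0` otherwise. -/
def edgeMarkovianLaw (p q : I) (G₀ : SimpleGraph V) : Measure (Pair V → ℕ → Fin 2) :=
  Measure.pi fun e => walkLaw (fun _ => edgeMatrix p q) (if e.1 ∈ G₀.edgeSet then 1 else 0)

/-- The graph `G_t` whose edges are the pairs `e` with `Y_t(e) = 1`. -/
def graphAt (Y : Pair V → ℕ → Fin 2) (t : ℕ) : SimpleGraph V :=
  SimpleGraph.fromEdgeSet {e | ∃ h : ¬ e.IsDiag, Y ⟨e, h⟩ t = 1}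

end EdgeMarkovian

end

end DynamicWalk

namespace DynamicWalk

noncomputable section

/-! ### The Markov property of the chain -/

/-! Time is cut into blocks of length `L = T + W`, where `T = ⌈1/p⌉` is of the order of the mixing
term and `W` is a working window. Whatever the past, after `T` steps the edges are independent with
probabilities within a factor 2 of `ϖ = p/(p+q)` (`edgeMatrix_pow_bounds`). Chernoff bounds for all
degrees and all cuts, with Cheeger's inequality, show that at each such time the Metropolis walk
contracts the variance by the constant rate `gapConst`, except with probability `3/n³`
(`indep_not_contracting_le_inv_cube`). As `W = O(n log n)`, a block is good, i.e. contracts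
throughout its window, except with conditional probability `O(log n / n²)`.

For fixed graphs, it is enough that one good block succeeds with probability at least 1/2 from any
configuration. The failure probability after `j` blocks is then at most `discount j`, the product of
1/2 over the good blocks, and the expected time is at most `L ∑ discount j`. Since the discounts
exceed `2^{-j}` only through bad blocks, their sum is at most 3 with high probability
(`measure_discount_gt_le`). So all three quantities are at most `3L`, for three different windows.

The success in a good block comes from `avoid_le_exp`: after `O(log n)` burn-in steps, a walk avoids
an arbitrarily moving target for `s` steps with probability at most `exp(-γs/(4n))`. The function of
avoidance probabilities vanishes at the target, so its variance is at least `1/n` of its second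
moment, and contraction of the variance by `1-γ` shrinks the second moment by `1-γ/n`. For hitting,
`k` independent walks and `s` of order `n/k` suffice; for covering, `s` of order `n log n / k` and a
union bound over vertices.

For coalescence, the occupied set is pushed forward by independent random maps. Among the occupied
vertices `m` hunters are chosen and only meetings with hunters are counted. Given the trajectory of
another walker, the hunters avoid it independently, so it survives with probability at most `α^m`.
Taking `m = 2^j` and windows of order `n/2^j` for `j` decreasing to 0, the lengths sum to `O(n)`,
the `O(log n)` burn-ins add only `O(log² n)`, and the expected number of surplus walkers ends below
1/2. -/

theorem exists_comp_frestrictLe {S β : Type*} {f : (ℕ → S) → β} {n : ℕ}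
    (hf : DependsOn f (Set.Iic n)) (x : S) :
    ∃ F : (Finset.Iic n → S) → β, ∀ X, f X = F (Preorder.frestrictLe (π := fun _ => S) n X) := by
  refine ⟨fun z => f fun i => if h : i ≤ n then z ⟨i, Finset.mem_Iic.2 h⟩ else x, fun X => ?_⟩
  refine hf fun i hi => ?_
  have hi' : i ≤ n := hi
  simp [hi']

section Chain

variable {S : Type*} [Finite S] [MeasurableSpace S] [MeasurableSingletonClass S]

/-- This is the one-step Markov property: in the Ionescu-Tulcea construction the joint law of the
path up to `n` and of the next position is the composition product of the path law with `κ n`. -/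
theorem lintegral_chainLaw_succ (κ : ℕ → Kernel S S) [∀ t, IsMarkovKernel (κ t)] (x : S) {n : ℕ}
    {f : (ℕ → S) → ℝ≥0∞} (hf : DependsOn f (Set.Iic n)) (g : S → ℝ≥0∞) :
    ∫⁻ X, f X * g (X (n + 1)) ∂chainLaw κ x =
      ∫⁻ X, f X * ∫⁻ y, g y ∂κ n (X n) ∂chainLaw κ x := by
  obtain ⟨F, hF⟩ := exists_comp_frestrictLe hf x
  set η : (t : ℕ) → Kernel ((i : Finset.Iic t) → S) S := fun t =>
    (κ t).comap (fun h : (i : Finset.Iic t) → S => h ⟨t, Finset.mem_Iic.2 le_rfl⟩)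
      (measurable_pi_apply _) with hη
  have key := Kernel.partialTraj_compProd_eq_map_traj (X := fun _ => S) (κ := η) (Nat.zero_le n)
    (x₀ := fun _ => x)
  have hmap := Kernel.traj_map_frestrictLe_apply (X := fun _ => S) (κ := η) 0 n (fun _ => x)
  have hm1 : Measurable fun X : ℕ → S =>
      (Preorder.frestrictLe (π := fun _ => S) n X, X (n + 1)) :=
    (Preorder.measurable_frestrictLe n).prodMk (measurable_pi_apply _)
  have e1 : ∫⁻ X, f X * g (X (n + 1)) ∂chainLaw κ x =
      ∫⁻ z, F z.1 * g z.2 ∂((Kernel.traj (X := fun _ => S) η 0 fun _ => x).map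
        fun X : ℕ → S => (Preorder.frestrictLe (π := fun _ => S) n X, X (n + 1))) := by
    rw [lintegral_map Measurable.of_discrete hm1]
    simp only [hF]
    rfl
  rw [e1, ← key, Measure.lintegral_compProd Measurable.of_discrete, ← hmap,
    lintegral_map Measurable.of_discrete (Preorder.measurable_frestrictLe n)]
  simp only [hF]
  refine lintegral_congr fun X => ?_
  rw [lintegral_const_mul _ Measurable.of_discrete]
  rfl

open scoped Classical in
/-- Along times `a, …, a + r`, a supersolution `v` bounds the probability of staying in the
sets `A t`. -/
theorem lintegral_stay_le (κ : ℕ → Kernel S S) [∀ t, IsMarkovKernel (κ t)] (x : S) {a : ℕ}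
    {f : (ℕ → S) → ℝ≥0∞} (hf : DependsOn f (Set.Iic a)) (A : ℕ → Set S) (v : ℕ → S → ℝ≥0∞)
    (r : ℕ)
    (hv : ∀ t, a ≤ t → t < a + r → ∀ y ∈ A t, ∫⁻ z, v (t + 1) z ∂κ t y ≤ v t y) :
    ∫⁻ X, f X * (if ∀ t, a ≤ t → t < a + r → X t ∈ A t then v (a + r) (X (a + r)) else 0)
        ∂chainLaw κ x ≤
      ∫⁻ X, f X * v a (X a) ∂chainLaw κ x := by
  induction r with
  | zero => exact lintegral_mono fun X => by split_ifs <;> simp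
  | succ r ih =>
    refine le_trans ?_ (ih fun t h1 h2 => hv t h1 (by omega))
    have hdep : DependsOn (fun X : ℕ → S => f X *
        (if ∀ t, a ≤ t → t < a + (r + 1) → X t ∈ A t then 1 else 0)) (Set.Iic (a + r)) := by
      intro X Y hXY
      have h1 : f X = f Y := hf fun i hi => hXY i (le_trans hi (Nat.le_add_right a r))
      have h2 : (∀ t, a ≤ t → t < a + (r + 1) → X t ∈ A t) ↔
          (∀ t, a ≤ t → t < a + (r + 1) → Y t ∈ A t) := by
        refine forall_congr' fun t => forall_congr' fun _ => forall_congr' fun h => ?_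
        rw [hXY t (show t ≤ a + r by omega)]
      simp only [h1, h2]
    -- The staying event up to time `a + r` belongs to the past, so the Markov property replaces `v
    -- (a + r + 1)` by its average under the kernel, which is at most `v (a + r)` on `A (a + r)`.
    have := lintegral_chainLaw_succ κ x hdep (v (a + r + 1))
    calc _ = ∫⁻ X, (f X * (if ∀ t, a ≤ t → t < a + (r + 1) → X t ∈ A t then 1 else 0)) *
            v (a + r + 1) (X (a + r + 1)) ∂chainLaw κ x := by
          refine lintegral_congr fun X => ?_
          split_ifs <;> simp [add_assoc]
      _ ≤ _ := by
          rw [this]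
          refine lintegral_mono fun X => ?_
          split_ifs with h1 h2 h2
          · rw [mul_one]
            exact mul_le_mul_right (hv (a + r) (by omega) (by omega) _
              (h1 (a + r) (by omega) (by omega))) _
          · exact absurd (fun t h3 h4 => h1 t h3 (by omega)) h2
          · simp
          · simp

end Chain

/-! ### Expected first times -/

open scoped Classical in
-- `A` is tested only at multiples of `L`, and the sum counts the failed tests before the first
-- success. No monotonicity of `A` is needed.
theorem firstTime_le_tsum (A : ℕ → Prop) (L : ℕ) (hL : 0 < L) :
    firstTime A ≤ (L : ℝ≥0∞) * ∑' j : ℕ, if ∀ i ≤ j, ¬ A (i * L) then (1 : ℝ≥0∞) else 0 := by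
  by_cases h : ∃ j, A (j * L)
  · let J := Nat.find h
    have h1 : firstTime A ≤ ((J * L : ℕ) : ℝ≥0∞) := iInf₂_le _ (Nat.find_spec h)
    refine h1.trans ?_
    have h2 : ((J : ℕ) : ℝ≥0∞) ≤
        ∑' j : ℕ, if ∀ i ≤ j, ¬ A (i * L) then (1 : ℝ≥0∞) else 0 := by
      refine le_trans (le_of_eq ?_) (ENNReal.sum_le_tsum (Finset.range J))
      rw [Finset.sum_congr rfl fun j hj => if_pos fun i hi =>
        Nat.find_min h (lt_of_le_of_lt hi (Finset.mem_range.1 hj))]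
      simp [J]
    push_cast
    rw [mul_comm]
    exact mul_le_mul_right h2 _
  · have h' : ∀ j, ¬ A (j * L) := fun j hj => h ⟨j, hj⟩
    have : ∑' j : ℕ, (if ∀ i ≤ j, ¬ A (i * L) then (1 : ℝ≥0∞) else 0) = ∞ := by
      rw [show (fun j : ℕ => if ∀ i ≤ j, ¬ A (i * L) then (1 : ℝ≥0∞) else 0) = fun _ => 1 from
        funext fun j => if_pos fun i _ => h' i]
      exact ENNReal.tsum_const_eq_top_of_ne_zero one_ne_zero
    rw [this, ENNReal.mul_top (by simpa using hL.ne')]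
    exact le_top

open scoped Classical in
theorem lintegral_firstTime_le {Ω : Type*} [MeasurableSpace Ω] (μ : Measure Ω)
    (A : Ω → ℕ → Prop) (hA : ∀ t, MeasurableSet {ω | A ω t}) (L : ℕ) (hL : 0 < L) :
    ∫⁻ ω, firstTime (A ω) ∂μ ≤ L * ∑' j : ℕ, μ {ω | ∀ i ≤ j, ¬ A ω (i * L)} := by
  have hm : ∀ j : ℕ, MeasurableSet {ω | ∀ i ≤ j, ¬ A ω (i * L)} := fun j => by
    simp only [Set.ofPred_forall]
    exact MeasurableSet.iInter fun i => MeasurableSet.iInter fun _ => (hA _).compl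
  refine (lintegral_mono fun ω => firstTime_le_tsum (A ω) L hL).trans (le_of_eq ?_)
  have hi : ∀ j : ℕ, (fun ω => if ∀ i ≤ j, ¬ A ω (i * L) then (1 : ℝ≥0∞) else 0) =
      Set.indicator {ω | ∀ i ≤ j, ¬ A ω (i * L)} 1 := fun j => by
    ext ω; simp [Set.indicator]
  have hmi : ∀ j : ℕ, Measurable fun ω => if ∀ i ≤ j, ¬ A ω (i * L) then (1 : ℝ≥0∞) else 0 :=
    fun j => by rw [hi]; exact measurable_one.indicator (hm j)
  rw [lintegral_const_mul _ (Measurable.tsum hmi),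
    lintegral_tsum fun j => (hmi j).aemeasurable]
  simp_rw [hi]
  congr 2
  ext j
  exact lintegral_indicator_one (hm j)

/-! ### Walks avoiding a moving target -/

section Avoid

variable {V : Type*} [Fintype V] [DecidableEq V]

/-- A matrix preserving sums which contracts the variance by the factor `1 - γ`. -/
def Contracting (γ : ℝ) (P : Matrix V V ℝ) : Prop :=
  (∀ f : V → ℝ, ∑ x, P.mulVec f x = ∑ x, f x) ∧
    ∀ f : V → ℝ, ∑ x, P.mulVec f x ^ 2 ≤
      ∑ x, f x ^ 2 - γ * (∑ x, f x ^ 2 - (∑ x, f x) ^ 2 / Fintype.card V)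

/-- The probability that the walk started at `x` at time `t` differs from `h` at all times in
`[t, t + r]` that are at least `c`. -/
def avoid (P : ℕ → Matrix.rowStochastic ℝ V) (c : ℕ) (h : ℕ → V) : ℕ → ℕ → V → ℝ
  | t, 0, x => if c ≤ t ∧ x = h t then 0 else 1
  | t, r + 1, x => if c ≤ t ∧ x = h t then 0 else (P (t + 1)).1.mulVec (avoid P c h (t + 1) r) x

theorem rowStochastic_mulVec_nonneg (P : Matrix.rowStochastic ℝ V) {f : V → ℝ}
    (hf : ∀ x, 0 ≤ f x) (x : V) : 0 ≤ P.1.mulVec f x :=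
  Finset.sum_nonneg fun y _ => mul_nonneg (Matrix.nonneg_of_mem_rowStochastic P.2) (hf y)

theorem rowStochastic_mulVec_le (P : Matrix.rowStochastic ℝ V) {f : V → ℝ} {C : ℝ}
    (hf : ∀ x, f x ≤ C) (x : V) : P.1.mulVec f x ≤ C := by
  calc P.1.mulVec f x ≤ ∑ y, P.1 x y * C :=
        Finset.sum_le_sum fun y _ =>
          mul_le_mul_of_nonneg_left (hf y) (Matrix.nonneg_of_mem_rowStochastic P.2)
    _ = C := by rw [← Finset.sum_mul, Matrix.sum_row_of_mem_rowStochastic P.2, one_mul]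

variable (P : ℕ → Matrix.rowStochastic ℝ V) (c : ℕ) (h : ℕ → V)

theorem avoid_nonneg (r t : ℕ) (x : V) : 0 ≤ avoid P c h t r x := by
  induction r generalizing t x with
  | zero => unfold avoid; split_ifs <;> norm_num
  | succ r ih =>
    unfold avoid
    split_ifs
    · exact le_rfl
    · exact rowStochastic_mulVec_nonneg _ (ih (t + 1)) x

theorem avoid_le_one (r t : ℕ) (x : V) : avoid P c h t r x ≤ 1 := by
  induction r generalizing t x with
  | zero => unfold avoid; split_ifs <;> norm_num
  | succ r ih =>
    unfold avoid
    split_ifs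
    · exact zero_le_one
    · exact rowStochastic_mulVec_le _ (ih (t + 1)) x

theorem avoid_target {r t : ℕ} (hc : c ≤ t) : avoid P c h t r (h t) = 0 := by
  cases r <;> simp [avoid, hc]

theorem avoid_of_lt {r t : ℕ} (hc : t < c) :
    avoid P c h t (r + 1) = (P (t + 1)).1.mulVec (avoid P c h (t + 1) r) := by
  ext x
  simp [avoid, hc.not_ge]

/-- Cauchy–Schwarz on the remaining `n - 1` points. Equivalently, the variance is at least `1/n` of
the second moment. -/
theorem sq_sum_le_of_eq_zero {f : V → ℝ} {z : V} (hz : f z = 0) :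
    (∑ x, f x) ^ 2 ≤ (Fintype.card V - 1 : ℝ) * ∑ x, f x ^ 2 := by
  have h1 : ∑ x, f x = ∑ x ∈ Finset.univ.erase z, f x := by
    rw [← Finset.add_sum_erase _ _ (Finset.mem_univ z), hz, zero_add]
  have h2 : ∑ x, f x ^ 2 = ∑ x ∈ Finset.univ.erase z, f x ^ 2 := by
    rw [← Finset.add_sum_erase _ _ (Finset.mem_univ z), hz]; simp
  have h3 := sq_sum_le_card_mul_sum_sq (s := Finset.univ.erase z) (f := f)
  have h4 : ((Finset.univ.erase z).card : ℝ) = Fintype.card V - 1 := by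
    rw [Finset.card_erase_of_mem (Finset.mem_univ z), Finset.card_univ,
      Nat.cast_pred (Fintype.card_pos_iff.2 ⟨z⟩)]
  rw [h1, h2, ← h4]
  exact h3

variable {P c h} {γ : ℝ}

/-- At every step the function being averaged vanishes at the current target, so contraction of the
variance becomes contraction of the second moment by `1 - γ/n`. Nothing is asked of the motion of
the target. -/
theorem sum_avoid_sq_le (hγ0 : 0 < γ) (hγ1 : γ ≤ 1) (r t : ℕ) (hc : c ≤ t)
    (hP : ∀ s, t < s → s ≤ t + r → Contracting γ (P s).1) :
    ∑ x, avoid P c h t r x ^ 2 ≤ Fintype.card V * (1 - γ / Fintype.card V) ^ r := by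
  have hn : (0 : ℝ) < Fintype.card V := by exact_mod_cast Fintype.card_pos_iff.2 ⟨h 0⟩
  have hn1 : (1 : ℝ) ≤ Fintype.card V := by exact_mod_cast Fintype.card_pos_iff.2 ⟨h 0⟩
  induction r generalizing t with
  | zero =>
    calc ∑ x, avoid P c h t 0 x ^ 2 ≤ ∑ _x : V, (1 : ℝ) :=
          Finset.sum_le_sum fun x _ => pow_le_one₀ (avoid_nonneg ..) (avoid_le_one ..)
      _ = _ := by simp
  | succ r ih =>
    set f := avoid P c h (t + 1) r with hf
    have ih' := ih (t + 1) (by omega) fun s h1 h2 => hP s (by omega) (by omega)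
    have h1 : ∑ x, avoid P c h t (r + 1) x ^ 2 ≤ ∑ x, (P (t + 1)).1.mulVec f x ^ 2 := by
      refine Finset.sum_le_sum fun x _ => ?_
      unfold avoid
      split_ifs
      · simpa using sq_nonneg _
      · exact le_rfl
    have h2 := (hP (t + 1) (by omega) (by omega)).2 f
    have h3 : (∑ x, f x) ^ 2 / Fintype.card V ≤
        (Fintype.card V - 1 : ℝ) * (∑ x, f x ^ 2) / Fintype.card V := by
      gcongr
      exact sq_sum_le_of_eq_zero (avoid_target P c h (by omega))
    have h4 : (Fintype.card V - 1 : ℝ) * (∑ x, f x ^ 2) / Fintype.card V =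
        (∑ x, f x ^ 2) - (∑ x, f x ^ 2) / Fintype.card V := by field_simp
    have hfac : 0 ≤ 1 - γ / Fintype.card V := by
      rw [sub_nonneg, div_le_one hn]; linarith
    calc _ ≤ (1 - γ / Fintype.card V) * ∑ x, f x ^ 2 := by
          refine h1.trans (h2.trans ?_)
          have : γ * ((∑ x, f x ^ 2) / Fintype.card V) ≤
              γ * (∑ x, f x ^ 2 - (∑ x, f x) ^ 2 / Fintype.card V) :=
            mul_le_mul_of_nonneg_left (by linarith) hγ0.le
          have e : (1 - γ / Fintype.card V) * ∑ x, f x ^ 2 =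
            ∑ x, f x ^ 2 - γ * ((∑ x, f x ^ 2) / Fintype.card V) := by ring
          linarith
      _ ≤ (1 - γ / Fintype.card V) * (Fintype.card V * (1 - γ / Fintype.card V) ^ r) :=
          mul_le_mul_of_nonneg_left ih' hfac
      _ = _ := by ring

/-- Before time `c` the target is ignored, so these steps keep the mean and contract the variance by
the full factor. They make the avoidance probability nearly independent of the starting vertex. -/
theorem avoid_free (hγ1 : γ ≤ 1) (s ℓ t : ℕ) (htc : t + ℓ = c)
    (hP : ∀ u, t < u → u ≤ t + ℓ → Contracting γ (P u).1) :
    ∑ x, avoid P c h t (ℓ + s) x = ∑ x, avoid P c h c s x ∧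
      ∑ x, avoid P c h t (ℓ + s) x ^ 2 -
          (∑ x, avoid P c h t (ℓ + s) x) ^ 2 / Fintype.card V ≤
        (1 - γ) ^ ℓ * (∑ x, avoid P c h c s x ^ 2 -
          (∑ x, avoid P c h c s x) ^ 2 / Fintype.card V) := by
  induction ℓ generalizing t with
  | zero =>
    obtain rfl : t = c := by omega
    simp
  | succ ℓ ih =>
    obtain ⟨ih1, ih2⟩ := ih (t + 1) (by omega) fun u h1 h2 => hP u (by omega) (by omega)
    have hg := hP (t + 1) (by omega) (by omega)
    rw [show ℓ + 1 + s = (ℓ + s) + 1 by ring, avoid_of_lt P c h (by omega), hg.1]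
    refine ⟨ih1, ?_⟩
    have := hg.2 (avoid P c h (t + 1) (ℓ + s))
    calc _ ≤ (1 - γ) * (∑ x, avoid P c h (t + 1) (ℓ + s) x ^ 2 -
          (∑ x, avoid P c h (t + 1) (ℓ + s) x) ^ 2 / Fintype.card V) := by linarith
      _ ≤ (1 - γ) * _ := mul_le_mul_of_nonneg_left ih2 (by linarith)
      _ = _ := by ring

/-- After `ℓ` free steps, a walk avoids a moving target for `s` further steps with
probability at most `exp (-γ s / (4 |V|))`. -/
theorem avoid_le_exp (hγ0 : 0 < γ) (hγ1 : γ ≤ 1) {a ℓ s : ℕ} (hs : 1 ≤ s)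
    (hℓ : Fintype.card V * (1 - γ) ^ ℓ ≤ (γ / (4 * Fintype.card V)) ^ 2)
    (hP : ∀ u, a < u → u ≤ a + (ℓ + s) → Contracting γ (P u).1) (x : V) :
    avoid P (a + ℓ) h a (ℓ + s) x ≤ Real.exp (-(γ * s / (4 * Fintype.card V))) := by
  have hn : (0 : ℝ) < Fintype.card V := by exact_mod_cast Fintype.card_pos_iff.2 ⟨x⟩
  set n : ℝ := (Fintype.card V : ℝ) with hn'
  obtain ⟨h1, h2⟩ := avoid_free (P := P) (h := h) hγ1 s ℓ a rfl
    fun u h1 h2 => hP u h1 (by omega)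
  have h3 := sum_avoid_sq_le (P := P) (c := a + ℓ) (h := h) hγ0 hγ1 s (a + ℓ) le_rfl
    fun u h1 h2 => hP u (by omega) (by omega)
  set f := avoid P (a + ℓ) h a (ℓ + s)
  set g := avoid P (a + ℓ) h (a + ℓ) s
  have hn1 : (1 : ℝ) ≤ n := by rw [hn']; exact_mod_cast Fintype.card_pos_iff.2 ⟨x⟩
  have hq0 : 0 ≤ 1 - γ / n := by rw [sub_nonneg, div_le_one hn]; linarith
  set ρ := (1 - γ / n) ^ s with hρ
  have hρ0 : 0 ≤ ρ := pow_nonneg hq0 s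
  -- The mean is the avoidance probability from a uniform start; Cauchy–Schwarz bounds it by the
  -- second moment.
  have hmean : (∑ y, f y) / n ≤ √ρ := by
    refine Real.le_sqrt_of_sq_le ?_
    have := sq_sum_le_card_mul_sum_sq (s := Finset.univ) (f := g)
    rw [Finset.card_univ] at this
    rw [h1, div_pow, div_le_iff₀ (by positivity)]
    calc _ ≤ n * ∑ y, g y ^ 2 := this
      _ ≤ n * (n * ρ) := by gcongr
      _ = _ := by ring
  have hvar : (f x - (∑ y, f y) / n) ^ 2 ≤
      ∑ y, f y ^ 2 - (∑ y, f y) ^ 2 / n := by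
    have e : ∑ y, (f y - (∑ z, f z) / n) ^ 2 = ∑ y, f y ^ 2 - (∑ y, f y) ^ 2 / n := by
      simp_rw [sub_sq, Finset.sum_add_distrib, Finset.sum_sub_distrib, ← Finset.sum_mul,
        ← Finset.mul_sum, Finset.sum_const, Finset.card_univ, nsmul_eq_mul, ← hn']
      field_simp
      ring
    rw [← e]
    exact Finset.single_le_sum (f := fun y => (f y - (∑ z, f z) / n) ^ 2)
      (fun y _ => sq_nonneg _) (Finset.mem_univ x)
  -- The burn-in length is chosen so that the deviation from the mean is a small multiple of the
  -- bound `√ρ` for the mean itself, not merely small in absolute terms.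
  have hdev : f x - (∑ y, f y) / n ≤ √ρ * (γ / (4 * n)) := by
    have hD : (f x - (∑ y, f y) / n) ^ 2 ≤ ρ * (γ / (4 * n)) ^ 2 := by
      refine hvar.trans (h2.trans ?_)
      have hg : ∑ y, g y ^ 2 - (∑ y, g y) ^ 2 / n ≤ n * ρ := by
        have : 0 ≤ (∑ y, g y) ^ 2 / n := by positivity
        linarith
      calc _ ≤ (1 - γ) ^ ℓ * (n * ρ) :=
            mul_le_mul_of_nonneg_left hg (pow_nonneg (by linarith) _)
        _ = ρ * (n * (1 - γ) ^ ℓ) := by ring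
        _ ≤ _ := mul_le_mul_of_nonneg_left hℓ hρ0
    have hpos : 0 ≤ γ / (4 * n) := by positivity
    refine le_of_sq_le_sq ?_ (by positivity)
    rw [mul_pow, Real.sq_sqrt hρ0]
    exact hD
  have hρe : √ρ ≤ Real.exp (-(γ * s / (2 * n))) := by
    rw [Real.sqrt_le_left (Real.exp_nonneg _), ← Real.exp_nat_mul]
    calc ρ ≤ (Real.exp (-(γ / n))) ^ s := by
          refine pow_le_pow_left₀ hq0 ?_ s
          have := Real.add_one_le_exp (-(γ / n))
          linarith
      _ = _ := by
          rw [← Real.exp_nat_mul]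
          congr 1
          push_cast
          field_simp
  -- The extra factor costs at most half of the exponent `γ s / (2n)`, because `s ≥ 1`.
  calc f x ≤ √ρ * (1 + γ / (4 * n)) := by linarith
    _ ≤ Real.exp (-(γ * s / (2 * n))) * Real.exp (γ / (4 * n)) := by
        refine mul_le_mul hρe ?_ (by positivity) (Real.exp_nonneg _)
        have := Real.add_one_le_exp (γ / (4 * n))
        linarith
    _ ≤ _ := by
        rw [← Real.exp_add, Real.exp_le_exp]
        have hs' : (1 : ℝ) ≤ s := by exact_mod_cast hs
        have : γ / (4 * n) * 1 ≤ γ / (4 * n) * s := by gcongr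
        have e1 : γ * s / (2 * n) = 2 * (γ / (4 * n) * s) := by field_simp; ring
        have e2 : γ * s / (4 * n) = γ / (4 * n) * s := by ring
        rw [e1, e2]
        linarith

end Avoid

/-! ### Cheeger's inequality -/

section Cheeger

variable {V : Type*} [Fintype V] [DecidableEq V]

/-- Layer-cake argument by induction on the size of the support: the lowest positive level is peeled
off and the conductance bound is applied to the support, which has at most half of the vertices. -/
theorem conductance_coarea {P : V → V → ℝ} {φ : ℝ}
    (hφ : ∀ S : Finset V, 2 * S.card ≤ Fintype.card V → φ * S.card ≤ ∑ u ∈ S, ∑ v ∈ Sᶜ, P u v)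
    (N : ℕ) (F : V → ℝ) (hF : ∀ x, 0 ≤ F x)
    (hcard : (Finset.univ.filter fun x => F x ≠ 0).card ≤ N)
    (hN : 2 * (Finset.univ.filter fun x => F x ≠ 0).card ≤ Fintype.card V) :
    φ * ∑ x, F x ≤ ∑ u, ∑ v, P u v * max (F u - F v) 0 := by
  induction N generalizing F with
  | zero =>
    have h0 : ∀ x, F x = 0 := by
      intro x
      by_contra hx
      have : x ∈ Finset.univ.filter fun x => F x ≠ 0 := by simp [hx]
      rw [Finset.card_eq_zero.1 (Nat.le_zero.1 hcard)] at this
      simp at this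
    simp [h0]
  | succ N ih =>
    set S := Finset.univ.filter fun x => F x ≠ 0 with hS
    rcases S.eq_empty_or_nonempty with hSe | hSn
    · exact ih F hF (by simp [← hS, hSe]) hN
    obtain ⟨z, hz, hmin⟩ := S.exists_min_image F hSn
    have hmem : ∀ x, x ∈ S ↔ F x ≠ 0 := fun x => by simp [hS]
    set F' : V → ℝ := fun x => F x - if x ∈ S then F z else 0 with hF'
    have hF'0 : ∀ x, 0 ≤ F' x := fun x => by
      by_cases hx : x ∈ S
      · simp [hF', hx, hmin x hx]
      · simp [hF', hx, hF x]
    have hsub : (Finset.univ.filter fun x => F' x ≠ 0) ⊆ S.erase z := by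
      intro x hx
      simp only [Finset.mem_filter, Finset.mem_univ, true_and] at hx
      rw [Finset.mem_erase]
      by_cases hxS : x ∈ S
      · refine ⟨fun h => hx ?_, hxS⟩
        subst h
        simp [hF', hz]
      · have : F x = 0 := by by_contra h; exact hxS ((hmem x).2 h)
        exact absurd (by simp [hF', hxS, this]) hx
    have hlt : (Finset.univ.filter fun x => F' x ≠ 0).card < S.card :=
      lt_of_le_of_lt (Finset.card_le_card hsub) (Finset.card_erase_lt_of_mem hz)
    have ih' := ih F' hF'0 (by omega) (by omega)
    -- Lowering `F` on its support by the minimal value `F z` changes the positive differences only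
    -- across the boundary of the support.
    have hpt : ∀ u v, max (F u - F v) 0 =
        max (F' u - F' v) 0 + if u ∈ S ∧ v ∈ Sᶜ then F z else 0 := by
      intro u v
      have hFz := hF z
      by_cases hu : u ∈ S <;> by_cases hv : v ∈ S
      · simp [hF', hu, hv]
      · have hv0 : F v = 0 := by by_contra h; exact hv ((hmem v).2 h)
        have := hmin u hu
        simp only [hF', hu, hv, hv0, Finset.mem_compl, if_true, if_false, not_false_eq_true,
          and_self, sub_zero]
        rw [max_eq_left (hF u), max_eq_left (by linarith)]
        ring
      · have hu0 : F u = 0 := by by_contra h; exact hu ((hmem u).2 h)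
        have := hmin v hv
        have h3 := hF v
        simp only [hF', hu, hv, hu0, Finset.mem_compl, if_true, if_false, false_and, add_zero,
          sub_zero]
        rw [max_eq_right (by linarith), max_eq_right (by linarith)]
      · simp [hF', hu, hv]
    have hsumF : ∑ x, F x = ∑ x, F' x + F z * S.card := by
      simp [hF', Finset.sum_sub_distrib, Finset.sum_ite_mem, mul_comm]
    have hcut : ∑ u, ∑ v, P u v * (if u ∈ S ∧ v ∈ Sᶜ then F z else 0) =
        F z * ∑ u ∈ S, ∑ v ∈ Sᶜ, P u v := by
      rw [Finset.mul_sum, ← Finset.sum_filter_add_sum_filter_not Finset.univ (· ∈ S)]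
      rw [Finset.sum_eq_zero (s := Finset.univ.filter fun u => u ∉ S), add_zero,
        Finset.filter_mem_eq_inter, Finset.univ_inter]
      · refine Finset.sum_congr rfl fun u hu => ?_
        rw [Finset.mul_sum, ← Finset.sum_filter_add_sum_filter_not Finset.univ (· ∈ Sᶜ)]
        rw [Finset.sum_eq_zero (s := Finset.univ.filter fun u => u ∉ Sᶜ), add_zero,
          Finset.filter_mem_eq_inter, Finset.univ_inter]
        · refine Finset.sum_congr rfl fun v hv => ?_
          rw [if_pos ⟨hu, hv⟩, mul_comm]
        · intro v hv
          rw [if_neg fun h => (Finset.mem_filter.1 hv).2 h.2, mul_zero]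
      · intro u hu
        refine Finset.sum_eq_zero fun v _ => ?_
        rw [if_neg fun h => (Finset.mem_filter.1 hu).2 h.1, mul_zero]
    have := mul_le_mul_of_nonneg_left (hφ S hN) (hF z)
    calc φ * ∑ x, F x = φ * ∑ x, F' x + F z * (φ * S.card) := by rw [hsumF]; ring
      _ ≤ _ + F z * ∑ u ∈ S, ∑ v ∈ Sᶜ, P u v := add_le_add ih' this
      _ = _ := by
        simp_rw [hpt, mul_add, Finset.sum_add_distrib]
        rw [hcut]

/-- The median is the least value of `f` with at most half of the vertices strictly above it. -/
theorem exists_median (f : V → ℝ) [Nonempty V] :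
    ∃ m : ℝ, 2 * (Finset.univ.filter fun x => m < f x).card ≤ Fintype.card V ∧
      2 * (Finset.univ.filter fun x => f x < m).card ≤ Fintype.card V := by
  set T := Finset.univ.filter fun x =>
    2 * (Finset.univ.filter fun y => f x < f y).card ≤ Fintype.card V with hT
  have hTn : T.Nonempty := by
    obtain ⟨z, -, hz⟩ := Finset.univ.exists_max_image f Finset.univ_nonempty
    refine ⟨z, ?_⟩
    have : (Finset.univ.filter fun y => f z < f y) = ∅ := by
      ext y; simpa using hz y (Finset.mem_univ y)
    simp [hT, this]
  obtain ⟨x, hx, hmin⟩ := T.exists_min_image f hTn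
  refine ⟨f x, (Finset.mem_filter.1 hx).2, ?_⟩
  by_contra hcon
  push Not at hcon
  have hne : (Finset.univ.filter fun y => f y < f x).Nonempty := by
    rw [← Finset.card_pos]; omega
  obtain ⟨y, hy, hmax⟩ := Finset.exists_max_image _ f hne
  have hy' : f y < f x := (Finset.mem_filter.1 hy).2
  have hyT : y ∈ T := by
    rw [hT, Finset.mem_filter]
    refine ⟨Finset.mem_univ _, ?_⟩
    have hsub : (Finset.univ.filter fun z => f y < f z) ⊆
        (Finset.univ.filter fun z => f z < f x)ᶜ := by
      intro z hz
      rw [Finset.mem_compl]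
      intro hz'
      exact absurd (Finset.mem_filter.1 hz).2 (not_lt.2 (hmax z hz'))
    have := Finset.card_le_card hsub
    rw [Finset.card_compl] at this
    omega
  exact absurd hy' (not_lt.2 (hmin y hyT))

variable {P : Matrix V V ℝ} {φ : ℝ}

/-- The core of Cheeger's inequality: apply the coarea bound to `g²`, factor `g(u)² - g(v)²`, and
use Cauchy–Schwarz with `∑ P (g(u) + g(v))² ≤ 4 ∑ g²`. -/
theorem sum_sq_le_energy (hP : P ∈ Matrix.rowStochastic ℝ V) (hsymm : ∀ u v, P u v = P v u)
    (hφ0 : 0 ≤ φ)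
    (hφ : ∀ S : Finset V, 2 * S.card ≤ Fintype.card V → φ * S.card ≤ ∑ u ∈ S, ∑ v ∈ Sᶜ, P u v)
    (g : V → ℝ) (hg : ∀ x, 0 ≤ g x)
    (hN : 2 * (Finset.univ.filter fun x => g x ≠ 0).card ≤ Fintype.card V) :
    φ ^ 2 / 4 * ∑ x, g x ^ 2 ≤ ∑ u, ∑ v, P u v * (g u - g v) ^ 2 := by
  have hP0 : ∀ u v, 0 ≤ P u v := fun u v => Matrix.nonneg_of_mem_rowStochastic hP
  have hrow : ∀ u, ∑ v, P u v = 1 := fun u => Matrix.sum_row_of_mem_rowStochastic hP u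
  have hcol : ∀ v, ∑ u, P u v = 1 := fun v => by simp_rw [fun u => hsymm u v]; exact hrow v
  set Q := ∑ x, g x ^ 2 with hQ
  have hQ0 : 0 ≤ Q := Finset.sum_nonneg fun x _ => sq_nonneg _
  have h1 := conductance_coarea hφ _ (fun x => g x ^ 2) (fun x => sq_nonneg _) le_rfl
    (by simpa using hN)
  have h2 : ∑ u, ∑ v, P u v * max (g u ^ 2 - g v ^ 2) 0 ≤
      ∑ u, ∑ v, (√(P u v) * |g u - g v|) * (√(P u v) * (g u + g v)) := by
    refine Finset.sum_le_sum fun u _ => Finset.sum_le_sum fun v _ => ?_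
    have e : (√(P u v) * |g u - g v|) * (√(P u v) * (g u + g v)) =
        P u v * (|g u - g v| * (g u + g v)) := by
      linear_combination (|g u - g v| * (g u + g v)) * Real.mul_self_sqrt (hP0 u v)
    rw [e]
    refine mul_le_mul_of_nonneg_left (max_le ?_ ?_) (hP0 u v)
    · rw [show g u ^ 2 - g v ^ 2 = (g u - g v) * (g u + g v) by ring]
      exact mul_le_mul_of_nonneg_right (le_abs_self _) (add_nonneg (hg u) (hg v))
    · exact mul_nonneg (abs_nonneg _) (add_nonneg (hg u) (hg v))
  have h3 : (∑ u, ∑ v, (√(P u v) * |g u - g v|) * (√(P u v) * (g u + g v))) ^ 2 ≤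
      (∑ u, ∑ v, P u v * (g u - g v) ^ 2) * ∑ u, ∑ v, P u v * (g u + g v) ^ 2 := by
    have := Finset.sum_mul_sq_le_sq_mul_sq (Finset.univ : Finset (V × V))
      (fun e => √(P e.1 e.2) * |g e.1 - g e.2|) (fun e => √(P e.1 e.2) * (g e.1 + g e.2))
    simp only [Fintype.sum_prod_type, mul_pow, sq_abs, Real.sq_sqrt (hP0 _ _)] at this
    exact this
  have h4 : ∑ u, ∑ v, P u v * (g u + g v) ^ 2 ≤ 4 * Q := by
    calc _ ≤ ∑ u, ∑ v, (P u v * (2 * g u ^ 2) + P u v * (2 * g v ^ 2)) := by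
          refine Finset.sum_le_sum fun u _ => Finset.sum_le_sum fun v _ => ?_
          rw [← mul_add]
          refine mul_le_mul_of_nonneg_left ?_ (hP0 u v)
          nlinarith [sq_nonneg (g u - g v)]
      _ = 4 * Q := by
          simp_rw [Finset.sum_add_distrib]
          rw [Finset.sum_comm (f := fun u v => P u v * (2 * g v ^ 2))]
          simp_rw [← Finset.sum_mul, hrow, hcol, one_mul, ← Finset.mul_sum]
          ring
  set E := ∑ u, ∑ v, P u v * (g u - g v) ^ 2 with hE
  have hE0 : 0 ≤ E := Finset.sum_nonneg fun u _ => Finset.sum_nonneg fun v _ =>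
    mul_nonneg (hP0 u v) (sq_nonneg _)
  have h5 : (φ * Q) ^ 2 ≤ E * (4 * Q) := by
    calc (φ * Q) ^ 2 ≤ _ := pow_le_pow_left₀ (mul_nonneg hφ0 hQ0) (h1.trans h2) 2
      _ ≤ _ := h3
      _ ≤ _ := mul_le_mul_of_nonneg_left h4 hE0
  rcases hQ0.eq_or_lt with h | h
  · rw [← h, mul_zero]; exact hE0
  · have : (φ ^ 2 / 4 * Q) * (4 * Q) ≤ E * (4 * Q) := by linarith
    exact le_of_mul_le_mul_right this (by positivity)

/-- After subtracting a median, the positive and negative parts each live on at most half of the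
vertices. Their second moments add up to at least the variance, and their energies to at most the
energy of `f`. -/
theorem variance_le_energy (hP : P ∈ Matrix.rowStochastic ℝ V) (hsymm : ∀ u v, P u v = P v u)
    (hφ0 : 0 ≤ φ)
    (hφ : ∀ S : Finset V, 2 * S.card ≤ Fintype.card V → φ * S.card ≤ ∑ u ∈ S, ∑ v ∈ Sᶜ, P u v)
    (f : V → ℝ) :
    φ ^ 2 / 4 * (∑ x, f x ^ 2 - (∑ x, f x) ^ 2 / Fintype.card V) ≤
      ∑ u, ∑ v, P u v * (f u - f v) ^ 2 := by
  have hP0 : ∀ u v, 0 ≤ P u v := fun u v => Matrix.nonneg_of_mem_rowStochastic hP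
  rcases isEmpty_or_nonempty V with hV | hV
  · simp
  obtain ⟨m, hm1, hm2⟩ := exists_median f
  have hA := sum_sq_le_energy hP hsymm hφ0 hφ (fun x => max (f x - m) 0) (fun x => le_max_right _ _)
    (by
      refine le_trans (Nat.mul_le_mul_left 2 (Finset.card_le_card fun x hx => ?_)) hm1
      simp only [Finset.mem_filter, Finset.mem_univ, true_and] at hx ⊢
      by_contra h
      exact hx (max_eq_right (by linarith)))
  have hB := sum_sq_le_energy hP hsymm hφ0 hφ (fun x => max (m - f x) 0) (fun x => le_max_right _ _)
    (by
      refine le_trans (Nat.mul_le_mul_left 2 (Finset.card_le_card fun x hx => ?_)) hm2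
      simp only [Finset.mem_filter, Finset.mem_univ, true_and] at hx ⊢
      by_contra h
      exact hx (max_eq_right (by linarith)))
  have hvar : ∑ x, f x ^ 2 - (∑ x, f x) ^ 2 / Fintype.card V ≤ ∑ x, (f x - m) ^ 2 := by
    have hn : (0 : ℝ) < Fintype.card V := by exact_mod_cast Fintype.card_pos
    have e : ∑ x, (f x - m) ^ 2 =
        ∑ x, f x ^ 2 - 2 * m * ∑ x, f x + Fintype.card V * m ^ 2 := by
      simp_rw [sub_sq, Finset.sum_add_distrib, Finset.sum_sub_distrib, Finset.sum_const,
        Finset.card_univ, nsmul_eq_mul, Finset.mul_sum]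
      congr 2
      exact Finset.sum_congr rfl fun x _ => by ring
    have h2 : 0 ≤ (∑ x, f x - Fintype.card V * m) ^ 2 / Fintype.card V := by positivity
    have e2 : (∑ x, f x - Fintype.card V * m) ^ 2 / Fintype.card V =
        (∑ x, f x) ^ 2 / Fintype.card V - 2 * m * ∑ x, f x + Fintype.card V * m ^ 2 := by
      field_simp
      ring
    linarith
  have hsplit : ∑ x, (f x - m) ^ 2 = ∑ x, max (f x - m) 0 ^ 2 + ∑ x, max (m - f x) 0 ^ 2 := by
    rw [← Finset.sum_add_distrib]
    refine Finset.sum_congr rfl fun x _ => ?_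
    rcases le_total (f x) m with h | h
    · rw [max_eq_right (by linarith), max_eq_left (by linarith)]; ring
    · rw [max_eq_left (by linarith), max_eq_right (by linarith)]; ring
  calc _ ≤ φ ^ 2 / 4 * ∑ x, (f x - m) ^ 2 := mul_le_mul_of_nonneg_left hvar (by positivity)
    _ ≤ _ := by
      rw [hsplit, mul_add]
      refine (add_le_add hA hB).trans ?_
      simp_rw [← Finset.sum_add_distrib, ← mul_add]
      refine Finset.sum_le_sum fun u _ => Finset.sum_le_sum fun v _ =>
        mul_le_mul_of_nonneg_left ?_ (hP0 u v)
      rcases le_total (f u) m with hu | hu <;> rcases le_total (f v) m with hv | hv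
      · rw [max_eq_right (by linarith : f u - m ≤ 0), max_eq_right (by linarith : f v - m ≤ 0),
          max_eq_left (by linarith : 0 ≤ m - f u), max_eq_left (by linarith : 0 ≤ m - f v)]
        nlinarith
      · rw [max_eq_right (by linarith : f u - m ≤ 0), max_eq_left (by linarith : 0 ≤ f v - m),
          max_eq_left (by linarith : 0 ≤ m - f u), max_eq_right (by linarith : m - f v ≤ 0)]
        nlinarith [mul_nonneg (sub_nonneg.2 hu) (sub_nonneg.2 hv)]
      · rw [max_eq_left (by linarith : 0 ≤ f u - m), max_eq_right (by linarith : f v - m ≤ 0),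
          max_eq_right (by linarith : m - f u ≤ 0), max_eq_left (by linarith : 0 ≤ m - f v)]
        nlinarith [mul_nonneg (sub_nonneg.2 hu) (sub_nonneg.2 hv)]
      · rw [max_eq_left (by linarith : 0 ≤ f u - m), max_eq_left (by linarith : 0 ≤ f v - m),
          max_eq_right (by linarith : m - f u ≤ 0), max_eq_right (by linarith : m - f v ≤ 0)]
        nlinarith

/-- A symmetric lazy stochastic matrix with conductance at least `φ` contracts the variance. -/
theorem contracting_of_conductance (hP : P ∈ Matrix.rowStochastic ℝ V)
    (hsymm : ∀ u v, P u v = P v u) (hlazy : ∀ u, 1 / 2 ≤ P u u) (hφ0 : 0 ≤ φ)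
    (hφ : ∀ S : Finset V, 2 * S.card ≤ Fintype.card V → φ * S.card ≤ ∑ u ∈ S, ∑ v ∈ Sᶜ, P u v) :
    Contracting (φ ^ 2 / 8) P := by
  have hP0 : ∀ u v, 0 ≤ P u v := fun u v => Matrix.nonneg_of_mem_rowStochastic hP
  have hrow : ∀ u, ∑ v, P u v = 1 := fun u => Matrix.sum_row_of_mem_rowStochastic hP u
  have hcol : ∀ v, ∑ u, P u v = 1 := fun v => by simp_rw [fun u => hsymm u v]; exact hrow v
  refine ⟨fun f => ?_, fun f => ?_⟩
  · simp_rw [Matrix.mulVec, dotProduct]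
    rw [Finset.sum_comm]
    simp_rw [← Finset.sum_mul, hcol, one_mul]
  have hE := variance_le_energy hP hsymm hφ0 hφ f
  have hexp : ∑ u, ∑ v, P u v * (f u - f v) ^ 2 =
      2 * ∑ x, f x ^ 2 - 2 * ∑ u, f u * P.mulVec f u := by
    have : ∀ u v, P u v * (f u - f v) ^ 2 =
        P u v * f u ^ 2 + P u v * f v ^ 2 - 2 * (f u * (P u v * f v)) := fun u v => by ring
    simp_rw [this, Finset.sum_sub_distrib, Finset.sum_add_distrib]
    rw [Finset.sum_comm (f := fun u v => P u v * f v ^ 2)]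
    simp_rw [← Finset.sum_mul, hrow, hcol, one_mul, ← Finset.mul_sum, Matrix.mulVec, dotProduct]
    ring
  -- the non-lazy part `R = 2P - 1`
  have hR : ∑ u, (2 * P.mulVec f u - f u) ^ 2 ≤ ∑ u, f u ^ 2 := by
    set R : V → V → ℝ := fun u v => 2 * P u v - if u = v then 1 else 0 with hRdef
    have hR0 : ∀ u v, 0 ≤ R u v := fun u v => by
      simp only [hRdef]
      split_ifs with h
      · subst h; linarith [hlazy u]
      · linarith [hP0 u v]
    have hRrow : ∀ u, ∑ v, R u v = 1 := fun u => by
      simp only [hRdef, Finset.sum_sub_distrib, ← Finset.mul_sum, hrow]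
      simp; norm_num
    have hRcol : ∀ v, ∑ u, R u v = 1 := fun v => by
      simp only [hRdef, Finset.sum_sub_distrib, ← Finset.mul_sum, hcol]
      simp; norm_num
    have hRf : ∀ u, 2 * P.mulVec f u - f u = ∑ v, R u v * f v := fun u => by
      simp only [hRdef, sub_mul, Finset.sum_sub_distrib, mul_assoc, ← Finset.mul_sum,
        Matrix.mulVec, dotProduct]
      simp
    calc _ ≤ ∑ u, ∑ v, R u v * f v ^ 2 := by
          refine Finset.sum_le_sum fun u _ => ?_
          rw [hRf]
          exact (even_two.convexOn_pow (𝕜 := ℝ)).map_sum_le (fun v _ => hR0 u v) (hRrow u) (fun v _ => Set.mem_univ _)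
      _ = _ := by
          rw [Finset.sum_comm]
          simp_rw [← Finset.sum_mul, hRcol, one_mul]
  have hR' : ∑ u, (2 * P.mulVec f u - f u) ^ 2 =
      4 * ∑ u, P.mulVec f u ^ 2 - 4 * ∑ u, f u * P.mulVec f u + ∑ u, f u ^ 2 := by
    rw [Finset.mul_sum, Finset.mul_sum, ← Finset.sum_sub_distrib, ← Finset.sum_add_distrib]
    exact Finset.sum_congr rfl fun u _ => by ring
  -- `hR` and `hR'` give `‖Pf‖² ≤ ⟨f, Pf⟩`, and `hexp` says that `⟨f, Pf⟩` is `‖f‖²` minus half of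
  -- the energy; this halving turns `φ²/4` into `φ²/8`.
  linarith

end Cheeger

/-! ### Spectral contraction of the lazy Metropolis walk from degree and cut bounds -/

section Metropolis

variable {V : Type*} [Fintype V] [DecidableEq V]

theorem metropolisMatrix_symm (G : SimpleGraph V) (u v : V) :
    metropolisMatrix G u v = metropolisMatrix G v u := by
  unfold metropolisMatrix
  by_cases h : G.Adj u v
  · rw [if_pos h, if_pos h.symm, max_comm]
  · have h' : ¬ G.Adj v u := fun h' => h h'.symm
    rw [if_neg h, if_neg h']
    by_cases e : u = v
    · subst e; rfl
    · rw [if_neg e, if_neg (Ne.symm e)]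

theorem half_le_metropolisMatrix (G : SimpleGraph V) (u : V) :
    1 / 2 ≤ metropolisMatrix G u u := by
  classical
  have hle : ∑ w ∈ G.neighborFinset u, 1 / (2 * max (G.degree u : ℝ) (G.degree w)) ≤
      ∑ w ∈ G.neighborFinset u, 1 / (2 * (G.degree u : ℝ)) := by
    refine Finset.sum_le_sum fun w hw => ?_
    have hpos : 0 < G.degree u :=
      (G.degree_pos_iff_exists_adj u).2 ⟨w, (G.mem_neighborFinset u w).1 hw⟩
    have hpos' : (0 : ℝ) < G.degree u := by exact_mod_cast hpos
    refine one_div_le_one_div_of_le (by positivity) ?_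
    have := le_max_left (G.degree u : ℝ) (G.degree w)
    linarith
  have h1 : ∑ w ∈ G.neighborFinset u, 1 / (2 * (G.degree u : ℝ)) ≤ 1 / 2 := by
    rw [Finset.sum_const, G.card_neighborFinset_eq_degree, nsmul_eq_mul, mul_one_div,
      mul_comm 2, ← div_div]
    have := div_self_le_one (G.degree u : ℝ)
    linarith
  unfold metropolisMatrix
  rw [if_neg (G.loopless.irrefl u), if_pos rfl]
  convert! sub_le_sub_left (hle.trans h1) 1 using 1
  norm_num

open scoped Classical in
-- Each edge carries weight at least `1/(2Δ)`, so counting the edges of a cut bounds its flow from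
-- below, and conductance applies.
theorem metropolis_contracting (G : SimpleGraph V) {Δ φ : ℝ} (hΔ : 0 < Δ) (hφ0 : 0 ≤ φ)
    (hdeg : ∀ u, (G.degree u : ℝ) ≤ Δ)
    (hcut : ∀ S : Finset V, 2 * S.card ≤ Fintype.card V →
      2 * Δ * φ * S.card ≤ ((S ×ˢ Sᶜ).filter fun e => G.Adj e.1 e.2).card) :
    Contracting (φ ^ 2 / 8) (metropolis G).1 := by
  refine contracting_of_conductance (metropolis G).2 (metropolisMatrix_symm G)
    (half_le_metropolisMatrix G) hφ0 fun S hS => ?_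
  have h1 := hcut S hS
  have h2 : ∀ u v, (if G.Adj u v then 1 / (2 * Δ) else 0) ≤ (metropolis G).1 u v := by
    intro u v
    split_ifs with h
    · have hpos : 0 < G.degree u := (G.degree_pos_iff_exists_adj u).2 ⟨v, h⟩
      have hpos' : (0 : ℝ) < G.degree u := by exact_mod_cast hpos
      show _ ≤ metropolisMatrix G u v
      unfold metropolisMatrix
      rw [if_pos h]
      refine one_div_le_one_div_of_le ?_ ?_
      · exact mul_pos two_pos (lt_of_lt_of_le hpos' (le_max_left _ _))
      · exact mul_le_mul_of_nonneg_left (max_le (hdeg u) (hdeg v)) two_pos.le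
    · exact Matrix.nonneg_of_mem_rowStochastic (metropolis G).2
  calc φ * S.card = 2 * Δ * φ * S.card * (1 / (2 * Δ)) := by field_simp
    _ ≤ ((S ×ˢ Sᶜ).filter fun e => G.Adj e.1 e.2).card * (1 / (2 * Δ)) := by gcongr
    _ = ∑ u ∈ S, ∑ v ∈ Sᶜ, if G.Adj u v then 1 / (2 * Δ) else 0 := by
        rw [← Finset.sum_product', ← Finset.sum_filter, Finset.sum_const, nsmul_eq_mul]
    _ ≤ _ := Finset.sum_le_sum fun u _ => Finset.sum_le_sum fun v _ => h2 u v

end Metropolis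

/-! ### Expectations over independent choices -/

section Indep

variable {ι κ V : Type*} [Fintype ι] [Fintype κ] [DecidableEq ι] [DecidableEq κ] [Fintype V]

/-- The expectation of `G ξ`, where the `ξ i` are independent with weights `p i`. -/
def indep (p : ι → V → ℝ) (G : (ι → V) → ℝ) : ℝ := ∑ ξ : ι → V, (∏ i, p i (ξ i)) * G ξ

theorem indep_mono {p : ι → V → ℝ} (hp : ∀ i v, 0 ≤ p i v) {G G' : (ι → V) → ℝ}
    (h : ∀ ξ, G ξ ≤ G' ξ) : indep p G ≤ indep p G' :=
  Finset.sum_le_sum fun ξ _ =>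
    mul_le_mul_of_nonneg_left (h ξ) (Finset.prod_nonneg fun i _ => hp i _)

theorem indep_nonneg {p : ι → V → ℝ} (hp : ∀ i v, 0 ≤ p i v) {G : (ι → V) → ℝ}
    (h : ∀ ξ, 0 ≤ G ξ) : 0 ≤ indep p G :=
  Finset.sum_nonneg fun ξ _ => mul_nonneg (Finset.prod_nonneg fun i _ => hp i _) (h ξ)

theorem indep_add (p : ι → V → ℝ) (G G' : (ι → V) → ℝ) :
    indep p (fun ξ => G ξ + G' ξ) = indep p G + indep p G' := by
  simp [indep, mul_add, Finset.sum_add_distrib]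

theorem indep_const_mul (p : ι → V → ℝ) (c : ℝ) (G : (ι → V) → ℝ) :
    indep p (fun ξ => c * G ξ) = c * indep p G := by
  simp only [indep, Finset.mul_sum]
  exact Finset.sum_congr rfl fun ξ _ => by ring

theorem indep_sum {α : Type*} (s : Finset α) (p : ι → V → ℝ) (G : α → (ι → V) → ℝ) :
    indep p (fun ξ => ∑ j ∈ s, G j ξ) = ∑ j ∈ s, indep p (G j) := by
  simp only [indep, Finset.mul_sum]
  exact Finset.sum_comm

theorem indep_prod [DecidableEq V] (p f : ι → V → ℝ) :
    indep p (fun ξ => ∏ i, f i (ξ i)) = ∏ i, ∑ v, p i v * f i v := by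
  rw [Finset.prod_univ_sum, Fintype.piFinset_univ]
  exact Finset.sum_congr rfl fun ξ _ => Finset.prod_mul_distrib.symm

theorem indep_const [DecidableEq V] {p : ι → V → ℝ} (hp : ∀ i, ∑ v, p i v = 1) (c : ℝ) :
    indep p (fun _ => c) = c := by
  have := indep_prod p fun _ _ => 1
  simp only [Finset.prod_const_one, mul_one, hp] at this
  simpa [this] using indep_const_mul p c fun _ => 1

/-- Marginals of a product law: the coordinates outside the range of `τ` sum to 1. Injectivity makes
the selected coordinates independent. -/
theorem indep_comp [DecidableEq V] {p : ι → V → ℝ} (hp : ∀ i, ∑ v, p i v = 1) {τ : κ → ι}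
    (hτ : Function.Injective τ) (G : (κ → V) → ℝ) :
    indep p (fun ξ => G (ξ ∘ τ)) = indep (fun k => p (τ k)) G := by
  unfold indep
  rw [← Finset.sum_fiberwise (g := fun ξ : ι → V => ξ ∘ τ)]
  refine Finset.sum_congr rfl fun ζ _ => ?_
  have h1 : ∑ ξ ∈ Finset.univ.filter (fun ξ : ι → V => ξ ∘ τ = ζ),
      (∏ i, p i (ξ i)) * G (ξ ∘ τ) =
      (∑ ξ ∈ Finset.univ.filter (fun ξ : ι → V => ξ ∘ τ = ζ), ∏ i, p i (ξ i)) * G ζ := by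
    rw [Finset.sum_mul]
    exact Finset.sum_congr rfl fun ξ hξ => by rw [(Finset.mem_filter.1 hξ).2]
  rw [h1]
  congr 1
  set T : ι → Finset V := Function.extend τ (fun k => {ζ k}) fun _ => Finset.univ with hT
  have hTτ : ∀ k, T (τ k) = {ζ k} := fun k => hτ.extend_apply _ _ k
  have hset : Finset.univ.filter (fun ξ : ι → V => ξ ∘ τ = ζ) = Fintype.piFinset T := by
    ext ξ
    simp only [Finset.mem_filter, Finset.mem_univ, true_and, Fintype.mem_piFinset]
    constructor
    · rintro rfl i
      by_cases hi : ∃ k, τ k = i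
      · obtain ⟨k, rfl⟩ := hi
        simp [hTτ]
      · simp [hT, Function.extend_apply' _ _ _ hi]
    · intro h
      ext k
      have := h (τ k)
      rw [hTτ] at this
      exact Finset.mem_singleton.1 this
  rw [hset, ← Finset.prod_univ_sum]
  refine (Fintype.prod_of_injective τ hτ _ _ (fun i hi => ?_) fun k => ?_).symm
  · have hi' : ¬ ∃ k, τ k = i := hi
    rw [hT, Function.extend_apply' _ _ _ hi', hp]
  · rw [hTτ, Finset.sum_singleton]

theorem indep_option (p : Option ι → V → ℝ) (G : (Option ι → V) → ℝ) :
    indep p G = ∑ v, p none v * indep (fun i => p (some i))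
      fun ξ => G fun o => o.elim v ξ := by
  unfold indep
  rw [← (Equiv.piOptionEquivProd (β := fun _ : Option ι => V)).symm.sum_comp,
    Fintype.sum_prod_type]
  refine Finset.sum_congr rfl fun v _ => ?_
  rw [Finset.mul_sum]
  refine Finset.sum_congr rfl fun ξ _ => ?_
  have e : (Equiv.piOptionEquivProd (β := fun _ : Option ι => V)).symm (v, ξ) =
      fun o => o.elim v ξ := by
    ext o; cases o <;> rfl
  rw [e, Fintype.prod_option, mul_assoc]
  rfl

end Indep

/-! ### Coalescing walks as random maps -/

section Coalescing

/-- The number of occupied vertices, minus one. -/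
def excess {V : Type*} (S : Finset V) : ℝ := S.card - 1

theorem excess_nonneg {V : Type*} {S : Finset V} (hS : S.Nonempty) : 0 ≤ excess S := by
  have : (1 : ℝ) ≤ S.card := by exact_mod_cast hS.card_pos
  unfold excess; linarith

variable {V : Type*} [Fintype V] [DecidableEq V]

/-- The expectation of `F` over the image of `S` under the random map which moves the vertices
independently according to `P`. -/
def mapStep (P : Matrix.rowStochastic ℝ V) (F : Finset V → ℝ) (S : Finset V) : ℝ :=
  indep (fun v => P.1 v) fun η => F (S.image η)

theorem rowStochastic_nonneg (P : Matrix.rowStochastic ℝ V) (u v : V) : 0 ≤ P.1 u v :=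
  Matrix.nonneg_of_mem_rowStochastic P.2

theorem rowStochastic_sum (P : Matrix.rowStochastic ℝ V) (u : V) : ∑ v, P.1 u v = 1 :=
  Matrix.sum_row_of_mem_rowStochastic P.2 u

/-- The walkers moving the vertices of `S` may be chosen among a larger system of independent
walkers. -/
theorem indep_selection {ι : Type*} [Fintype ι] [DecidableEq ι] (P : Matrix.rowStochastic ℝ V)
    (F : Finset V → ℝ) (S : Finset V) (w : ι → V) (sel : V → ι) (h : ∀ v ∈ S, w (sel v) = v) :
    indep (fun i => P.1 (w i)) (fun ξ => F (S.image (ξ ∘ sel))) = mapStep P F S := by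
  have himg : ∀ f : V → V, S.image f = Finset.univ.image fun v : S => f v := fun f => by
    ext x; simp
  have h1 := indep_comp (κ := S) (p := fun i => P.1 (w i)) (fun i => rowStochastic_sum P _)
    (τ := fun v => sel v)
    (fun a b hab => Subtype.ext (by
      rw [← h a a.2, ← h b b.2]; exact congrArg w hab))
    fun ζ => F (Finset.univ.image ζ)
  have h2 := indep_comp (κ := S) (p := fun v => P.1 v) (fun i => rowStochastic_sum P _)
    (τ := fun v => (v : V)) Subtype.val_injective fun ζ => F (Finset.univ.image ζ)
  unfold mapStep
  simp_rw [himg]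
  refine h1.trans (Eq.trans ?_ h2.symm)
  congr 1
  ext v
  rw [h v v.2]

theorem mapStep_mono (P : Matrix.rowStochastic ℝ V) {F F' : Finset V → ℝ} {S : Finset V}
    (hS : S.Nonempty) (h : ∀ S : Finset V, S.Nonempty → F S ≤ F' S) :
    mapStep P F S ≤ mapStep P F' S :=
  indep_mono (fun _ _ => rowStochastic_nonneg P _ _) fun _ => h _ (hS.image _)

/-- The expectation of `F` over the image of `S` under the composition of the `r` independent
random maps which follow time `t`. -/
def mapIter (P : ℕ → Matrix.rowStochastic ℝ V) (F : Finset V → ℝ) : ℕ → ℕ → Finset V → ℝ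
  | _, 0 => F
  | t, r + 1 => mapStep (P (t + 1)) (mapIter P F (t + 1) r)

variable (P : ℕ → Matrix.rowStochastic ℝ V)

theorem mapIter_mono {F F' : Finset V → ℝ} (h : ∀ S : Finset V, S.Nonempty → F S ≤ F' S)
    (r t : ℕ) {S : Finset V} (hS : S.Nonempty) : mapIter P F t r S ≤ mapIter P F' t r S := by
  induction r generalizing t S with
  | zero => exact h S hS
  | succ r ih => exact mapStep_mono _ hS fun T hT => ih (t + 1) hT

theorem mapIter_affine (F : Finset V → ℝ) (α β : ℝ) (r t : ℕ) (S : Finset V) :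
    mapIter P (fun S => α + β * F S) t r S = α + β * mapIter P F t r S := by
  induction r generalizing t S with
  | zero => rfl
  | succ r ih =>
    simp only [mapIter, mapStep, ih]
    rw [indep_add, indep_const_mul,
      indep_const (p := fun v => (P (t + 1)).1 v) fun v => rowStochastic_sum _ v]

theorem mapIter_add (F : Finset V → ℝ) (r s t : ℕ) (S : Finset V) :
    mapIter P F t (r + s) S = mapIter P (mapIter P F (t + r) s) t r S := by
  induction r generalizing t S with
  | zero => simp [mapIter]
  | succ r ih =>
    rw [show r + 1 + s = (r + s) + 1 by ring]
    simp only [mapIter, mapStep, ih, show t + 1 + r = t + (r + 1) by ring]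

theorem mapIter_nonneg {F : Finset V → ℝ} (h : ∀ S : Finset V, S.Nonempty → 0 ≤ F S)
    (r t : ℕ) {S : Finset V} (hS : S.Nonempty) : 0 ≤ mapIter P F t r S := by
  induction r generalizing t S with
  | zero => exact h S hS
  | succ r ih =>
    exact indep_nonneg (p := fun v => (P (t + 1)).1 v) (fun _ _ => rowStochastic_nonneg _ _ _)
      fun η => ih (t + 1) (hS.image η)

variable (c : ℕ) {ι : Type*} [Fintype ι] [DecidableEq ι]

open scoped Classical in
/-- The probability that a walk started at `v` at time `t` is met by none of the independent walks
started at the `y i`, at all times in `[t, t + r]` that are at least `c`. -/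
def escape : ℕ → ℕ → (ι → V) → V → ℝ
  | t, 0, y, v => if c ≤ t ∧ ∃ i, y i = v then 0 else 1
  | t, r + 1, y, v => if c ≤ t ∧ ∃ i, y i = v then 0 else
      ∑ v', (P (t + 1)).1 v v' * indep (fun i => (P (t + 1)).1 (y i)) fun y' =>
        escape (t + 1) r y' v'

/-- The number of coalescing walks is at most that of the process in which only meetings with the
walks `y` are effective. -/
theorem mapIter_card_le (r t : ℕ) (S : Finset V) (y : ι → V) (z : V → V) (J : Finset V)
    (hS : S ⊆ Finset.univ.image y ∪ J.image z) :
    mapIter P (fun S => (S.card : ℝ)) t r S ≤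
      Fintype.card ι + ∑ j ∈ J, escape P c t r y (z j) := by
  classical
  -- A walker met by a hunter `y i` at a counted time is dropped from the list, since its vertex is
  -- already covered by the hunters.
  set J' := J.filter fun j => ¬ (c ≤ t ∧ ∃ i, y i = z j) with hJ'
  have hS' : S ⊆ Finset.univ.image y ∪ J'.image z := by
    intro v hv
    by_cases hy : ∃ i, y i = v
    · exact Finset.mem_union_left _ (by simpa using hy)
    · rcases Finset.mem_union.1 (hS hv) with h | h
      · exact absurd (by simpa using h) hy
      · obtain ⟨j, hj, rfl⟩ := Finset.mem_image.1 h
        exact Finset.mem_union_right _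
          (Finset.mem_image_of_mem _ (Finset.mem_filter.2 ⟨hj, fun h => hy h.2⟩))
  cases r with
  | zero =>
    have h1 : ∑ j ∈ J, escape P c t 0 y (z j) = J'.card := by
      simp only [escape]
      rw [Finset.card_filter]
      push_cast
      exact Finset.sum_congr rfl fun j _ => by split_ifs <;> simp_all
    show (S.card : ℝ) ≤ _
    rw [h1]
    have h2 : S.card ≤ Fintype.card ι + J'.card :=
      (Finset.card_le_card hS').trans ((Finset.card_union_le _ _).trans
        (add_le_add Finset.card_image_le Finset.card_image_le))
    exact_mod_cast h2
  | succ r =>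
    -- Each occupied vertex follows one labelled walker standing there. All labelled walkers move
    -- independently, even those sharing a vertex, so the new occupied set is again covered by
    -- hunters and survivors.
    have hsel : ∀ v, ∃ i : ι ⊕ V, v ∈ S → Sum.elim y z i = v ∧ ∀ j, i = Sum.inr j → j ∈ J' := by
      intro v
      by_cases hv : v ∈ S
      · rcases Finset.mem_union.1 (hS' hv) with h | h
        · obtain ⟨i, -, hi⟩ := Finset.mem_image.1 h
          exact ⟨Sum.inl i, fun _ => ⟨hi, fun j hj => by cases hj⟩⟩
        · obtain ⟨j, hj, hi⟩ := Finset.mem_image.1 h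
          exact ⟨Sum.inr j, fun _ => ⟨hi, fun j' hj' => by cases hj'; exact hj⟩⟩
      · exact ⟨Sum.inr v, fun h => absurd h hv⟩
    choose sel hsel using hsel
    have hstep := indep_selection (P (t + 1)) (mapIter P (fun S => (S.card : ℝ)) (t + 1) r) S
      (Sum.elim y z) sel fun v hv => (hsel v hv).1
    have hbound : ∀ ξ : ι ⊕ V → V,
        mapIter P (fun S => (S.card : ℝ)) (t + 1) r (S.image (ξ ∘ sel)) ≤
          Fintype.card ι + ∑ j ∈ J', escape P c (t + 1) r (ξ ∘ Sum.inl) (ξ (Sum.inr j)) := by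
      intro ξ
      refine mapIter_card_le r (t + 1) _ (ξ ∘ Sum.inl) (ξ ∘ Sum.inr) J' ?_
      intro x hx
      obtain ⟨v, hv, rfl⟩ := Finset.mem_image.1 hx
      rcases hs : sel v with i | j
      · exact Finset.mem_union_left _ (by simp [hs])
      · exact Finset.mem_union_right _ (Finset.mem_image.2 ⟨j, (hsel v hv).2 j hs, by simp [hs]⟩)
    show mapStep (P (t + 1)) (mapIter P (fun S => (S.card : ℝ)) (t + 1) r) S ≤ _
    rw [← hstep]
    refine (indep_mono (fun _ _ => rowStochastic_nonneg _ _ _) hbound).trans (le_of_eq ?_)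
    rw [indep_add, indep_const fun i => rowStochastic_sum _ _, indep_sum]
    congr 1
    rw [hJ', Finset.sum_filter]
    refine Finset.sum_congr rfl fun j _ => ?_
    by_cases hj : c ≤ t ∧ ∃ i, y i = z j
    · rw [if_neg (not_not.2 hj), escape, if_pos hj]
    rw [if_pos hj, escape, if_neg hj]
    have hτ : Function.Injective fun o : Option ι => o.elim (Sum.inr j : ι ⊕ V) Sum.inl := by
      intro a b hab
      cases a <;> cases b <;> simp_all
    have := indep_comp (p := fun i => (P (t + 1)).1 (Sum.elim y z i))
      (fun i => rowStochastic_sum _ _) hτ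
      fun ζ => escape P c (t + 1) r (fun i => ζ (some i)) (ζ none)
    rw [indep_option] at this
    exact this

/-- The expectation of `G` over the path which follows `h` up to time `t` and then makes `r`
steps of the walk. -/
def pathAvg : ℕ → ℕ → (ℕ → V) → ((ℕ → V) → ℝ) → ℝ
  | _, 0, h, G => G h
  | t, r + 1, h, G => ∑ v, (P (t + 1)).1 (h t) v *
      pathAvg (t + 1) r (Function.update h (t + 1) v) G

theorem pathAvg_le (r t : ℕ) (h : ℕ → V) (G : (ℕ → V) → ℝ) {C : ℝ} (hG : ∀ h, G h ≤ C) :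
    pathAvg P t r h G ≤ C := by
  induction r generalizing t h with
  | zero => exact hG h
  | succ r ih =>
    exact rowStochastic_mulVec_le (P (t + 1))
      (f := fun v => pathAvg P (t + 1) r (Function.update h (t + 1) v) G) (fun v => ih _ _) (h t)

theorem pathAvg_congr (r t : ℕ) (h : ℕ → V) (G G' : (ℕ → V) → ℝ)
    (hG : ∀ h', (∀ s ≤ t, h' s = h s) → G h' = G' h') :
    pathAvg P t r h G = pathAvg P t r h G' := by
  induction r generalizing t h with
  | zero => exact hG h fun _ _ => rfl
  | succ r ih =>
    unfold pathAvg
    refine Finset.sum_congr rfl fun v _ => ?_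
    rw [ih (t + 1) _ fun h' hh => hG h' fun s hs => ?_]
    rw [hh s (by omega), Function.update_of_ne (by omega)]

theorem pathAvg_indep {p : ι → V → ℝ} (r t : ℕ) (h : ℕ → V) (H : (ι → V) → (ℕ → V) → ℝ) :
    pathAvg P t r h (fun h' => indep p fun y => H y h') =
      indep p fun y => pathAvg P t r h (H y) := by
  induction r generalizing t h with
  | zero => rfl
  | succ r ih =>
    unfold pathAvg
    simp_rw [ih]
    rw [indep_sum]
    simp_rw [indep_const_mul]

theorem pathAvg_zero (r t : ℕ) (h : ℕ → V) : pathAvg P t r h (fun _ => 0) = 0 := by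
  induction r generalizing t h with
  | zero => rfl
  | succ r ih => simp [pathAvg, ih]

/-- Conditionally on the trajectory of the hunted walk, the hunters are independent, so the escape
probability is an average of products of probabilities of avoiding a moving target. A bound on
`avoid` uniform in the trajectory then bounds `escape`. -/
theorem escape_eq_pathAvg (r t : ℕ) (y : ι → V) (h : ℕ → V) :
    escape P c t r y (h t) = pathAvg P t r h fun h' => ∏ i, avoid P c h' t r (y i) := by
  classical
  induction r generalizing t y h with
  | zero =>
    simp only [escape, pathAvg, avoid]
    split_ifs with h1
    · obtain ⟨h1, i, hi⟩ := h1
      exact (Finset.prod_eq_zero (Finset.mem_univ i) (by simp [h1, hi])).symm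
    · refine (Finset.prod_eq_one fun i _ => if_neg fun h2 => h1 ⟨h2.1, i, h2.2⟩).symm
  | succ r ih =>
    by_cases h1 : c ≤ t ∧ ∃ i, y i = h t
    · rw [escape, if_pos h1, pathAvg_congr P (r + 1) t h _ fun _ => 0, pathAvg_zero]
      intro h' hh
      obtain ⟨h1, i, hi⟩ := h1
      exact Finset.prod_eq_zero (Finset.mem_univ i) (by simp [avoid, h1, hi, hh t le_rfl])
    · rw [pathAvg_congr P (r + 1) t h _ fun h' => indep (fun i => (P (t + 1)).1 (y i))
        fun y' => ∏ i, avoid P c h' (t + 1) r (y' i), pathAvg_indep, escape, if_neg h1]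
      · unfold pathAvg
        rw [indep_sum]
        refine Finset.sum_congr rfl fun v _ => ?_
        rw [indep_const_mul]
        congr 2
        ext y'
        rw [← ih (t + 1) y' (Function.update h (t + 1) v), Function.update_self]
      · intro h' hh
        rw [indep_prod]
        refine Finset.prod_congr rfl fun i _ => ?_
        rw [avoid, if_neg fun h2 => h1 ⟨h2.1, i, by rw [h2.2, hh t le_rfl]⟩]
        rfl

theorem escape_le {α : ℝ} (r t : ℕ) (hα : ∀ h x, avoid P c h t r x ≤ α) (y : ι → V) (v : V) :
    escape P c t r y v ≤ α ^ Fintype.card ι := by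
  have := escape_eq_pathAvg P c r t y fun _ => v
  rw [this]
  refine pathAvg_le P r t _ _ fun h => ?_
  refine (Finset.prod_le_prod (fun i _ => avoid_nonneg _ _ _ _ _ _) fun i _ => hα h (y i)).trans ?_
  simp

theorem mapIter_excess_eq (r t : ℕ) (S : Finset V) :
    mapIter P excess t r S = mapIter P (fun S => (S.card : ℝ)) t r S - 1 := by
  have := mapIter_affine P (fun S => (S.card : ℝ)) (-1) 1 r t S
  rw [show (excess : Finset V → ℝ) = fun S => -1 + 1 * (S.card : ℝ) from
    funext fun S => by unfold excess; ring, this]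
  ring

/-- Choose `m` occupied vertices as hunters; each of the other `|S| - m ≤ excess S` walkers survives
with probability at most `α^m`. If there are at most `m` walkers, it is enough that their number
never grows. -/
theorem mapIter_excess_le {α : ℝ} (hα0 : 0 ≤ α) (r t : ℕ) (hα : ∀ h x, avoid P c h t r x ≤ α)
    {S : Finset V} (hS : S.Nonempty) {m : ℕ} (hm : 1 ≤ m) :
    mapIter P excess t r S ≤ (m - 1) + α ^ m * excess S := by
  rw [mapIter_excess_eq]
  have hm' : (1 : ℝ) ≤ m := by exact_mod_cast hm
  rcases le_total m S.card with h | h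
  · obtain ⟨T, hT, hTc⟩ := Finset.exists_subset_card_eq h
    have h1 := mapIter_card_le P c r t S (fun i : T => (i : V)) id (S \ T) (by
      intro v hv
      by_cases hvT : v ∈ T
      · exact Finset.mem_union_left _ (by simpa using hvT)
      · exact Finset.mem_union_right _ (by simp [hv, hvT]))
    have h2 : ∑ j ∈ S \ T, escape P c t r (fun i : T => (i : V)) (id j) ≤
        (S \ T).card * α ^ m := by
      rw [← nsmul_eq_mul, ← Finset.sum_const]
      refine Finset.sum_le_sum fun j _ => (escape_le P c r t hα _ _).trans (le_of_eq ?_)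
      rw [Fintype.card_coe, hTc]
    have h3 : ((S \ T).card : ℝ) ≤ excess S := by
      have : (S \ T).card + m = S.card := by
        rw [← hTc]; exact Finset.card_sdiff_add_card_eq_card hT
      have h4 : ((S \ T).card : ℝ) + m = S.card := by exact_mod_cast this
      unfold excess; linarith
    have h4 := mul_le_mul_of_nonneg_right h3 (pow_nonneg hα0 m)
    rw [Fintype.card_coe, hTc] at h1
    linarith
  · have h1 := mapIter_card_le P c r t S (fun i : S => (i : V)) id ∅ (by
      intro v hv
      exact Finset.mem_union_left _ (by simpa using hv))
    rw [Finset.sum_empty, Fintype.card_coe, add_zero] at h1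
    have h2 : (S.card : ℝ) ≤ m := by exact_mod_cast h
    have := mul_nonneg (pow_nonneg hα0 m) (excess_nonneg hS)
    linarith

/-- In successive windows of lengths `len (J - 1), …, len 0` the expected number of walks
decreases from `|S|` to almost one. -/
theorem mapIter_excess_schedule (len : ℕ → ℕ) (J a : ℕ)
    (hlen : ∀ j < J, ∀ t, a ≤ t → t + len j ≤ a + ∑ i ∈ Finset.range J, len i →
      ∀ S : Finset V, S.Nonempty →
        mapIter P excess t (len j) S ≤ (2 ^ j - 1) + 1 / 8 * excess S)
    {S : Finset V} (hS : S.Nonempty) :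
    mapIter P excess a (∑ j ∈ Finset.range J, len j) S ≤
      (4 / 3 * (1 - (1 / 4) ^ J) - 8 / 7 * (1 - (1 / 8) ^ J)) + (1 / 8) ^ J * excess S := by
  induction J generalizing a S with
  | zero => simp [mapIter]
  | succ J ih =>
    have hsum : ∑ j ∈ Finset.range (J + 1), len j = len J + ∑ j ∈ Finset.range J, len j := by
      rw [Finset.sum_range_succ, add_comm]
    rw [hsum, mapIter_add]
    have ih' := fun T hT => ih (a + len J)
      (fun j hj t h1 h2 => hlen j (by omega) t (by omega) (by omega)) (S := T) hT
    refine (mapIter_mono P ih' (len J) a hS).trans ?_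
    rw [mapIter_affine]
    have h1 := hlen J (by omega) a le_rfl (by omega) S hS
    have h2 := mul_le_mul_of_nonneg_left h1 (pow_nonneg (by norm_num : (0 : ℝ) ≤ 1 / 8) J)
    refine (add_le_add_right h2 _).trans (le_of_eq ?_)
    -- Window `j` contributes `(2^j - 1)/8^j = 4^{-j} - 8^{-j}` to the final bound; the two
    -- geometric sums give the constants `4/3` and `8/7`.
    have e : (1 / 8 : ℝ) ^ J * 2 ^ J = (1 / 4) ^ J := by rw [← mul_pow]; norm_num
    rw [pow_succ, pow_succ]
    linear_combination e

/-- The coalescing window: if the walks contract, then starting from any set of occupied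
vertices, the expected excess is at most one half at its end. -/
theorem mapIter_excess_le_half {γ : ℝ} (hγ0 : 0 < γ) (hγ1 : γ ≤ 1) {a ℓ J : ℕ} {s : ℕ → ℕ}
    (hs : ∀ j, 12 * Fintype.card V ≤ γ * (s j * 2 ^ j))
    (hJ : Fintype.card V ≤ 2 ^ J) (hJ1 : 1 ≤ J)
    (hℓ : Fintype.card V * (1 - γ) ^ ℓ ≤ (γ / (4 * Fintype.card V)) ^ 2)
    (hP : ∀ u, a < u → u ≤ a + ∑ j ∈ Finset.range J, (ℓ + s j) → Contracting γ (P u).1)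
    {S : Finset V} (hS : S.Nonempty) :
    mapIter P excess a (∑ j ∈ Finset.range J, (ℓ + s j)) S ≤ 1 / 2 := by
  have hn : (0 : ℝ) < Fintype.card V := by
    exact_mod_cast Fintype.card_pos_iff.2 ⟨hS.choose⟩
  have hmain := mapIter_excess_schedule P (fun j => ℓ + s j) J a
    (fun j hj t h1 h2 T hT => by
      have hs1 : 1 ≤ s j := by
        by_contra h
        have h0 : s j = 0 := by omega
        have := hs j
        rw [h0] at this
        simp at this
        linarith
      have h3 := mapIter_excess_le P (t + ℓ) (Real.exp_nonneg _) (ℓ + s j) t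
        (fun h x => avoid_le_exp (P := P) (h := h) hγ0 hγ1 hs1 hℓ
          (fun u hu1 hu2 => hP u (by omega) (by omega)) x) hT (m := 2 ^ j) Nat.one_le_two_pow
      refine h3.trans ?_
      push_cast
      refine add_le_add_right (mul_le_mul_of_nonneg_right ?_ (excess_nonneg hT)) _
      rw [← Real.exp_nat_mul]
      push_cast
      -- With `2^j` hunters the exponents add up to at least 3, whence the survival factor `e^{-3} ≤
      -- 1/8`.
      have h4 : (3 : ℝ) ≤ 2 ^ j * (γ * s j / (4 * Fintype.card V)) := by
        rw [mul_div_assoc', le_div_iff₀ (by positivity)]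
        linarith [hs j]
      calc Real.exp (2 ^ j * -(γ * s j / (4 * Fintype.card V))) ≤ Real.exp (-3) :=
            Real.exp_le_exp.2 (by linarith)
        _ ≤ 1 / 8 := by
            rw [Real.exp_neg, one_div]
            refine inv_anti₀ (by norm_num) ?_
            have e3 : Real.exp 3 = Real.exp 1 ^ 3 := by rw [← Real.exp_nat_mul]; norm_num
            have e1 : (2 : ℝ) ≤ Real.exp 1 := by linarith [Real.add_one_le_exp (1 : ℝ)]
            rw [e3]
            calc (8 : ℝ) = 2 ^ 3 := by norm_num
              _ ≤ _ := pow_le_pow_left₀ (by norm_num) e1 3) hS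
  refine hmain.trans ?_
  have h1 : excess S ≤ 2 ^ J := by
    have h2 : (S.card : ℝ) ≤ 2 ^ J := by exact_mod_cast (Finset.card_le_univ S).trans hJ
    unfold excess; linarith
  -- The initial excess is at most `2^J`. The total is then at most `4/3 - 8/7 + 1/7 = 1/3`.
  have h2 : (1 / 8 : ℝ) ^ J * excess S ≤ (1 / 4) ^ J := by
    refine (mul_le_mul_of_nonneg_left h1 (by positivity)).trans (le_of_eq ?_)
    rw [← mul_pow]; norm_num
  have h3 : (1 / 8 : ℝ) ^ J ≤ 1 / 8 := pow_le_of_le_one (by norm_num) (by norm_num) (by omega)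
  have h4 : (0 : ℝ) ≤ (1 / 4) ^ J := by positivity
  linarith

end Coalescing

/-! ### Random graphs with independent edges -/

section RandomGraph

/-- The moment generating function factors over the edges, and each factor is bounded by `1 + a ≤
exp a`. It is used with `θ = 1` for degrees and `θ = -1` for cuts. -/
theorem indep_exp_le {ε : Type*} [Fintype ε] [DecidableEq ε] {ρ : ε → Fin 2 → ℝ}
    (hρ0 : ∀ e i, 0 ≤ ρ e i) (hρ1 : ∀ e, ρ e 0 + ρ e 1 = 1) (D : Finset ε) {θ a : ℝ}
    (ha : ∀ e ∈ D, ρ e 1 * (Real.exp θ - 1) ≤ a) :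
    indep ρ (fun y => Real.exp (θ * (D.filter fun e => y e = 1).card)) ≤
      Real.exp (a * D.card) := by
  have h1 : ∀ y : ε → Fin 2, Real.exp (θ * (D.filter fun e => y e = 1).card) =
      ∏ e, if e ∈ D ∧ y e = 1 then Real.exp θ else 1 := fun y => by
    rw [mul_comm, Real.exp_nat_mul, ← Finset.prod_const, Finset.prod_filter,
      ← Finset.prod_subset (Finset.subset_univ D) fun e _ he => by simp [he]]
    exact Finset.prod_congr rfl fun e he => by simp [he]
  simp_rw [h1]
  rw [indep_prod ρ fun e i => if e ∈ D ∧ i = 1 then Real.exp θ else 1]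
  have h2 : Real.exp (a * D.card) = ∏ e, if e ∈ D then Real.exp a else 1 := by
    rw [Finset.prod_ite_mem, Finset.univ_inter, Finset.prod_const, mul_comm, Real.exp_nat_mul]
  rw [h2]
  refine Finset.prod_le_prod (fun e _ => Finset.sum_nonneg fun i _ =>
    mul_nonneg (hρ0 e i) (by split_ifs <;> positivity)) fun e _ => ?_
  rw [Fin.sum_univ_two]
  by_cases he : e ∈ D
  · simp only [he, true_and, if_true, zero_ne_one, if_false, mul_one]
    have := Real.add_one_le_exp a
    have h3 := ha e he
    have h4 := hρ1 e
    linarith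
  · simp [he, hρ1]

theorem indep_card_gt_le {ε : Type*} [Fintype ε] [DecidableEq ε] {ρ : ε → Fin 2 → ℝ} {ϖ : ℝ}
    (hρ0 : ∀ e i, 0 ≤ ρ e i) (hρ1 : ∀ e, ρ e 0 + ρ e 1 = 1) (hρϖ : ∀ e, ρ e 1 ≤ 2 * ϖ)
    (D : Finset ε) (T : ℝ) :
    indep ρ (fun y => if T < (D.filter fun e => y e = 1).card then 1 else 0) ≤
      Real.exp (4 * ϖ * D.card - T) := by
  have h1 := indep_exp_le hρ0 hρ1 D (θ := 1) (a := 4 * ϖ) fun e _ => by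
    have := Real.exp_one_lt_d9
    have := hρ0 e 1
    have := hρϖ e
    nlinarith
  calc _ ≤ indep ρ (fun y => Real.exp (-T) * Real.exp (1 * (D.filter fun e => y e = 1).card)) := by
        refine indep_mono hρ0 fun y => ?_
        rw [← Real.exp_add]
        split_ifs with h
        · exact Real.one_le_exp (by linarith)
        · exact Real.exp_nonneg _
    _ ≤ Real.exp (-T) * Real.exp (4 * ϖ * D.card) := by
        rw [indep_const_mul]
        exact mul_le_mul_of_nonneg_left h1 (Real.exp_nonneg _)
    _ = _ := by rw [← Real.exp_add]; congr 1; ring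

theorem indep_card_lt_le {ε : Type*} [Fintype ε] [DecidableEq ε] {ρ : ε → Fin 2 → ℝ} {ϖ : ℝ}
    (hρ0 : ∀ e i, 0 ≤ ρ e i) (hρ1 : ∀ e, ρ e 0 + ρ e 1 = 1) (hρϖ : ∀ e, ϖ / 2 ≤ ρ e 1)
    (D : Finset ε) (T : ℝ) :
    indep ρ (fun y => if ((D.filter fun e => y e = 1).card : ℝ) < T then 1 else 0) ≤
      Real.exp (T - ϖ / 4 * D.card) := by
  have h1 := indep_exp_le hρ0 hρ1 D (θ := -1) (a := -(ϖ / 4)) fun e _ => by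
    have h2 : Real.exp (-1) ≤ 1 / 2 := by
      rw [Real.exp_neg, one_div]
      exact inv_anti₀ two_pos (by linarith [Real.add_one_le_exp (1 : ℝ)])
    have := hρ0 e 1
    have := hρϖ e
    nlinarith
  calc _ ≤ indep ρ (fun y => Real.exp T * Real.exp (-1 * (D.filter fun e => y e = 1).card)) := by
        refine indep_mono hρ0 fun y => ?_
        rw [← Real.exp_add]
        split_ifs with h
        · exact Real.one_le_exp (by linarith)
        · exact Real.exp_nonneg _
    _ ≤ Real.exp T * Real.exp (-(ϖ / 4) * D.card) := by
        rw [indep_const_mul]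
        exact mul_le_mul_of_nonneg_left h1 (Real.exp_nonneg _)
    _ = _ := by rw [← Real.exp_add]; congr 1; ring

variable {V : Type*} [Fintype V] [DecidableEq V]

/-- The graph whose edges are the pairs `e` with `y e = 1`. -/
def graphOf {V : Type*} (y : Pair V → Fin 2) : SimpleGraph V :=
  SimpleGraph.fromEdgeSet {e | ∃ h : ¬ e.IsDiag, y ⟨e, h⟩ = 1}

theorem graphOf_adj {V : Type*} (y : Pair V → Fin 2) (u v : V) :
    (graphOf y).Adj u v ↔ ∃ h : ¬ (s(u, v)).IsDiag, y ⟨s(u, v), h⟩ = 1 := by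
  unfold graphOf
  rw [SimpleGraph.fromEdgeSet_adj]
  constructor
  · exact fun h => h.1
  · rintro ⟨h, h'⟩
    exact ⟨⟨h, h'⟩, fun e => h (by simp [e])⟩

open scoped Classical in
/-- The pairs with one end in `S` and the other outside. -/
def cutPairs (S : Finset V) : Finset (Pair V) :=
  Finset.univ.filter fun e => ∃ u ∈ S, ∃ v ∈ Sᶜ, e.1 = s(u, v)

open scoped Classical in
-- An unordered pair crossing the cut has exactly one orientation from `S` to its complement.
theorem card_cutPairs_filter (S : Finset V) (Q : Pair V → Prop) [DecidablePred Q] :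
    ((cutPairs S).filter Q).card =
      ((S ×ˢ Sᶜ).filter fun a => ∃ h : ¬ (s(a.1, a.2)).IsDiag, Q ⟨s(a.1, a.2), h⟩).card := by
  symm
  refine Finset.card_bij (fun a ha => ⟨s(a.1, a.2), (Finset.mem_filter.1 ha).2.choose⟩) ?_ ?_ ?_
  · intro a ha
    obtain ⟨h1, h2, h3⟩ := Finset.mem_filter.1 ha
    rw [Finset.mem_product] at h1
    exact Finset.mem_filter.2 ⟨Finset.mem_filter.2 ⟨Finset.mem_univ _, a.1, h1.1, a.2, h1.2, rfl⟩,
      h3⟩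
  · rintro ⟨a, b⟩ ha ⟨a', b'⟩ ha' h
    have h1 := Finset.mem_product.1 (Finset.mem_filter.1 ha).1
    have h1' := Finset.mem_product.1 (Finset.mem_filter.1 ha').1
    simp only [Subtype.mk.injEq, Sym2.eq_iff] at h
    rcases h with ⟨rfl, rfl⟩ | ⟨rfl, rfl⟩
    · rfl
    · exact absurd h1.1 (Finset.mem_compl.1 h1'.2)
  · rintro ⟨e, he⟩ hmem
    obtain ⟨h1, h2⟩ := Finset.mem_filter.1 hmem
    obtain ⟨-, u, hu, v, hv, huv⟩ := Finset.mem_filter.1 h1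
    subst huv
    exact ⟨(u, v), Finset.mem_filter.2 ⟨Finset.mem_product.2 ⟨hu, hv⟩, he, h2⟩, rfl⟩

theorem card_cutPairs (S : Finset V) : (cutPairs S).card = S.card * (Fintype.card V - S.card) := by
  classical
  have := card_cutPairs_filter S fun _ => True
  rw [Finset.filter_true_of_mem fun _ _ => trivial] at this
  rw [this, Finset.filter_true_of_mem, Finset.card_product, Finset.card_compl]
  rintro ⟨u, v⟩ huv
  obtain ⟨h1, h2⟩ := Finset.mem_product.1 huv
  refine ⟨fun h => ?_, trivial⟩
  rw [Sym2.mk_isDiag_iff] at h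
  exact Finset.mem_compl.1 h2 (h ▸ h1)

open scoped Classical in
theorem degree_graphOf (y : Pair V → Fin 2) (u : V) :
    (graphOf y).degree u = ((cutPairs {u}).filter fun e => y e = 1).card := by
  rw [card_cutPairs_filter, ← SimpleGraph.card_neighborFinset_eq_degree]
  refine Finset.card_bij (fun v _ => (u, v)) ?_ ?_ ?_
  · intro v hv
    rw [SimpleGraph.mem_neighborFinset] at hv
    have hne := hv.ne
    rw [graphOf_adj] at hv
    exact Finset.mem_filter.2 ⟨by simp [hne.symm], hv⟩
  · intro a _ b _ h
    exact (Prod.mk.inj h).2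
  · rintro ⟨a, b⟩ hab
    obtain ⟨h1, h2⟩ := Finset.mem_filter.1 hab
    obtain ⟨h3, -⟩ := Finset.mem_product.1 h1
    obtain rfl := Finset.mem_singleton.1 h3
    exact ⟨b, by rw [SimpleGraph.mem_neighborFinset, graphOf_adj]; exact h2, rfl⟩

/-- The contraction rate of the lazy Metropolis walk on a typical random graph. -/
def gapConst : ℝ := (1 / 256) ^ 2 / 8

open scoped Classical in
theorem contracting_graphOf {d : ℝ} (hd : 0 < d) (y : Pair V → Fin 2)
    (hdeg : ∀ u, (((cutPairs {u}).filter fun e => y e = 1).card : ℝ) ≤ 8 * d)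
    (hcut : ∀ S : Finset V, S.Nonempty → 2 * S.card ≤ Fintype.card V →
      d / 16 * S.card ≤ ((cutPairs S).filter fun e => y e = 1).card) :
    Contracting gapConst (metropolis (graphOf y)).1 := by
  -- Here `φ = 1/256`, read off `gapConst`, and `2 · 8d · (1/256) = d/16` matches the cut
  -- hypothesis.
  refine metropolis_contracting (graphOf y) (Δ := 8 * d) (by positivity) (by norm_num)
    (fun u => ?_) fun S hS => ?_
  · convert hdeg u
    convert degree_graphOf y u
  · rcases S.eq_empty_or_nonempty with rfl | hne
    · simp
    · have := hcut S hne hS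
      rw [card_cutPairs_filter] at this
      simp_rw [← graphOf_adj] at this
      calc _ = d / 16 * S.card := by ring
        _ ≤ _ := this

open scoped Classical in
-- Union bound over too large degrees and too small cuts, with `d = nϖ`. A set of size `i ≤ n/2` has
-- at least `i n / 2` crossing pairs, so its cut fails with probability at most `exp(-d/16)^i`.
theorem indep_not_contracting_le {ρ : Pair V → Fin 2 → ℝ} {ϖ : ℝ} (hϖ : 0 < ϖ)
    (hρ0 : ∀ e i, 0 ≤ ρ e i) (hρ1 : ∀ e, ρ e 0 + ρ e 1 = 1) (hρl : ∀ e, ϖ / 2 ≤ ρ e 1)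
    (hρu : ∀ e, ρ e 1 ≤ 2 * ϖ) :
    indep ρ (fun y => if Contracting gapConst (metropolis (graphOf y)).1 then 0 else 1) ≤
      Fintype.card V * Real.exp (-(4 * (Fintype.card V * ϖ))) +
        ((1 + Real.exp (-(Fintype.card V * ϖ / 16))) ^ Fintype.card V - 1) := by
  rcases isEmpty_or_nonempty V with hV | hV
  · have : ∀ y : Pair V → Fin 2, Contracting gapConst (metropolis (graphOf y)).1 :=
      fun y => ⟨fun f => by simp, fun f => by simp⟩
    simp [this, indep]
  set n : ℝ := (Fintype.card V : ℝ) with hn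
  have hn0 : 0 < n := by rw [hn]; exact_mod_cast Fintype.card_pos
  set d := n * ϖ with hd
  have hd0 : 0 < d := mul_pos hn0 hϖ
  set 𝒮 : Finset (Finset V) := Finset.univ.filter fun S => S.Nonempty ∧ 2 * S.card ≤ Fintype.card V
  have hpt : ∀ y : Pair V → Fin 2,
      (if Contracting gapConst (metropolis (graphOf y)).1 then (0 : ℝ) else 1) ≤
        (∑ u : V, if 8 * d < ((cutPairs {u}).filter fun e => y e = 1).card then 1 else 0) +
          ∑ S ∈ 𝒮,
            if (((cutPairs S).filter fun e => y e = 1).card : ℝ) < d / 16 * S.card then 1 else 0 := by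
    intro y
    have hA : 0 ≤ ∑ u : V, if 8 * d < ((cutPairs {u}).filter fun e => y e = 1).card
        then (1 : ℝ) else 0 := Finset.sum_nonneg fun u _ => by split_ifs <;> norm_num
    have hB : 0 ≤ ∑ S ∈ 𝒮, if (((cutPairs S).filter fun e => y e = 1).card : ℝ) <
        d / 16 * S.card then (1 : ℝ) else 0 :=
      Finset.sum_nonneg fun u _ => by split_ifs <;> norm_num
    split_ifs with hc
    · linarith
    · by_cases h1 : ∀ u, (((cutPairs {u}).filter fun e => y e = 1).card : ℝ) ≤ 8 * d
      · by_cases h2 : ∀ S : Finset V, S.Nonempty → 2 * S.card ≤ Fintype.card V →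
          d / 16 * S.card ≤ ((cutPairs S).filter fun e => y e = 1).card
        · exact absurd (contracting_graphOf hd0 y h1 h2) hc
        · push Not at h2
          obtain ⟨S, hS1, hS2, hS3⟩ := h2
          have := Finset.single_le_sum (s := 𝒮) (f := fun S =>
            if (((cutPairs S).filter fun e => y e = 1).card : ℝ) < d / 16 * S.card
            then (1 : ℝ) else 0) (fun u _ => by split_ifs <;> norm_num)
            (Finset.mem_filter.2 ⟨Finset.mem_univ S, hS1, hS2⟩)
          simp only [hS3, if_true] at this
          linarith
      · push Not at h1
        obtain ⟨u, hu⟩ := h1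
        have := Finset.single_le_sum (s := Finset.univ) (f := fun u =>
          if 8 * d < ((cutPairs {u}).filter fun e => y e = 1).card
          then (1 : ℝ) else 0) (fun u _ => by split_ifs <;> norm_num) (Finset.mem_univ u)
        simp only [hu, if_true] at this
        linarith
  refine (indep_mono hρ0 hpt).trans ?_
  rw [indep_add, indep_sum, indep_sum]
  refine add_le_add ?_ ?_
  · calc _ ≤ ∑ _u : V, Real.exp (-(4 * d)) := by
          refine Finset.sum_le_sum fun u _ => ?_
          refine (indep_card_gt_le hρ0 hρ1 hρu _ _).trans (Real.exp_le_exp.2 ?_)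
          have h1 : ((cutPairs {u}).card : ℝ) ≤ n := by
            rw [card_cutPairs, hn]
            exact_mod_cast (by simp)
          have : 4 * ϖ * (cutPairs {u}).card ≤ 4 * ϖ * n := by gcongr
          rw [hd]; linarith
      _ = _ := by simp [← hn]
  · calc _ ≤ ∑ S ∈ 𝒮, Real.exp (-(d / 16)) ^ S.card := by
          refine Finset.sum_le_sum fun S hS => ?_
          obtain ⟨-, -, hS2⟩ := Finset.mem_filter.1 hS
          refine (indep_card_lt_le hρ0 hρ1 hρl _ _).trans ?_
          rw [← Real.exp_nat_mul]
          refine Real.exp_le_exp.2 ?_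
          have h1 : (S.card : ℝ) * (n / 2) ≤ (cutPairs S).card := by
            rw [card_cutPairs, Nat.cast_mul, Nat.cast_sub (Finset.card_le_univ S), ← hn]
            have : (2 * S.card : ℝ) ≤ n := by rw [hn]; exact_mod_cast hS2
            gcongr
            linarith
          have : ϖ / 4 * (S.card * (n / 2)) ≤ ϖ / 4 * (cutPairs S).card := by gcongr
          rw [hd]; linarith
      -- Extending the sum to all nonempty sets lets the binomial theorem evaluate it.
      _ ≤ ∑ S ∈ Finset.univ.erase (∅ : Finset V), Real.exp (-(d / 16)) ^ S.card := by
          refine Finset.sum_le_sum_of_subset_of_nonneg (fun S hS => ?_)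
            fun _ _ _ => by positivity
          exact Finset.mem_erase.2 ⟨((Finset.mem_filter.1 hS).2.1).ne_empty, Finset.mem_univ _⟩
      _ = _ := by
          have h1 := Finset.prod_one_add (f := fun _ : V => Real.exp (-(d / 16))) Finset.univ
          simp only [Finset.prod_const, Finset.powerset_univ, Finset.card_univ] at h1
          rw [h1, ← Finset.add_sum_erase _ _ (Finset.mem_univ (∅ : Finset V))]
          simp

open scoped Classical in
theorem indep_not_contracting_le_inv_cube {ρ : Pair V → Fin 2 → ℝ} {ϖ : ℝ}
    (hn : 2 ≤ Fintype.card V)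
    (hϖ : 64 * Real.log (Fintype.card V) ≤ Fintype.card V * ϖ)
    (hρ0 : ∀ e i, 0 ≤ ρ e i) (hρ1 : ∀ e, ρ e 0 + ρ e 1 = 1) (hρl : ∀ e, ϖ / 2 ≤ ρ e 1)
    (hρu : ∀ e, ρ e 1 ≤ 2 * ϖ) :
    indep ρ (fun y => if Contracting gapConst (metropolis (graphOf y)).1 then 0 else 1) ≤
      3 / (Fintype.card V : ℝ) ^ 3 := by
  have hn2 : (2 : ℝ) ≤ Fintype.card V := by exact_mod_cast hn
  set n : ℝ := (Fintype.card V : ℝ) with hnn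
  have hn0 : 0 < n := by linarith
  have hlog : 0 < Real.log n := Real.log_pos (by linarith)
  have hϖ0 : 0 < ϖ := by
    by_contra h
    nlinarith
  refine (indep_not_contracting_le hϖ0 hρ0 hρ1 hρl hρu).trans ?_
  rw [← hnn]
  have hpow : ∀ k : ℕ, Real.exp (-(k * Real.log n)) = 1 / n ^ k := fun k => by
    rw [Real.exp_neg, Real.exp_nat_mul, Real.exp_log hn0, one_div]
  have h1 : n * Real.exp (-(4 * (n * ϖ))) ≤ 1 / n ^ 3 := by
    calc n * Real.exp (-(4 * (n * ϖ))) ≤ n * Real.exp (-((4 : ℕ) * Real.log n)) := by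
          refine mul_le_mul_of_nonneg_left (Real.exp_le_exp.2 ?_) hn0.le
          push_cast
          linarith
      _ = 1 / n ^ 3 := by rw [hpow]; field_simp
  have h2 : (1 + Real.exp (-(n * ϖ / 16))) ^ Fintype.card V - 1 ≤ 2 / n ^ 3 := by
    -- This is where the constant 64 in the density hypothesis is spent: `64/16 = 4` powers of `n`,
    -- one of which goes to the union bound.
    have h3 : Real.exp (-(n * ϖ / 16)) ≤ 1 / n ^ 4 := by
      rw [← hpow]
      refine Real.exp_le_exp.2 ?_
      push_cast
      linarith
    have h4 : (1 + Real.exp (-(n * ϖ / 16))) ^ Fintype.card V ≤ Real.exp (1 / n ^ 3) := by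
      calc _ ≤ Real.exp (1 / n ^ 4) ^ Fintype.card V := by
            refine pow_le_pow_left₀ (by positivity) ?_ _
            have := Real.add_one_le_exp (1 / n ^ 4)
            linarith
        _ = _ := by
            rw [← Real.exp_nat_mul, ← hnn]
            congr 1
            field_simp
    have h5 : |1 / n ^ 3| ≤ 1 := by
      rw [abs_of_nonneg (by positivity), div_le_one (by positivity)]
      exact one_le_pow₀ (by linarith)
    have h6 := Real.abs_exp_sub_one_le h5
    rw [abs_of_nonneg (by positivity : (0 : ℝ) ≤ 1 / n ^ 3)] at h6
    have h7 := le_abs_self (Real.exp (1 / n ^ 3) - 1)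
    have e : 2 / n ^ 3 = 2 * (1 / n ^ 3) := by ring
    linarith
  have e : 3 / n ^ 3 = 1 / n ^ 3 + 2 / n ^ 3 := by ring
  linarith

end RandomGraph

/-! ### The edge chains -/

section EdgeChain

variable {V : Type*} [Fintype V] [DecidableEq V] [MeasurableSpace V] [MeasurableSingletonClass V]

theorem lintegral_stepKernel (P : Matrix.rowStochastic ℝ V) (u : V) (g : V → ℝ≥0∞) :
    ∫⁻ v, g v ∂stepKernel P u = ∑ v, g v * ENNReal.ofReal (P.1 u v) := by
  rw [lintegral_fintype]
  refine Finset.sum_congr rfl fun v _ => ?_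
  congr 1
  exact PMF.toMeasure_apply_singleton (rowPMF P u) v (measurableSet_singleton v)

theorem lintegral_walkLaw_add (P : Matrix.rowStochastic ℝ V) (x : V) {a : ℕ}
    {f : (ℕ → V) → ℝ≥0∞} (hf : DependsOn f (Set.Iic a)) (r : ℕ) (g : V → ℝ≥0∞) :
    ∫⁻ X, f X * g (X (a + r)) ∂walkLaw (fun _ => P) x =
      ∫⁻ X, f X * ∑ v, g v * ENNReal.ofReal ((P ^ r).1 (X a) v) ∂walkLaw (fun _ => P) x := by
  induction r generalizing g with
  | zero =>
    refine lintegral_congr fun X => ?_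
    rw [Finset.sum_eq_single (X a)]
    · simp
    · intro v _ hv
      simp [Matrix.one_apply_ne hv.symm]
    · simp
  | succ r ih =>
    have h1 := lintegral_chainLaw_succ (fun t => stepKernel ((fun _ => P) (t + 1))) x (n := a + r)
      (f := f) (fun X Y h => hf fun i hi => h i (le_trans hi (Nat.le_add_right a r))) g
    simp only [lintegral_stepKernel] at h1
    refine h1.trans ((ih fun u => ∑ v, g v * ENNReal.ofReal (P.1 u v)).trans
      (lintegral_congr fun X => ?_))
    congr 1
    have h2 : ∀ v, ENNReal.ofReal ((P ^ (r + 1)).1 (X a) v) =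
        ∑ u, ENNReal.ofReal ((P ^ r).1 (X a) u) * ENNReal.ofReal (P.1 u v) := fun v => by
      rw [pow_succ]
      show ENNReal.ofReal (((P ^ r).1 * P.1) (X a) v) = _
      rw [Matrix.mul_apply, ENNReal.ofReal_sum_of_nonneg fun u _ =>
        mul_nonneg (rowStochastic_nonneg _ _ _) (rowStochastic_nonneg _ _ _)]
      exact Finset.sum_congr rfl fun u _ => ENNReal.ofReal_mul (rowStochastic_nonneg _ _ _)
    simp_rw [h2, Finset.sum_mul, Finset.mul_sum]
    rw [Finset.sum_comm]
    exact Finset.sum_congr rfl fun v _ => Finset.sum_congr rfl fun u _ => by ring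

theorem walkLaw_path_add (P : Matrix.rowStochastic ℝ V) (x : V) (a r : ℕ)
    (z : Finset.Iic a → V) (v : V) :
    walkLaw (fun _ => P) x {X | Preorder.frestrictLe (π := fun _ => V) a X = z ∧ X (a + r) = v} =
      walkLaw (fun _ => P) x {X | Preorder.frestrictLe (π := fun _ => V) a X = z} *
        ENNReal.ofReal ((P ^ r).1 (z ⟨a, Finset.mem_Iic.2 le_rfl⟩) v) := by
  classical
  have hm : MeasurableSet {X : ℕ → V | Preorder.frestrictLe (π := fun _ => V) a X = z} :=
    measurableSet_eq_fun (Preorder.measurable_frestrictLe a) measurable_const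
  have hm' : MeasurableSet {X : ℕ → V | X (a + r) = v} :=
    measurableSet_eq_fun (measurable_pi_apply (a + r)) measurable_const
  have hmm : MeasurableSet {X : ℕ → V |
      Preorder.frestrictLe (π := fun _ => V) a X = z ∧ X (a + r) = v} := hm.inter hm'
  have h1 := lintegral_walkLaw_add P x (a := a)
    (f := Set.indicator {X : ℕ → V | Preorder.frestrictLe (π := fun _ => V) a X = z} 1)
    (fun X Y h => by
      have : Preorder.frestrictLe (π := fun _ => V) a X = Preorder.frestrictLe a Y := by
        ext i; exact h i (Finset.mem_Iic.1 i.2)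
      simp [Set.indicator, this]) r fun u => if u = v then 1 else 0
  have e1 : ∀ X : ℕ → V,
      Set.indicator {X : ℕ → V | Preorder.frestrictLe (π := fun _ => V) a X = z} 1 X *
        (if X (a + r) = v then (1 : ℝ≥0∞) else 0) =
      Set.indicator {X | Preorder.frestrictLe (π := fun _ => V) a X = z ∧ X (a + r) = v} 1 X := by
    intro X
    by_cases h : Preorder.frestrictLe (π := fun _ => V) a X = z <;>
      by_cases h' : X (a + r) = v <;> simp [Set.indicator, h, h']
  have e2 : ∀ X : ℕ → V,
      Set.indicator {X : ℕ → V | Preorder.frestrictLe (π := fun _ => V) a X = z} 1 X *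
        ∑ u, (if u = v then (1 : ℝ≥0∞) else 0) * ENNReal.ofReal ((P ^ r).1 (X a) u) =
      Set.indicator {X : ℕ → V | Preorder.frestrictLe (π := fun _ => V) a X = z} 1 X *
        ENNReal.ofReal ((P ^ r).1 (z ⟨a, Finset.mem_Iic.2 le_rfl⟩) v) := by
    intro X
    by_cases h : Preorder.frestrictLe (π := fun _ => V) a X = z
    · have : X a = z ⟨a, Finset.mem_Iic.2 le_rfl⟩ := congrFun h ⟨a, Finset.mem_Iic.2 le_rfl⟩
      simp [this]
    · simp [Set.indicator, h]
  simp_rw [e1, e2] at h1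
  rw [lintegral_indicator_one hmm, lintegral_mul_const _ (measurable_one.indicator hm),
    lintegral_indicator_one hm] at h1
  exact h1

end EdgeChain

/-! ### Mixing of a single edge -/

section EdgePow

variable {p q : I}

theorem edgeMatrix_pow (hpq : 0 < (p : ℝ) + q) (r : ℕ) (i : Fin 2) :
    (edgeMatrix p q ^ r).1 i 1 =
      (p : ℝ) / (p + q) + ((i : ℕ) - (p : ℝ) / (p + q)) * (1 - p - q) ^ r := by
  induction r with
  | zero => fin_cases i <;> simp
  | succ r ih =>
    have h0 := rowStochastic_sum (edgeMatrix p q ^ r) i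
    rw [Fin.sum_univ_two] at h0
    have h1 : (edgeMatrix p q ^ (r + 1)).1 i 1 =
        (edgeMatrix p q ^ r).1 i 0 * p + (edgeMatrix p q ^ r).1 i 1 * (1 - q) := by
      rw [pow_succ]
      show ((edgeMatrix p q ^ r).1 * (edgeMatrix p q).1) i 1 = _
      rw [Matrix.mul_apply, Fin.sum_univ_two]
      simp [edgeMatrix]
    have h2 : (edgeMatrix p q ^ r).1 i 0 = 1 - (edgeMatrix p q ^ r).1 i 1 := by linarith
    have h3 : (p : ℝ) / (p + q) * (p + q) = p := div_mul_cancel₀ _ hpq.ne'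
    rw [h1, h2, ih, pow_succ]
    linear_combination -h3

/-- With `w = p/(p+q)`, the error factor satisfies `(1-p-q)^r ≤ exp(-1/w)`, which is at most both
`1/2` and `w`. The first gives the lower bound from state 0, the second the upper bound from state
1; relative accuracy in `w` is what requires time `1/p` and not only `1/(p+q)`. -/
theorem edgeMatrix_pow_bounds (hp : 0 < (p : ℝ)) (hpq1 : (p : ℝ) + q ≤ 1) {r : ℕ}
    (hr : 1 / (p : ℝ) ≤ r) (i : Fin 2) :
    (p : ℝ) / (p + q) / 2 ≤ (edgeMatrix p q ^ r).1 i 1 ∧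
      (edgeMatrix p q ^ r).1 i 1 ≤ 2 * ((p : ℝ) / (p + q)) := by
  have hq := q.2.1
  have hpq : 0 < (p : ℝ) + q := by linarith
  rw [edgeMatrix_pow hpq]
  set w : ℝ := (p : ℝ) / (p + q) with hw
  have hw0 : 0 < w := div_pos hp hpq
  have hw1 : w ≤ 1 := by rw [hw, div_le_one hpq]; linarith
  set l : ℝ := (1 - p - q : ℝ) ^ r with hl
  have hl0 : 0 ≤ l := pow_nonneg (by linarith) r
  have hle : l ≤ Real.exp (-(1 / w)) := by
    calc l ≤ Real.exp (-((p : ℝ) + q)) ^ r := by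
          refine pow_le_pow_left₀ (by linarith) ?_ r
          have := Real.add_one_le_exp (-((p : ℝ) + q))
          linarith
      _ ≤ _ := by
          rw [← Real.exp_nat_mul]
          refine Real.exp_le_exp.2 ?_
          have : 1 / w = 1 / (p : ℝ) * (p + q) := by rw [hw]; field_simp
          rw [this]
          nlinarith
  have hx : 1 ≤ 1 / w := by rw [le_div_iff₀ hw0]; linarith
  have h1 : Real.exp (-(1 / w)) * Real.exp (1 / w) = 1 := by rw [← Real.exp_add]; simp
  have h2 := Real.add_one_le_exp (1 / w)
  have h0 := Real.exp_pos (-(1 / w))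
  have hl2 : l ≤ 1 / 2 := by nlinarith
  have hlw : l ≤ w := by
    have h3 : Real.exp (-(1 / w)) * (1 / w) ≤ 1 := by nlinarith
    rw [mul_one_div, div_le_one hw0] at h3
    linarith
  fin_cases i
  · simp only [Nat.cast_zero]
    constructor <;> nlinarith
  · simp only [Nat.cast_one]
    constructor <;> nlinarith

end EdgePow

/-! ### Conditional law of later graphs given the past -/

section EdgeProcess

variable {V : Type*} [Fintype V] [DecidableEq V]

instance (p q : I) (G₀ : SimpleGraph V) : IsProbabilityMeasure (edgeMarkovianLaw p q G₀) := by
  unfold edgeMarkovianLaw; infer_instance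

/-- The edge indicators up to time `a`. -/
def history {V : Type*} (a : ℕ) (Y : Pair V → ℕ → Fin 2) : Pair V → Finset.Iic a → Fin 2 :=
  fun e => Preorder.frestrictLe (π := fun _ => Fin 2) a (Y e)

theorem measurable_history {V : Type*} (a : ℕ) : Measurable (history (V := V) a) :=
  measurable_pi_lambda _ fun e =>
    (Preorder.measurable_frestrictLe a).comp (measurable_pi_apply e)

/-- The edge indicators at time `t`. -/
def snapshot {V : Type*} (t : ℕ) (Y : Pair V → ℕ → Fin 2) : Pair V → Fin 2 := fun e => Y e t

theorem measurable_snapshot {V : Type*} (t : ℕ) : Measurable (snapshot (V := V) t) :=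
  measurable_pi_lambda _ fun e => (measurable_pi_apply t).comp (measurable_pi_apply e)

variable {p q : I} {G₀ : SimpleGraph V}

open scoped Classical in
-- Given the whole history up to `a`, the edges at time `a + r` are independent, with weights from
-- the rows of the `r`-th power. The events factor over the edges and are summed over the finitely
-- many snapshots in `B`.
theorem edgeMarkovianLaw_history_snapshot_le {a r : ℕ} (B : Set (Pair V → Fin 2)) {ε : ℝ}
    (hε : ∀ y : Pair V → Fin 2, indep (fun e => (edgeMatrix p q ^ r).1 (y e))
      (fun y' => if y' ∈ B then 1 else 0) ≤ ε) (z : Pair V → Finset.Iic a → Fin 2) :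
    edgeMarkovianLaw p q G₀ {Y | history a Y = z ∧ snapshot (a + r) Y ∈ B} ≤
      ENNReal.ofReal ε * edgeMarkovianLaw p q G₀ {Y | history a Y = z} := by
  set x : Pair V → Fin 2 := fun e => if e.1 ∈ G₀.edgeSet then 1 else 0 with hx
  have hlaw : edgeMarkovianLaw p q G₀ =
      Measure.pi fun e => walkLaw (fun _ => edgeMatrix p q) (x e) := rfl
  set M : ℝ≥0∞ := ∏ e, walkLaw (fun _ => edgeMatrix p q) (x e)
    {X | Preorder.frestrictLe (π := fun _ => Fin 2) a X = z e} with hM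
  have h1 : edgeMarkovianLaw p q G₀ {Y | history a Y = z} = M := by
    have : {Y : Pair V → ℕ → Fin 2 | history a Y = z} = Set.univ.pi fun e =>
        {X | Preorder.frestrictLe (π := fun _ => Fin 2) a X = z e} := by
      ext Y; simp [history, funext_iff (f := history a Y)]
    rw [this, hlaw, Measure.pi_pi]
  have h2 : ∀ y : Pair V → Fin 2,
      edgeMarkovianLaw p q G₀ {Y | history a Y = z ∧ snapshot (a + r) Y = y} =
        M * ENNReal.ofReal (∏ e, (edgeMatrix p q ^ r).1 (z e ⟨a, Finset.mem_Iic.2 le_rfl⟩) (y e)) := by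
    intro y
    have : {Y : Pair V → ℕ → Fin 2 | history a Y = z ∧ snapshot (a + r) Y = y} =
        Set.univ.pi fun e =>
          {X | Preorder.frestrictLe (π := fun _ => Fin 2) a X = z e ∧ X (a + r) = y e} := by
      ext Y
      simp only [Set.mem_ofPred_eq, Set.mem_pi, Set.mem_univ, true_implies, forall_and,
        funext_iff (f := history a Y), funext_iff (f := snapshot (a + r) Y)]
      rfl
    rw [this, hlaw, Measure.pi_pi, ENNReal.ofReal_prod_of_nonneg fun e _ =>
      rowStochastic_nonneg _ _ _, ← Finset.prod_mul_distrib]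
    exact Finset.prod_congr rfl fun e _ => walkLaw_path_add _ _ _ _ _ _
  have h3 : {Y : Pair V → ℕ → Fin 2 | history a Y = z ∧ snapshot (a + r) Y ∈ B} =
      ⋃ y ∈ Finset.univ.filter (· ∈ B), {Y | history a Y = z ∧ snapshot (a + r) Y = y} := by
    ext Y
    simp only [Set.mem_ofPred_eq, Finset.mem_filter, Finset.mem_univ, true_and, Set.mem_iUnion,
      exists_prop]
    constructor
    · rintro ⟨h, h'⟩
      exact ⟨_, h', h, rfl⟩
    · rintro ⟨y, h, h', h''⟩
      exact ⟨h', h'' ▸ h⟩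
  rw [h3, h1]
  refine (measure_biUnion_finset_le _ _).trans ?_
  simp_rw [h2]
  rw [← Finset.mul_sum, mul_comm]
  refine mul_le_mul_left ?_ _
  rw [← ENNReal.ofReal_sum_of_nonneg fun y _ => Finset.prod_nonneg fun e _ =>
    rowStochastic_nonneg _ _ _]
  refine ENNReal.ofReal_le_ofReal (le_trans (le_of_eq ?_)
    (hε fun e => z e ⟨a, Finset.mem_Iic.2 le_rfl⟩))
  simp [indep, Finset.sum_filter]

open scoped Classical in
/-- Conditionally on the edges up to time `a`, the edges at time `a + r` lie in `B` with
probability at most `ε`. -/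
theorem lintegral_history_snapshot_le {a r : ℕ} (B : Set (Pair V → Fin 2)) {ε : ℝ}
    (hε : ∀ y : Pair V → Fin 2, indep (fun e => (edgeMatrix p q ^ r).1 (y e))
      (fun y' => if y' ∈ B then 1 else 0) ≤ ε) (F : (Pair V → Finset.Iic a → Fin 2) → ℝ≥0∞) :
    ∫⁻ Y, F (history a Y) * (if snapshot (a + r) Y ∈ B then 1 else 0) ∂edgeMarkovianLaw p q G₀ ≤
      ENNReal.ofReal ε * ∫⁻ Y, F (history a Y) ∂edgeMarkovianLaw p q G₀ := by
  set μ := edgeMarkovianLaw p q G₀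
  have hB : MeasurableSet {Y : Pair V → ℕ → Fin 2 | snapshot (a + r) Y ∈ B} :=
    measurable_snapshot (a + r) (Set.toFinite B).measurableSet
  have hF : Measurable F := Measurable.of_discrete
  have e1 : ∫⁻ Y, F (history a Y) * (if snapshot (a + r) Y ∈ B then 1 else 0) ∂μ =
      ∫⁻ z, F z ∂((μ.restrict {Y | snapshot (a + r) Y ∈ B}).map (history a)) := by
    rw [lintegral_map hF (measurable_history a), ← lintegral_indicator hB]
    refine lintegral_congr fun Y => ?_
    by_cases h : snapshot (a + r) Y ∈ B <;> simp [Set.indicator, h]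
  rw [e1, ← lintegral_map hF (measurable_history a), lintegral_fintype, lintegral_fintype,
    Finset.mul_sum]
  refine Finset.sum_le_sum fun z _ => ?_
  have hz : MeasurableSet {z} := measurableSet_singleton z
  rw [Measure.map_apply (measurable_history a) hz, Measure.map_apply (measurable_history a) hz,
    Measure.restrict_apply (measurable_history a hz)]
  calc _ ≤ F z * (ENNReal.ofReal ε * μ {Y | history a Y = z}) :=
        mul_le_mul_right (edgeMarkovianLaw_history_snapshot_le B hε z) _
    _ = _ := by
      rw [← mul_assoc, mul_comm (F z), mul_assoc]
      rfl

end EdgeProcess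

/-! ### Blocks of good graphs -/

section Blocks

variable {V : Type*} [Fintype V] [DecidableEq V]

/-- All walk steps in the final part of the `b`-th block of length `L` contract. -/
def GoodBlock (P : ℕ → Matrix.rowStochastic ℝ V) (L T b : ℕ) : Prop :=
  ∀ t, b * L + T < t → t ≤ (b + 1) * L → Contracting gapConst (P t).1

open scoped Classical in
/-- The product of factors `1/2`, one for each good block among the first `j`. -/
def discount (P : ℕ → Matrix.rowStochastic ℝ V) (L T j : ℕ) : ℝ≥0∞ :=
  ∏ b ∈ Finset.range j, if GoodBlock P L T b then 2⁻¹ else 1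

/-- The walk sequence of an edge-indicator sequence. -/
abbrev metropolisSeq (Y : Pair V → ℕ → Fin 2) : ℕ → Matrix.rowStochastic ℝ V :=
  fun t => metropolis (graphAt Y t)

theorem graphAt_eq_graphOf {V : Type*} (Y : Pair V → ℕ → Fin 2) (t : ℕ) :
    graphAt Y t = graphOf (snapshot t Y) := rfl

theorem discount_metropolisSeq_congr {Y Y' : Pair V → ℕ → Fin 2} {L T j : ℕ}
    (h : ∀ t ≤ j * L, snapshot t Y = snapshot t Y') :
    discount (metropolisSeq Y) L T j = discount (metropolisSeq Y') L T j := by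
  classical
  unfold discount
  refine Finset.prod_congr rfl fun b hb => ?_
  have hbj : (b + 1) * L ≤ j * L := Nat.mul_le_mul_right L (Finset.mem_range.1 hb)
  have : GoodBlock (metropolisSeq Y) L T b ↔ GoodBlock (metropolisSeq Y') L T b := by
    refine forall_congr' fun t => forall_congr' fun _ => forall_congr' fun ht => ?_
    simp only [metropolisSeq, graphAt_eq_graphOf, h t (ht.trans hbj)]
  exact if_congr this rfl rfl

/-- The first `j` blocks end at time `jL`, so the discount is measurable with respect to the past of
block `j`; the value 0 filled in at later times is never read. -/
theorem exists_discount_eq_history (L T j : ℕ) :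
    ∃ F : (Pair V → Finset.Iic (j * L) → Fin 2) → ℝ≥0∞, ∀ Y : Pair V → ℕ → Fin 2,
      discount (metropolisSeq Y) L T j = F (history (j * L) Y) := by
  refine ⟨fun z => discount (metropolisSeq fun e t =>
    if h : t ≤ j * L then z e ⟨t, Finset.mem_Iic.2 h⟩ else 0) L T j, fun Y => ?_⟩
  refine discount_metropolisSeq_congr fun t ht => ?_
  ext e
  simp [snapshot, history, ht]

theorem measurable_discount (L T j : ℕ) :
    Measurable fun Y : Pair V → ℕ → Fin 2 => discount (metropolisSeq Y) L T j := by
  obtain ⟨F, hF⟩ := exists_discount_eq_history (V := V) L T j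
  simp_rw [hF]
  exact (Measurable.of_discrete (f := F)).comp (measurable_history _)

theorem half_pow_le_discount (P : ℕ → Matrix.rowStochastic ℝ V) (L T j : ℕ) :
    2⁻¹ ^ j ≤ discount P L T j := by
  unfold discount
  calc (2⁻¹ : ℝ≥0∞) ^ j = ∏ _b ∈ Finset.range j, 2⁻¹ := by simp
    _ ≤ _ := Finset.prod_le_prod' fun b _ => by
      split_ifs
      · exact le_rfl
      · exact ENNReal.inv_le_one.2 one_le_two

variable {p q : I} {G₀ : SimpleGraph V}

/-- Given the past of a block, a union bound over its last `L - T` times makes it bad with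
probability at most `η`, so its factor has conditional mean at most `(1 + η)/2`. The hypothesis `hη`
says `(L - T) · 3/n³ ≤ η`. -/
theorem lintegral_discount_le (hn : 2 ≤ Fintype.card V) (hp : 0 < (p : ℝ))
    (hpq1 : (p : ℝ) + q ≤ 1)
    (hϖ : 64 * Real.log (Fintype.card V) ≤ Fintype.card V * ((p : ℝ) / (p + q)))
    {L T : ℕ} (hT : 1 / (p : ℝ) ≤ T) {η : ℝ}
    (hη : (L : ℝ) * (3 / (Fintype.card V : ℝ) ^ 3) ≤ η + T * (3 / (Fintype.card V : ℝ) ^ 3))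
    (hTL : T ≤ L) (j : ℕ) :
    ∫⁻ Y, discount (metropolisSeq Y) L T j ∂edgeMarkovianLaw p q G₀ ≤
      ENNReal.ofReal ((1 + η) / 2) ^ j := by
  classical
  set μ := edgeMarkovianLaw p q G₀
  set ε : ℝ := 3 / (Fintype.card V : ℝ) ^ 3 with hε
  have hε0 : 0 ≤ ε := by positivity
  obtain ⟨B, hB⟩ : ∃ B : Set (Pair V → Fin 2),
      B = {y | ¬ Contracting gapConst (metropolis (graphOf y)).1} := ⟨_, rfl⟩
  have hTL' : (T : ℝ) ≤ L := by exact_mod_cast hTL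
  have hη0 : 0 ≤ η := by nlinarith
  have hbad : ∀ r : ℕ, T ≤ r → ∀ y : Pair V → Fin 2,
      indep (fun e => (edgeMatrix p q ^ r).1 (y e)) (fun y' => if y' ∈ B then 1 else 0) ≤ ε := by
    intro r hr y
    have hr' : 1 / (p : ℝ) ≤ r := hT.trans (by exact_mod_cast hr)
    have := indep_not_contracting_le_inv_cube (V := V)
      (ρ := fun e => (edgeMatrix p q ^ r).1 (y e)) hn hϖ (fun _ _ => rowStochastic_nonneg _ _ _)
      (fun e => by
        have := rowStochastic_sum (edgeMatrix p q ^ r) (y e)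
        rwa [Fin.sum_univ_two] at this)
      (fun e => (edgeMatrix_pow_bounds hp hpq1 hr' _).1)
      (fun e => (edgeMatrix_pow_bounds hp hpq1 hr' _).2)
    refine le_trans (le_of_eq ?_) this
    congr 1
    ext y'
    simp only [hB, Set.mem_ofPred_eq]
    split_ifs <;> simp_all
  induction j with
  | zero => simp [discount]
  | succ j ih =>
    obtain ⟨F, hF⟩ := exists_discount_eq_history (V := V) L T j
    set W := Finset.Ioc (j * L + T) ((j + 1) * L) with hW
    have hWc : W.card = L - T := by
      rw [hW, Nat.card_Ioc, Nat.add_mul, one_mul]; omega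
    -- The factor of block `j` is `1/2`, plus another `1/2` if some graph of the window is bad.
    have hstep : ∀ Y : Pair V → ℕ → Fin 2, discount (metropolisSeq Y) L T (j + 1) ≤
        2⁻¹ * F (history (j * L) Y) +
          2⁻¹ * ∑ t ∈ W, F (history (j * L) Y) * (if snapshot t Y ∈ B then 1 else 0) := by
      intro Y
      have h1 : discount (metropolisSeq Y) L T (j + 1) = F (history (j * L) Y) *
          if GoodBlock (metropolisSeq Y) L T j then 2⁻¹ else 1 := by
        rw [← hF]
        unfold discount
        rw [Finset.prod_range_succ]
      rw [h1]
      split_ifs with hg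
      · rw [mul_comm]; exact le_self_add
      · unfold GoodBlock at hg
        push Not at hg
        obtain ⟨t, ht1, ht2, ht3⟩ := hg
        have h2 : F (history (j * L) Y) ≤
            ∑ t ∈ W, F (history (j * L) Y) * (if snapshot t Y ∈ B then 1 else 0) := by
          refine le_trans ?_ (Finset.single_le_sum (f := fun t =>
            F (history (j * L) Y) * (if snapshot t Y ∈ B then 1 else 0)) (fun _ _ => zero_le)
            (Finset.mem_Ioc.2 ⟨ht1, ht2⟩))
          have : snapshot t Y ∈ B := by rw [hB]; exact ht3
          simp [this]
        calc F (history (j * L) Y) * 1 =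
            2⁻¹ * F (history (j * L) Y) + 2⁻¹ * F (history (j * L) Y) := by
              rw [← add_mul, ENNReal.inv_two_add_inv_two, one_mul, mul_one]
          _ ≤ _ := by gcongr
    have hmF : Measurable fun Y : Pair V → ℕ → Fin 2 => F (history (j * L) Y) :=
      (Measurable.of_discrete (f := F)).comp (measurable_history _)
    have hmB : ∀ t, Measurable fun Y : Pair V → ℕ → Fin 2 =>
        F (history (j * L) Y) * (if snapshot t Y ∈ B then 1 else 0) := fun t =>
      hmF.mul ((Measurable.of_discrete (f := fun y => if y ∈ B then (1 : ℝ≥0∞) else 0)).comp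
        (measurable_snapshot t))
    set M := ∫⁻ Y, F (history (j * L) Y) ∂μ with hM
    have hMle : M ≤ ENNReal.ofReal ((1 + η) / 2) ^ j := by
      rw [hM]; simpa only [hF] using ih
    calc _ ≤ ∫⁻ Y, (2⁻¹ * F (history (j * L) Y) + 2⁻¹ * ∑ t ∈ W, F (history (j * L) Y) *
            (if snapshot t Y ∈ B then 1 else 0)) ∂μ := lintegral_mono hstep
      _ = 2⁻¹ * M + 2⁻¹ * ∑ t ∈ W, ∫⁻ Y, F (history (j * L) Y) *
            (if snapshot t Y ∈ B then 1 else 0) ∂μ := by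
          rw [lintegral_add_left (hmF.const_mul _), lintegral_const_mul _ hmF,
            lintegral_const_mul _ (Finset.measurable_sum _ fun t _ => hmB t),
            lintegral_finsetSum _ fun t _ => hmB t]
      _ ≤ 2⁻¹ * M + 2⁻¹ * ∑ _t ∈ W, ENNReal.ofReal ε * M := by
          gcongr with t ht
          obtain ⟨h1, h2⟩ := Finset.mem_Ioc.1 ht
          obtain ⟨r, rfl⟩ := Nat.exists_eq_add_of_le (show j * L ≤ t by omega)
          exact lintegral_history_snapshot_le B (hbad r (by omega)) F
      _ = ENNReal.ofReal ((1 + (L - T : ℝ) * ε) / 2) * M := by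
          rw [Finset.sum_const, hWc, nsmul_eq_mul, ← mul_assoc, ← mul_assoc, ← add_mul]
          congr 1
          have e1 : (2⁻¹ : ℝ≥0∞) = ENNReal.ofReal (1 / 2) := by
            rw [one_div, ENNReal.ofReal_inv_of_pos two_pos]; simp
          have e2 : ((L - T : ℕ) : ℝ≥0∞) = ENNReal.ofReal (L - T : ℝ) := by
            rw [← ENNReal.ofReal_natCast, Nat.cast_sub hTL]
          rw [e1, e2, ← ENNReal.ofReal_mul (by norm_num), ← ENNReal.ofReal_mul
            (mul_nonneg (by norm_num) (by linarith)), ← ENNReal.ofReal_add (by norm_num)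
            (mul_nonneg (mul_nonneg (by norm_num) (by linarith)) hε0)]
          congr 1
          ring
      _ ≤ ENNReal.ofReal ((1 + η) / 2) * ENNReal.ofReal ((1 + η) / 2) ^ j := by
          refine mul_le_mul' (ENNReal.ofReal_le_ofReal ?_) hMle
          linarith
      _ = _ := by rw [pow_succ, mul_comm]

/-- With high probability the sum of the discounts is at most `3`. -/
theorem measure_discount_gt_le (hn : 2 ≤ Fintype.card V) (hp : 0 < (p : ℝ))
    (hpq1 : (p : ℝ) + q ≤ 1)
    (hϖ : 64 * Real.log (Fintype.card V) ≤ Fintype.card V * ((p : ℝ) / (p + q)))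
    {L T : ℕ} (hT : 1 / (p : ℝ) ≤ T) {η : ℝ}
    (hη : (L : ℝ) * (3 / (Fintype.card V : ℝ) ^ 3) ≤ η + T * (3 / (Fintype.card V : ℝ) ^ 3))
    (hTL : T ≤ L) (hη0 : 0 ≤ η) (hη1 : η ≤ 1 / 2) :
    edgeMarkovianLaw p q G₀ {Y | 3 < ∑' j, discount (metropolisSeq Y) L T j} ≤
      ENNReal.ofReal (4 * η) := by
  set μ := edgeMarkovianLaw p q G₀
  -- Markov's inequality on the discounts themselves would not give small probability, as their sum
  -- is never below 2. Subtracting the deterministic minimum `2^{-j}` leaves a nonnegative sum of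
  -- mean at most `4η`, which must reach 1 for the total to exceed 3.
  set D : ℕ → (Pair V → ℕ → Fin 2) → ℝ≥0∞ := fun j Y =>
    discount (metropolisSeq Y) L T j - 2⁻¹ ^ j with hD
  have hDm : ∀ j, Measurable (D j) := fun j => (measurable_discount L T j).sub_const _
  have hsum2 : ∑' j : ℕ, (2⁻¹ : ℝ≥0∞) ^ j = 2 := by
    rw [ENNReal.tsum_geometric, ENNReal.one_sub_inv_two, inv_inv]
  have h1 : ∀ Y, ∑' j, discount (metropolisSeq Y) L T j ≤ ∑' j, D j Y + 2 := by
    intro Y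
    rw [← hsum2, ← ENNReal.tsum_add]
    exact ENNReal.tsum_le_tsum fun j => le_tsub_add
  have h2 : ∀ j, ∫⁻ Y, D j Y ∂μ ≤
      ENNReal.ofReal (((1 + η) / 2) ^ j - (1 / 2) ^ j) := by
    intro j
    have e1 : (2⁻¹ : ℝ≥0∞) ^ j = ENNReal.ofReal ((1 / 2) ^ j) := by
      rw [ENNReal.ofReal_pow (by norm_num), one_div, ENNReal.ofReal_inv_of_pos two_pos]; simp
    rw [lintegral_sub measurable_const (by simp)
      (Filter.Eventually.of_forall fun Y => half_pow_le_discount _ _ _ _), lintegral_const,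
      measure_univ, mul_one, e1, ENNReal.ofReal_sub _ (by positivity)]
    have h := lintegral_discount_le (G₀ := G₀) hn hp hpq1 hϖ hT hη hTL j
    rw [← ENNReal.ofReal_pow (by linarith)] at h
    exact tsub_le_tsub_right h _
  have hs1 := summable_geometric_of_lt_one (r := (1 + η) / 2) (by linarith) (by linarith)
  have hs2 := summable_geometric_of_lt_one (r := (1 : ℝ) / 2) (by norm_num) (by norm_num)
  have h3 : ∫⁻ Y, ∑' j, D j Y ∂μ ≤ ENNReal.ofReal (4 * η) := by
    rw [lintegral_tsum fun j => (hDm j).aemeasurable]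
    refine (ENNReal.tsum_le_tsum h2).trans ?_
    rw [← ENNReal.ofReal_tsum_of_nonneg (fun j => sub_nonneg.2
      (pow_le_pow_left₀ (by norm_num) (by linarith) j)) (hs1.sub hs2),
      hs1.tsum_sub hs2, tsum_geometric_of_lt_one (by linarith) (by linarith),
      tsum_geometric_of_lt_one (by norm_num) (by norm_num)]
    refine ENNReal.ofReal_le_ofReal ?_
    have : (1 - (1 + η) / 2)⁻¹ - (1 - 1 / 2 : ℝ)⁻¹ = 2 * η / (1 - η) := by
      have : (1 - η) ≠ 0 := by linarith
      rw [show 1 - (1 + η) / 2 = (1 - η) / 2 by ring, inv_div]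
      field_simp
      ring
    rw [this, div_le_iff₀ (by linarith)]
    nlinarith
  calc μ {Y | 3 < ∑' j, discount (metropolisSeq Y) L T j} ≤ μ {Y | 1 ≤ ∑' j, D j Y} := by
        refine measure_mono fun Y hY => ?_
        by_contra hcon
        have hcon' : ∑' j, D j Y < 1 := not_le.1 hcon
        have hY' : 3 < ∑' j, discount (metropolisSeq Y) L T j := hY
        have : ∑' j, D j Y + 2 ≤ 1 + 2 := by gcongr
        have h4 := hY'.trans_le ((h1 Y).trans this)
        norm_num at h4
    _ ≤ _ := by
        have hm : Measurable fun Y => ∑' j, D j Y := Measurable.tsum hDm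
        have := mul_meas_ge_le_lintegral (μ := μ) hm 1
        rw [one_mul] at this
        exact this.trans h3

end Blocks

/-! ### Hitting, covering and coalescing in good blocks -/

theorem gapConst_pos : 0 < gapConst := by unfold gapConst; norm_num

theorem gapConst_le_one : gapConst ≤ 1 := by unfold gapConst; norm_num

section Hitting

variable {V : Type*} [Fintype V] [DecidableEq V] [MeasurableSpace V] [MeasurableSingletonClass V]
  (P : ℕ → Matrix.rowStochastic ℝ V)

theorem lintegral_ofReal_stepKernel (P : Matrix.rowStochastic ℝ V) (u : V) {g : V → ℝ}
    (hg : ∀ v, 0 ≤ g v) :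
    ∫⁻ v, ENNReal.ofReal (g v) ∂stepKernel P u = ENNReal.ofReal (P.1.mulVec g u) := by
  rw [lintegral_stepKernel, Matrix.mulVec, dotProduct, ENNReal.ofReal_sum_of_nonneg fun v _ =>
    mul_nonneg (rowStochastic_nonneg _ _ _) (hg v)]
  exact Finset.sum_congr rfl fun v _ => by
    rw [ENNReal.ofReal_mul (rowStochastic_nonneg _ _ _), mul_comm]

theorem measurableSet_avoid {V : Type*} [Countable V] [MeasurableSpace V]
    [MeasurableSingletonClass V] (w : V) (N : ℕ) : MeasurableSet {X : ℕ → V | ∀ t ≤ N, X t ≠ w} := by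
  simp only [Set.ofPred_forall]
  exact MeasurableSet.iInter fun t => MeasurableSet.iInter fun _ =>
    (measurableSet_eq_fun (measurable_pi_apply t) measurable_const).compl

open scoped Classical in
-- Each good block multiplies the avoidance probability by the bound of `avoid_le_exp`, uniformly in
-- the position where its window starts; a bad block multiplies it by at most 1.
theorem walkLaw_avoid_le {L T ℓ s : ℕ} (hL : L = T + (ℓ + s)) (hs : 1 ≤ s)
    (hℓ : Fintype.card V * (1 - gapConst) ^ ℓ ≤ (gapConst / (4 * Fintype.card V)) ^ 2)
    (x w : V) (j : ℕ) :
    walkLaw P x {X | ∀ t ≤ j * L, X t ≠ w} ≤ ∏ b ∈ Finset.range j, if GoodBlock P L T b then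
      ENNReal.ofReal (Real.exp (-(gapConst * s / (4 * Fintype.card V)))) else 1 := by
  induction j with
  | zero => simpa using prob_le_one
  | succ j ih =>
    rw [Finset.prod_range_succ]
    split_ifs with hg
    · set α := ENNReal.ofReal (Real.exp (-(gapConst * s / (4 * Fintype.card V)))) with hα
      set a := j * L + T with ha
      have haL : a + (ℓ + s) = (j + 1) * L := by rw [ha, Nat.add_mul, one_mul]; omega
      set f : (ℕ → V) → ℝ≥0∞ := Set.indicator {X | ∀ t ≤ j * L, X t ≠ w} 1 with hf
      have hfd : DependsOn f (Set.Iic a) := by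
        intro X Y h
        have : (∀ t ≤ j * L, X t ≠ w) ↔ ∀ t ≤ j * L, Y t ≠ w :=
          forall_congr' fun t => forall_congr' fun ht => by rw [h t (show t ≤ a by omega)]
        simp [hf, Set.indicator, this]
      -- The supersolution is the probability of avoiding the constant target `w` from time `t` to
      -- the end of the block, with visits counted only after the burn-in.
      set v : ℕ → V → ℝ≥0∞ := fun t y =>
        ENNReal.ofReal (avoid P (a + ℓ) (fun _ => w) t (a + (ℓ + s) - t) y) with hv
      have hstay := lintegral_stay_le (fun t => stepKernel (P (t + 1))) x hfd (fun _ => {y | y ≠ w})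
        v (ℓ + s) fun t h1 h2 y hy => by
          simp only [hv]
          rw [lintegral_ofReal_stepKernel _ _ (avoid_nonneg _ _ _ _ _),
            show a + (ℓ + s) - t = (a + (ℓ + s) - (t + 1)) + 1 by omega, avoid,
            if_neg fun h => hy h.2]
      calc walkLaw P x {X | ∀ t ≤ (j + 1) * L, X t ≠ w} =
          ∫⁻ X, Set.indicator {X | ∀ t ≤ (j + 1) * L, X t ≠ w} 1 X ∂walkLaw P x :=
            (lintegral_indicator_one (measurableSet_avoid w _)).symm
        _ ≤ _ := by
            refine lintegral_mono fun X => ?_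
            by_cases hX : ∀ t ≤ (j + 1) * L, X t ≠ w
            · have h1 : ∀ t ≤ j * L, X t ≠ w := fun t ht => hX t (by omega)
              have h2 : ∀ t, a ≤ t → t < a + (ℓ + s) → X t ≠ w := fun t _ ht => hX t (by omega)
              have h3 : X (a + (ℓ + s)) ≠ w := hX _ (by omega)
              have e1 : Set.indicator {X | ∀ t ≤ (j + 1) * L, X t ≠ w} 1 X = (1 : ℝ≥0∞) :=
                Set.indicator_of_mem (by exact hX) _
              have e2 : f X = 1 := Set.indicator_of_mem (by exact h1) _
              rw [e1, e2, if_pos (by exact h2), one_mul]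
              simp [hv, h3, avoid]
            · rw [Set.indicator_of_notMem (by exact hX)]
              exact zero_le
        _ ≤ ∫⁻ X, f X * v a (X a) ∂walkLaw P x := hstay
        _ ≤ ∫⁻ X, f X * α ∂walkLaw P x := by
            refine lintegral_mono fun X => mul_le_mul_right ?_ _
            simp only [hv, hα, Nat.add_sub_cancel_left]
            exact ENNReal.ofReal_le_ofReal (avoid_le_exp gapConst_pos gapConst_le_one hs hℓ
              (fun u h1 h2 => hg u h1 (by omega)) _)
        _ = walkLaw P x {X | ∀ t ≤ j * L, X t ≠ w} * α := by
            rw [lintegral_mul_const _ (measurable_one.indicator (measurableSet_avoid w _)),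
              lintegral_indicator_one (measurableSet_avoid w _)]
        _ ≤ _ := mul_le_mul_left ih _
    · rw [mul_one]
      refine le_trans (measure_mono fun X hX => ?_) ih
      have hX' : ∀ t ≤ (j + 1) * L, X t ≠ w := hX
      exact fun t ht => hX' t (by rw [Nat.add_mul]; omega)

open scoped Classical in
theorem walksLaw_avoid_le {L T ℓ s : ℕ} (hL : L = T + (ℓ + s)) (hs : 1 ≤ s)
    (hℓ : Fintype.card V * (1 - gapConst) ^ ℓ ≤ (gapConst / (4 * Fintype.card V)) ^ 2)
    {k : ℕ} (x : Fin k → V) (w : V) (j : ℕ) :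
    walksLaw P x {X | ∀ i, ∀ t ≤ j * L, X i t ≠ w} ≤
      ∏ b ∈ Finset.range j, if GoodBlock P L T b then
        ENNReal.ofReal (Real.exp (-(gapConst * s * k / (4 * Fintype.card V)))) else 1 := by
  have h1 : {X : Fin k → ℕ → V | ∀ i, ∀ t ≤ j * L, X i t ≠ w} =
      Set.univ.pi fun _ => {X | ∀ t ≤ j * L, X t ≠ w} := by ext X; simp
  rw [h1, walksLaw, Measure.pi_pi]
  calc _ ≤ ∏ _i : Fin k, _ := Finset.prod_le_prod' fun i _ =>
        walkLaw_avoid_le P hL hs hℓ (x i) w j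
    _ = _ := by
        rw [Finset.prod_const, Finset.card_univ, Fintype.card_fin, ← Finset.prod_pow]
        refine Finset.prod_congr rfl fun b _ => ?_
        split_ifs
        · rw [← ENNReal.ofReal_pow (Real.exp_nonneg _), ← Real.exp_nat_mul]
          congr 2
          ring
        · exact one_pow k

theorem measurableSet_visited {V : Type*} [Countable V] [MeasurableSpace V]
    [MeasurableSingletonClass V] {k : ℕ} (w : V) (t : ℕ) :
    MeasurableSet {X : Fin k → ℕ → V | ∃ i, ∃ s ≤ t, X i s = w} := by
  simp only [Set.ofPred_exists]
  refine MeasurableSet.iUnion fun i => MeasurableSet.iUnion fun s => ?_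
  by_cases h : s ≤ t
  · simp only [h, true_and]
    exact measurableSet_eq_fun ((measurable_pi_apply s).comp (measurable_pi_apply i))
      measurable_const
  · simp [h]

theorem ofReal_exp_neg_le_half {y : ℝ} (hy : 1 ≤ y) :
    ENNReal.ofReal (Real.exp (-y)) ≤ 2⁻¹ := by
  have h1 : Real.exp (-y) ≤ 1 / 2 := by
    rw [Real.exp_neg, one_div]
    exact inv_anti₀ two_pos (by linarith [Real.add_one_le_exp y])
  have h2 : ENNReal.ofReal (1 / 2) = 2⁻¹ := by
    rw [one_div, ENNReal.ofReal_inv_of_pos two_pos]; simp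
  rw [← h2]
  exact ENNReal.ofReal_le_ofReal h1

theorem hitTime_le {L T ℓ s k : ℕ} (hL : L = T + (ℓ + s)) (hs : 1 ≤ s)
    (hℓ : Fintype.card V * (1 - gapConst) ^ ℓ ≤ (gapConst / (4 * Fintype.card V)) ^ 2)
    (hk : 1 ≤ gapConst * s * k / (4 * Fintype.card V)) :
    hitTime P k ≤ L * ∑' j, discount P L T j := by
  refine iSup₂_le fun x w => ?_
  refine (lintegral_firstTime_le (walksLaw P x) (fun X t => ∃ i, ∃ s ≤ t, X i s = w)
    (fun t => measurableSet_visited w t) L (by omega)).trans ?_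
  refine mul_le_mul_right (ENNReal.tsum_le_tsum fun j => ?_) _
  refine (measure_mono fun X hX => ?_).trans ((walksLaw_avoid_le P hL hs hℓ x w j).trans ?_)
  · intro i t ht h
    exact hX j le_rfl ⟨i, t, ht, h⟩
  · unfold discount
    refine Finset.prod_le_prod' fun b _ => ?_
    split_ifs
    · exact ofReal_exp_neg_le_half hk
    · exact le_rfl

/-- The union bound over vertices costs a factor `n`, which the first good block pays: its factor
satisfies `β ≤ n^{-2}`, so `nβ ≤ 1/2`, and every further good block gives at most `1/2`. -/
theorem coverTime_le {L T ℓ s k : ℕ} (hL : L = T + (ℓ + s)) (hs : 1 ≤ s)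
    (hn : 2 ≤ Fintype.card V)
    (hℓ : Fintype.card V * (1 - gapConst) ^ ℓ ≤ (gapConst / (4 * Fintype.card V)) ^ 2)
    (hk : 2 * Real.log (Fintype.card V) ≤ gapConst * s * k / (4 * Fintype.card V)) :
    coverTime P k ≤ L * ∑' j, discount P L T j := by
  classical
  refine iSup_le fun x => ?_
  refine (lintegral_firstTime_le (walksLaw P x) (fun X t => ∀ w : V, ∃ i, ∃ s ≤ t, X i s = w)
    (fun t => by
      simp only [Set.ofPred_forall]
      exact MeasurableSet.iInter fun w => measurableSet_visited w t) L (by omega)).trans ?_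
  refine mul_le_mul_right (ENNReal.tsum_le_tsum fun j => ?_) _
  have hn0 : (0 : ℝ) < Fintype.card V := by positivity
  set β := ENNReal.ofReal (Real.exp (-(gapConst * s * k / (4 * Fintype.card V)))) with hβ
  have hβn : Fintype.card V * β ≤ 2⁻¹ ∧ β ≤ 2⁻¹ := by
    have h1 : Real.exp (-(gapConst * s * k / (4 * Fintype.card V))) ≤
        ((Fintype.card V : ℝ) ^ 2)⁻¹ := by
      calc _ ≤ Real.exp (-((2 : ℕ) * Real.log (Fintype.card V))) :=
            Real.exp_le_exp.2 (neg_le_neg (by exact_mod_cast hk))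
        _ = _ := by rw [Real.exp_neg, Real.exp_nat_mul, Real.exp_log hn0]
    have hn2 : (2 : ℝ) ≤ Fintype.card V := by exact_mod_cast hn
    have h2 : ENNReal.ofReal (1 / 2) = 2⁻¹ := by
      rw [one_div, ENNReal.ofReal_inv_of_pos two_pos]; simp
    rw [← h2, hβ, ← ENNReal.ofReal_natCast, ← ENNReal.ofReal_mul hn0.le]
    have h3 : (Fintype.card V : ℝ) * Real.exp (-(gapConst * s * k / (4 * Fintype.card V))) ≤
        1 / 2 := by
      calc _ ≤ (Fintype.card V : ℝ) * ((Fintype.card V : ℝ) ^ 2)⁻¹ := by gcongr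
        _ = 1 / (Fintype.card V : ℝ) := by field_simp
        _ ≤ 1 / 2 := one_div_le_one_div_of_le two_pos hn2
    refine ⟨ENNReal.ofReal_le_ofReal h3, ENNReal.ofReal_le_ofReal (le_trans ?_ h3)⟩
    exact le_mul_of_one_le_left (Real.exp_nonneg _) (by linarith)
  have hprod : ∀ z : ℝ≥0∞, (∏ b ∈ Finset.range j, if GoodBlock P L T b then z else 1) =
      z ^ ((Finset.range j).filter fun b => GoodBlock P L T b).card := fun z => by
    rw [← Finset.prod_filter, Finset.prod_const]
  have hbound : walksLaw P x {X | ∀ i ≤ j, ¬ ∀ w : V, ∃ i', ∃ s ≤ i * L, X i' s = w} ≤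
      Fintype.card V * ∏ b ∈ Finset.range j, if GoodBlock P L T b then β else 1 := by
    calc _ ≤ walksLaw P x (⋃ w ∈ (Finset.univ : Finset V),
          {X | ∀ i, ∀ t ≤ j * L, X i t ≠ w}) := by
          refine measure_mono fun X hX => ?_
          have hX' := hX j le_rfl
          push Not at hX'
          obtain ⟨w, hw⟩ := hX'
          exact Set.mem_iUnion₂.2 ⟨w, Finset.mem_univ w, hw⟩
      _ ≤ ∑ w : V, _ := measure_biUnion_finset_le _ _
      _ ≤ ∑ _w : V, ∏ b ∈ Finset.range j, if GoodBlock P L T b then β else 1 :=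
          Finset.sum_le_sum fun w _ => walksLaw_avoid_le P hL hs hℓ x w j
      _ = _ := by simp
  unfold discount
  rw [hprod] at hbound ⊢
  rcases Nat.eq_zero_or_pos ((Finset.range j).filter fun b => GoodBlock P L T b).card with h | h
  · rw [h, pow_zero]
    have : IsProbabilityMeasure (walksLaw P x) := by unfold walksLaw; infer_instance
    exact prob_le_one
  · obtain ⟨g, hg⟩ := Nat.exists_eq_succ_of_ne_zero h.ne'
    rw [hg, Nat.succ_eq_add_one, pow_succ'] at hbound ⊢
    refine hbound.trans ?_
    rw [← mul_assoc]
    exact mul_le_mul' hβn.1 (pow_le_pow_left' hβn.2 g)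

end Hitting

/-! ### Coalescing time in good blocks -/

section CoalescingTime

variable {V : Type*} [Fintype V] [DecidableEq V] [MeasurableSpace V] [MeasurableSingletonClass V]

theorem apply_leader {V : Type*} [DecidableEq V] {m : ℕ} (x : Fin m → V) (a : Fin m) :
    x (leader x a) = x a :=
  (Finset.mem_filter.1 (Finset.min'_mem (Finset.univ.filter fun b => x b = x a)
    ⟨a, by simp⟩)).2

theorem leader_congr {V : Type*} [DecidableEq V] {m : ℕ} (x : Fin m → V) {a b : Fin m}
    (h : x a = x b) : leader x a = leader x b := by
  unfold leader
  congr 1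
  rw [h]

theorem measurableSet_card_image {m : ℕ} (t : ℕ) :
    MeasurableSet {C : ℕ → Fin m → V | (Finset.univ.image (C t)).card = 1} := by
  have h : Measurable fun C : ℕ → Fin m → V => (Finset.univ.image (C t)).card :=
    (Measurable.of_discrete (f := fun y : Fin m → V => (Finset.univ.image y).card)).comp
      (measurable_pi_apply t)
  exact measurableSet_eq_fun h measurable_const

/-- There is one leader per occupied vertex and the leaders move independently, so the occupied set
evolves as its image under an independent random map. The walker `a₀` only serves as default label
for unoccupied vertices. -/
theorem lintegral_coalKernel (P : Matrix.rowStochastic ℝ V) {m : ℕ} (x : Fin m → V)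
    (a₀ : Fin m) {F : Finset V → ℝ} (hF : ∀ S : Finset V, S.Nonempty → 0 ≤ F S) :
    ∫⁻ y, ENNReal.ofReal (F (Finset.univ.image y)) ∂coalKernel P m x =
      ENNReal.ofReal (mapStep P F (Finset.univ.image x)) := by
  classical
  have hsel : ∀ v, ∃ i : Fin m, ∀ a, x a = v → leader x a = i := by
    intro v
    by_cases h : ∃ a, x a = v
    · obtain ⟨a, rfl⟩ := h
      exact ⟨leader x a, fun b hb => leader_congr x hb⟩
    · exact ⟨a₀, fun a ha => absurd ⟨a, ha⟩ h⟩
  choose sel hsel using hsel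
  have himg : ∀ ξ : Fin m → V, (Finset.univ.image fun a => ξ (leader x a)) =
      (Finset.univ.image x).image (ξ ∘ sel) := fun ξ => by
    rw [Finset.image_image]
    congr 1
    ext a
    simp [hsel (x a) a rfl]
  have hprob : ∀ b, IsProbabilityMeasure (rowPMF P (x b)).toMeasure :=
    fun b => PMF.toMeasure.isProbabilityMeasure _
  have hker : coalKernel P m x =
      (Measure.pi fun b => (rowPMF P (x b)).toMeasure).map fun ξ a => ξ (leader x a) := rfl
  rw [hker, lintegral_map Measurable.of_discrete
    (measurable_pi_lambda _ fun a => measurable_pi_apply _), lintegral_fintype,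
    ← indep_selection P F (Finset.univ.image x) x sel]
  · unfold indep
    rw [ENNReal.ofReal_sum_of_nonneg]
    · refine Finset.sum_congr rfl fun ξ _ => ?_
      rw [himg, Measure.pi_singleton, ENNReal.ofReal_mul (Finset.prod_nonneg fun i _ =>
        rowStochastic_nonneg _ _ _), ENNReal.ofReal_prod_of_nonneg fun i _ =>
        rowStochastic_nonneg _ _ _, mul_comm]
      congr 1
      exact Finset.prod_congr rfl fun b _ =>
        PMF.toMeasure_apply_singleton (rowPMF P (x b)) _ (measurableSet_singleton _)
    · intro ξ _
      exact mul_nonneg (Finset.prod_nonneg fun i _ => rowStochastic_nonneg _ _ _)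
        (hF _ (Finset.Nonempty.image ⟨x a₀, by simp⟩ _))
  · intro v hv
    obtain ⟨a, -, rfl⟩ := Finset.mem_image.1 hv
    exact (congrArg x (hsel (x a) a rfl)).symm.trans (apply_leader x a)

variable (P : ℕ → Matrix.rowStochastic ℝ V)

open scoped Classical in
-- An uncoalesced configuration has excess at least 1, so by Markov's inequality an expected excess
-- of at most `1/2` at the end of a good block bounds the conditional failure probability.
theorem chainLaw_coalKernel_le {L T r m : ℕ} (hL : L = T + r) (a₀ : Fin m)
    (hr : ∀ b, GoodBlock P L T b → ∀ S : Finset V, S.Nonempty →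
      mapIter P excess (b * L + T) r S ≤ 1 / 2) (x : Fin m → V) (j : ℕ) :
    chainLaw (fun t => coalKernel (P (t + 1)) m) x
        {C | ∀ i ≤ j, ¬ (Finset.univ.image (C (i * L))).card = 1} ≤ discount P L T j := by
  set μ := chainLaw (fun t => coalKernel (P (t + 1)) m) x with hμ
  have hne : ∀ y : Fin m → V, (Finset.univ.image y).Nonempty := fun y => ⟨y a₀, by simp⟩
  have hm : ∀ j, MeasurableSet
      {C : ℕ → Fin m → V | ∀ i ≤ j, ¬ (Finset.univ.image (C (i * L))).card = 1} := by
    intro j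
    simp only [Set.ofPred_forall]
    exact MeasurableSet.iInter fun i => MeasurableSet.iInter fun _ =>
      (measurableSet_card_image (i * L)).compl
  induction j with
  | zero => simpa [discount] using prob_le_one
  | succ j ih =>
    unfold discount at ih ⊢
    rw [Finset.prod_range_succ]
    split_ifs with hg
    · set a := j * L + T with ha
      have haL : a + r = (j + 1) * L := by rw [ha, Nat.add_mul, one_mul]; omega
      set f : (ℕ → Fin m → V) → ℝ≥0∞ := Set.indicator
        {C | ∀ i ≤ j, ¬ (Finset.univ.image (C (i * L))).card = 1} 1 with hf
      have hfd : DependsOn f (Set.Iic a) := by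
        intro X Y h
        have : (∀ i ≤ j, ¬ (Finset.univ.image (X (i * L))).card = 1) ↔
            ∀ i ≤ j, ¬ (Finset.univ.image (Y (i * L))).card = 1 :=
          forall_congr' fun i => forall_congr' fun hi => by
            have : i * L ≤ j * L := Nat.mul_le_mul_right L hi
            rw [h (i * L) (show i * L ≤ a by omega)]
        simp only [hf, Set.indicator, Set.mem_ofPred_eq, this, Pi.one_apply]
      set v : ℕ → (Fin m → V) → ℝ≥0∞ := fun t y =>
        ENNReal.ofReal (mapIter P excess t (a + r - t) (Finset.univ.image y)) with hv
      -- No constraint is imposed inside the window (`Set.univ`); the expected final excess is an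
      -- exact solution of the backward recursion.
      have hstay := lintegral_stay_le (fun t => coalKernel (P (t + 1)) m) x hfd
        (fun _ => Set.univ) v r fun t h1 h2 y _ => by
          simp only [hv]
          rw [lintegral_coalKernel (P (t + 1)) y a₀ fun S hS =>
            mapIter_nonneg P (fun S hS => excess_nonneg hS) _ _ hS,
            show a + r - t = (a + r - (t + 1)) + 1 by omega, mapIter]
      calc μ {C | ∀ i ≤ j + 1, ¬ (Finset.univ.image (C (i * L))).card = 1} =
          ∫⁻ C, Set.indicator
            {C | ∀ i ≤ j + 1, ¬ (Finset.univ.image (C (i * L))).card = 1} 1 C ∂μ :=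
            (lintegral_indicator_one (hm (j + 1))).symm
        _ ≤ _ := by
            refine lintegral_mono fun C => ?_
            by_cases hC : ∀ i ≤ j + 1, ¬ (Finset.univ.image (C (i * L))).card = 1
            · have h1 : ∀ i ≤ j, ¬ (Finset.univ.image (C (i * L))).card = 1 :=
                fun i hi => hC i (by omega)
              have h3 : 1 ≤ v (a + r) (C (a + r)) := by
                simp only [hv, Nat.sub_self, mapIter]
                rw [← ENNReal.ofReal_one]
                refine ENNReal.ofReal_le_ofReal ?_
                have h4 := hC (j + 1) le_rfl
                rw [← haL] at h4
                have h5 := (hne (C (a + r))).card_pos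
                have h6 : (2 : ℝ) ≤ (Finset.univ.image (C (a + r))).card := by
                  exact_mod_cast (show 2 ≤ (Finset.univ.image (C (a + r))).card by omega)
                unfold excess
                linarith
              have e1 : Set.indicator
                  {C | ∀ i ≤ j + 1, ¬ (Finset.univ.image (C (i * L))).card = 1} 1 C =
                  (1 : ℝ≥0∞) := Set.indicator_of_mem (by exact hC) _
              have e2 : f C = 1 := Set.indicator_of_mem (by exact h1) _
              rw [e1, e2, if_pos fun _ _ _ => Set.mem_univ _, one_mul]
              exact h3
            · rw [Set.indicator_of_notMem (by exact hC)]
              exact zero_le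
        _ ≤ ∫⁻ C, f C * v a (C a) ∂μ := hstay
        _ ≤ ∫⁻ C, f C * 2⁻¹ ∂μ := by
            refine lintegral_mono fun C => mul_le_mul_right ?_ _
            simp only [hv, Nat.add_sub_cancel_left]
            have h2 : ENNReal.ofReal (1 / 2) = 2⁻¹ := by
              rw [one_div, ENNReal.ofReal_inv_of_pos two_pos]; simp
            rw [← h2]
            exact ENNReal.ofReal_le_ofReal (hr j hg _ (hne _))
        _ = μ {C | ∀ i ≤ j, ¬ (Finset.univ.image (C (i * L))).card = 1} * 2⁻¹ := by
            rw [lintegral_mul_const _ (measurable_one.indicator (hm j)),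
              lintegral_indicator_one (hm j)]
        _ ≤ _ := mul_le_mul_left ih _
    · rw [mul_one]
      refine le_trans (measure_mono fun X hX => ?_) ih
      have hX' : ∀ i ≤ j + 1, ¬ (Finset.univ.image (X (i * L))).card = 1 := hX
      exact fun i hi => hX' i (by omega)

theorem coalTime_le {L T ℓ J m : ℕ} {s : ℕ → ℕ} (hm : 1 ≤ m) (hL0 : 0 < L)
    (hL : L = T + ∑ j ∈ Finset.range J, (ℓ + s j))
    (hs : ∀ j, 12 * Fintype.card V ≤ gapConst * (s j * 2 ^ j))
    (hJ : Fintype.card V ≤ 2 ^ J) (hJ1 : 1 ≤ J)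
    (hℓ : Fintype.card V * (1 - gapConst) ^ ℓ ≤ (gapConst / (4 * Fintype.card V)) ^ 2) :
    coalTime P m ≤ L * ∑' j, discount P L T j := by
  refine iSup_le fun x => ?_
  have h := lintegral_firstTime_le (chainLaw (fun t => coalKernel (P (t + 1)) m) x)
    (fun (C : ℕ → Fin m → V) t => (Finset.univ.image (C t)).card = 1)
    (fun t => measurableSet_card_image t) L hL0
  refine h.trans (mul_le_mul_right (ENNReal.tsum_le_tsum fun j => ?_) _)
  refine chainLaw_coalKernel_le P hL ⟨0, hm⟩ (fun b hb S hS => ?_) x j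
  exact mapIter_excess_le_half P gapConst_pos gapConst_le_one hs hJ hJ1 hℓ
    (fun u h1 h2 => hb u h1 (by rw [Nat.add_mul, one_mul]; omega)) hS

end CoalescingTime

/-! ### Choice of the window lengths -/

section Windows

theorem log_le_two_mul_sqrt {x : ℝ} (hx : 0 < x) : Real.log x ≤ 2 * √x := by
  have h1 := Real.log_le_sub_one_of_pos (Real.sqrt_pos.2 hx)
  rw [Real.log_sqrt hx.le] at h1
  linarith

/-- This burn-in gives `(1 - γ)^ℓ ≤ n^{-4}`; one power of `n` pays the prefactor, two match the
right side, and the last absorbs the constant. -/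
theorem burnIn_le {n : ℝ} (hn1 : 1 ≤ n) (hn : 16 / gapConst ^ 2 ≤ n) {ℓ : ℕ}
    (hℓ : 4 / gapConst * Real.log n ≤ ℓ) :
    n * (1 - gapConst) ^ ℓ ≤ (gapConst / (4 * n)) ^ 2 := by
  have hγ := gapConst_pos
  have hn0 : 0 < n := by linarith
  have h1 : (1 - gapConst) ^ ℓ ≤ (n ^ 4)⁻¹ := by
    calc (1 - gapConst) ^ ℓ ≤ Real.exp (-gapConst) ^ ℓ := by
          refine pow_le_pow_left₀ (by linarith [gapConst_le_one]) ?_ ℓ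
          have := Real.add_one_le_exp (-gapConst)
          linarith
      _ ≤ Real.exp (-((4 : ℕ) * Real.log n)) := by
          rw [← Real.exp_nat_mul, Real.exp_le_exp]
          rw [div_mul_eq_mul_div, div_le_iff₀ hγ] at hℓ
          push_cast
          linarith
      _ = _ := by rw [Real.exp_neg, Real.exp_nat_mul, Real.exp_log hn0]
  calc n * (1 - gapConst) ^ ℓ ≤ n * (n ^ 4)⁻¹ := by gcongr
    _ = 1 / n ^ 2 * (1 / n) := by field_simp
    _ ≤ 1 / n ^ 2 * (gapConst ^ 2 / 16) := by
        refine mul_le_mul_of_nonneg_left ?_ (by positivity)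
        rw [div_le_iff₀ (by positivity)] at hn
        rw [div_le_iff₀ hn0]
        linarith
    _ = _ := by field_simp; ring

theorem clog_le {n : ℕ} (hn : 3 ≤ n) : (Nat.clog 2 n : ℝ) ≤ 3 * Real.log n := by
  have h1 := Nat.pow_pred_clog_lt_self (b := 2) (by norm_num) (x := n) (by omega)
  have hJ : 1 ≤ Nat.clog 2 n := Nat.clog_pos (by norm_num) (by omega)
  obtain ⟨j, hj⟩ := Nat.exists_eq_add_of_le hJ
  rw [hj] at h1 ⊢
  have h2 : (2 : ℝ) ^ j ≤ n := by
    have : 2 ^ j ≤ n := by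
      simpa using h1.le
    exact_mod_cast this
  have h3 := Real.log_le_log (by positivity) h2
  rw [Real.log_pow] at h3
  have h4 := Real.log_two_gt_d9
  have h5 : 1 ≤ Real.log n := by
    rw [Real.le_log_iff_exp_le (by positivity)]
    have : (3 : ℝ) ≤ n := by exact_mod_cast hn
    linarith [Real.exp_one_lt_d9]
  have hj0 : (0 : ℝ) ≤ j := j.cast_nonneg
  push_cast
  nlinarith

theorem sum_window_le {ℓ J : ℕ} {A : ℝ} (hA : 0 ≤ A) :
    ((∑ j ∈ Finset.range J, (ℓ + ⌈A / 2 ^ j⌉₊) : ℕ) : ℝ) ≤ J * (ℓ + 1) + 2 * A := by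
  have h1 : ∀ j : ℕ, (⌈A / 2 ^ j⌉₊ : ℝ) ≤ A / 2 ^ j + 1 := fun j =>
    (Nat.ceil_lt_add_one (by positivity)).le
  have h2 : ∑ j ∈ Finset.range J, A / (2 : ℝ) ^ j ≤ 2 * A := by
    have e : ∀ j : ℕ, A / (2 : ℝ) ^ j = A * (1 / 2) ^ j := fun j => by
      rw [one_div, inv_pow, div_eq_mul_inv]
    simp_rw [e]
    rw [← Finset.mul_sum, mul_comm 2 A]
    refine mul_le_mul_of_nonneg_left ?_ hA
    have := Summable.sum_le_tsum (Finset.range J) (fun j _ => by positivity)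
      (summable_geometric_of_lt_one (r := (1 : ℝ) / 2) (by norm_num) (by norm_num))
    rw [tsum_geometric_of_lt_one (by norm_num) (by norm_num)] at this
    norm_num at this ⊢
    exact this
  push_cast
  calc ∑ j ∈ Finset.range J, ((ℓ : ℝ) + ⌈A / 2 ^ j⌉₊) ≤
        ∑ j ∈ Finset.range J, ((ℓ + 1 : ℝ) + A / 2 ^ j) :=
        Finset.sum_le_sum fun j _ => by linarith [h1 j]
    _ ≤ _ := by
        rw [Finset.sum_add_distrib, Finset.sum_const, Finset.card_range, nsmul_eq_mul]
        linarith

theorem mul_le_ofReal_of_le_three {L : ℕ} {X : ℝ≥0∞} {R : ℝ} (hX : X ≤ 3) (hL : 3 * (L : ℝ) ≤ R) :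
    (L : ℝ≥0∞) * X ≤ ENNReal.ofReal R := by
  calc (L : ℝ≥0∞) * X ≤ L * 3 := by gcongr
    _ = ENNReal.ofReal (3 * L) := by
        rw [ENNReal.ofReal_mul (by norm_num), ENNReal.ofReal_natCast, mul_comm]
        simp
    _ ≤ _ := ENNReal.ofReal_le_ofReal hL

variable {n : ℕ} {p q : I}

/-- With probability at least `1 - 1 / (3n)`, the discounts of blocks with a window of length
`W = O(n log n)` have sum at most `3`. -/
theorem measure_window_bad_le {D : ℝ} (hD : 1 ≤ D) (hn3 : 3 ≤ n) (hnD : (7200 * D) ^ 2 ≤ n)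
    (hp : 0 < (p : ℝ)) (hpq1 : (p : ℝ) + q ≤ 1)
    (hϖ : 64 * Real.log n ≤ n * ((p : ℝ) / (p + q))) (G₀ : SimpleGraph (Fin n)) {T W : ℕ}
    (hT : 1 / (p : ℝ) ≤ T) (hW : (W : ℝ) ≤ 100 * D * n * Real.log n) :
    edgeMarkovianLaw p q G₀ {Y | 3 < ∑' j, discount (metropolisSeq Y) (T + W) T j} ≤
      ENNReal.ofReal (1 / (3 * n)) := by
  have hn : (3 : ℝ) ≤ n := by exact_mod_cast hn3
  have hn0 : (0 : ℝ) < n := by linarith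
  have hlog0 : 0 ≤ Real.log n := Real.log_nonneg (by linarith)
  set η : ℝ := 300 * D * Real.log n / n ^ 2 with hη
  have h1 : 3600 * D * Real.log n ≤ n := by
    have h2 := log_le_two_mul_sqrt hn0
    have h3 : 7200 * D ≤ √(n : ℝ) := Real.le_sqrt_of_sq_le hnD
    calc 3600 * D * Real.log n ≤ 3600 * D * (2 * √(n : ℝ)) := by gcongr
      _ = 7200 * D * √(n : ℝ) := by ring
      _ ≤ √(n : ℝ) * √(n : ℝ) := by gcongr
      _ = n := Real.mul_self_sqrt hn0.le
  -- The target `1/(3n)` is chosen so that three windows fail with total probability at most `1/n`.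
  have h4 : 4 * η ≤ 1 / (3 * n) := by
    rw [hη, mul_div_assoc', div_le_div_iff₀ (by positivity) (by positivity)]
    nlinarith
  have h5 : 1 / (3 * n) ≤ (1 : ℝ) := by rw [div_le_one (by positivity)]; linarith
  refine (measure_discount_gt_le (V := Fin n) (η := η) (by simpa using by omega) hp hpq1
    (by simpa using hϖ) hT ?_ (by omega) (by positivity) (by linarith)).trans
    (ENNReal.ofReal_le_ofReal h4)
  rw [Fintype.card_fin]
  have h6 : (W : ℝ) * (3 / (n : ℝ) ^ 3) ≤ η := by
    calc (W : ℝ) * (3 / (n : ℝ) ^ 3) ≤ 100 * D * n * Real.log n * (3 / (n : ℝ) ^ 3) := by gcongr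
      _ = η := by rw [hη]; field_simp; ring
  push_cast
  linarith

end Windows

end

end DynamicWalk

/-! ### The theorem: choice of constants and union bound over three windows -/

open DynamicWalk in
theorem theorem1p7 :
    ∃ (K δ : ℝ) (n₀ : ℕ), 0 < K ∧ 0 < δ ∧
      ∀ c : ℝ, 1 ≤ c →
      ∀ n : ℕ, n₀ ≤ n →
      ∀ p q : unitInterval,
        0 < (p : ℝ) + q → (p : ℝ) + q ≤ 1 →
        32 * (c + 1) * (Real.log n / n) ≤ (p : ℝ) / (p + q) →
      ∀ k : ℕ, 1 ≤ k →
      ∀ G₀ : SimpleGraph (Fin n),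
        edgeMarkovianLaw p q G₀
          {Y | ¬ (hitTime (fun t => metropolis (graphAt Y t)) k ≤
                    ENNReal.ofReal (K * (max 1 ((q : ℝ) / p) / (p + q) + Real.log n + n / k)) ∧
                  coverTime (fun t => metropolis (graphAt Y t)) k ≤
                    ENNReal.ofReal
                      (K * (max 1 ((q : ℝ) / p) / (p + q) + Real.log n + n * Real.log n / k)) ∧
                  coalTime (fun t => metropolis (graphAt Y t)) n ≤
                    ENNReal.ofReal (K * (max 1 ((q : ℝ) / p) / (p + q) + n)))}
          ≤ ENNReal.ofReal ((n : ℝ) ^ (-δ)) := by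
  have hγ := gapConst_pos
  set D : ℝ := 1 / gapConst with hD
  have hD1 : 1 ≤ D := by rw [hD, le_div_iff₀ hγ, one_mul]; exact gapConst_le_one
  have hD0 : 0 < D := by linarith
  have hγD : gapConst * D = 1 := by rw [hD]; field_simp
  -- With `D = 1/γ`, the constant is 3, from the sum of discounts, times `100 D`, which bounds `L`
  -- relative to the stated quantities.
  refine ⟨300 * D, 1, ⌈(7200 * D) ^ 2⌉₊ + 3, by positivity, one_pos, ?_⟩
  intro c hc n hn p q hpq hpq1 hcond k hk G₀
  have hn3 : 3 ≤ n := by omega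
  have hnD : (7200 * D) ^ 2 ≤ n :=
    (Nat.le_ceil _).trans (by exact_mod_cast (show ⌈(7200 * D) ^ 2⌉₊ ≤ n by omega))
  have hnr : (3 : ℝ) ≤ n := by exact_mod_cast hn3
  have hn0 : (0 : ℝ) < n := by linarith
  have hk1 : (1 : ℝ) ≤ k := by exact_mod_cast hk
  have hk0 : (0 : ℝ) < k := by linarith
  set lg := Real.log n with hlg
  have hlg1 : 1 ≤ lg := by
    rw [hlg, Real.le_log_iff_exp_le hn0]
    linarith [Real.exp_one_lt_d9]
  have hϖ : 64 * lg ≤ n * ((p : ℝ) / (p + q)) := by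
    have h1 : 64 * (lg / n) ≤ (p : ℝ) / (p + q) := by
      refine le_trans ?_ hcond
      have : 0 ≤ lg / n := by positivity
      nlinarith
    calc 64 * lg = n * (64 * (lg / n)) := by field_simp
      _ ≤ _ := by gcongr
  have hp : 0 < (p : ℝ) := by
    have h1 : 0 < (n : ℝ) * ((p : ℝ) / (p + q)) := by linarith
    have h2 : 0 < (p : ℝ) / (p + q) := by
      by_contra h
      nlinarith
    by_contra h
    exact absurd h2 (not_lt.2 (div_nonpos_of_nonpos_of_nonneg (not_lt.1 h) hpq.le))
  set m : ℝ := max 1 ((q : ℝ) / p) / (p + q) with hm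
  have hm0 : 0 ≤ m := div_nonneg (le_trans zero_le_one (le_max_left _ _)) hpq.le
  -- Since `1/p = (1 + q/p)/(p+q)`, the waiting time `T` is controlled by the mixing term of the
  -- statement.
  have hpm : 1 / (p : ℝ) ≤ 2 * m := by
    have h1 : 1 / (p : ℝ) = (1 + (q : ℝ) / p) / (p + q) := by field_simp
    rw [h1, hm, mul_div_assoc']
    gcongr
    linarith [le_max_left 1 ((q : ℝ) / p), le_max_right 1 ((q : ℝ) / p)]
  set T := ⌈1 / (p : ℝ)⌉₊ with hT
  have hT1 : 1 / (p : ℝ) ≤ T := Nat.le_ceil _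
  have hT2 : (T : ℝ) ≤ 2 * m + 1 := by
    have := (Nat.ceil_lt_add_one (a := 1 / (p : ℝ)) (by positivity)).le
    linarith
  set ℓ := ⌈4 / gapConst * lg⌉₊ with hℓ
  have hℓ2 : (ℓ : ℝ) ≤ 4 * D * lg + 1 := by
    have h1 := (Nat.ceil_lt_add_one (a := 4 / gapConst * lg) (by positivity)).le
    have h2 : 4 / gapConst * lg = 4 * D * lg := by rw [hD]; ring
    linarith
  have hburn : (Fintype.card (Fin n) : ℝ) * (1 - gapConst) ^ ℓ ≤
      (gapConst / (4 * Fintype.card (Fin n))) ^ 2 := by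
    rw [Fintype.card_fin]
    refine burnIn_le (by linarith) (le_trans ?_ hnD) (Nat.le_ceil _)
    have h1 : 16 / gapConst ^ 2 = 16 * D ^ 2 := by rw [hD]; ring
    rw [h1]
    nlinarith [sq_nonneg D]
  have hDlg : 1 ≤ D * lg := one_le_mul_of_one_le_of_one_le hD1 hlg1
  have hDn : D ≤ D * n := le_mul_of_one_le_right hD0.le (by linarith)
  have hlgDlg : lg ≤ D * lg := le_mul_of_one_le_left (by linarith) hD1
  have hDlgn : D * lg ≤ D * n * lg := by nlinarith
  have hDnn : D * n ≤ D * n * lg := le_mul_of_one_le_right (by positivity) hlg1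
  -- hitting
  set sh := ⌈4 * D * (n / k)⌉₊ with hsh
  have hsh1 : 4 * D * (n / k) ≤ sh := Nat.le_ceil _
  have hsh2 : (sh : ℝ) ≤ 4 * D * (n / k) + 1 := (Nat.ceil_lt_add_one (by positivity)).le
  have hsh0 : 1 ≤ sh := Nat.ceil_pos.2 (by positivity)
  have hnk : (n : ℝ) / k ≤ n := div_le_self hn0.le hk1
  have hDnk : D * (n / k) ≤ D * n := by gcongr
  have hnk0 : (0 : ℝ) < n / k := by positivity
  have hWh : ((ℓ + sh : ℕ) : ℝ) ≤ 100 * D * n * lg := by push_cast; linarith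
  -- The length `4Dn/k` makes the joint exponent of the `k` walks at least 1, and `e^{-1} ≤ 1/2`.
  have hkh : 1 ≤ gapConst * sh * k / (4 * Fintype.card (Fin n)) := by
    rw [Fintype.card_fin, le_div_iff₀ (by positivity)]
    calc 1 * (4 * (n : ℝ)) = gapConst * D * (4 * n) := by rw [hγD]
      _ = gapConst * (4 * D * (n / k)) * k := by field_simp
      _ ≤ gapConst * sh * k := by gcongr
  have hLh : 3 * ((T + (ℓ + sh) : ℕ) : ℝ) ≤ 300 * D * (m + lg + n / k) := by
    have h1 : m ≤ D * m := le_mul_of_one_le_left hm0 hD1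
    have h2 : 0 ≤ D * (n / k) := by positivity
    push_cast
    linarith
  -- covering
  set sc := ⌈8 * D * (n * lg / k)⌉₊ with hsc
  have hsc1 : 8 * D * (n * lg / k) ≤ sc := Nat.le_ceil _
  have hsc2 : (sc : ℝ) ≤ 8 * D * (n * lg / k) + 1 := (Nat.ceil_lt_add_one (by positivity)).le
  have hsc0 : 1 ≤ sc := Nat.ceil_pos.2 (by positivity)
  have hnlk : (n : ℝ) * lg / k ≤ n * lg := div_le_self (by positivity) hk1
  have hDnlk : D * (n * lg / k) ≤ D * n * lg := by rw [mul_assoc D]; gcongr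
  have hWc : ((ℓ + sc : ℕ) : ℝ) ≤ 100 * D * n * lg := by push_cast; linarith
  have hkc : 2 * Real.log (Fintype.card (Fin n)) ≤
      gapConst * sc * k / (4 * Fintype.card (Fin n)) := by
    rw [Fintype.card_fin, le_div_iff₀ (by positivity), ← hlg]
    calc 2 * lg * (4 * (n : ℝ)) = gapConst * D * (8 * (n * lg)) := by rw [hγD]; ring
      _ = gapConst * (8 * D * (n * lg / k)) * k := by field_simp
      _ ≤ gapConst * sc * k := by gcongr
  have hLc : 3 * ((T + (ℓ + sc) : ℕ) : ℝ) ≤ 300 * D * (m + lg + n * lg / k) := by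
    have h1 : m ≤ D * m := le_mul_of_one_le_left hm0 hD1
    have h2 : 0 ≤ D * (n * lg / k) := by positivity
    push_cast
    linarith
  -- coalescing
  set J := Nat.clog 2 n with hJ
  set s : ℕ → ℕ := fun j => ⌈12 * D * n / 2 ^ j⌉₊ with hs
  set W := ∑ j ∈ Finset.range J, (ℓ + s j) with hW
  have hWn : (W : ℝ) ≤ 99 * (D * n) := by
    have h1 := sum_window_le (ℓ := ℓ) (J := J) (A := 12 * D * n) (by positivity)
    have h2 : (J : ℝ) ≤ 3 * lg := clog_le hn3
    have h3 : (J : ℝ) * (ℓ + 1) ≤ 3 * lg * (6 * (D * lg)) := by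
      refine mul_le_mul h2 (by linarith) (by positivity) (by positivity)
    -- The `J = O(log n)` burn-ins of length `O(log n)` are absorbed into the `O(n)` bound, which is
    -- why the coalescing bound has no logarithmic term.
    have h4 : lg ^ 2 ≤ 4 * (n : ℝ) := by
      have h5 : lg ≤ 2 * √(n : ℝ) := log_le_two_mul_sqrt hn0
      calc lg ^ 2 ≤ (2 * √(n : ℝ)) ^ 2 := by gcongr
        _ = 4 * (n : ℝ) := by rw [mul_pow, Real.sq_sqrt hn0.le]; norm_num
    have h5 : 3 * lg * (6 * (D * lg)) ≤ 72 * (D * n) := by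
      calc 3 * lg * (6 * (D * lg)) = 18 * D * lg ^ 2 := by ring
        _ ≤ 18 * D * (4 * n) := by gcongr
        _ = _ := by ring
    calc (W : ℝ) ≤ J * (ℓ + 1) + 2 * (12 * D * n) := h1
      _ ≤ _ := by linarith
  have hWl : (W : ℝ) ≤ 100 * D * n * lg := by linarith
  have hLl : 3 * ((T + W : ℕ) : ℝ) ≤ 300 * D * (m + n) := by
    have h1 : m ≤ D * m := le_mul_of_one_le_left hm0 hD1
    push_cast
    linarith
  have hsj : ∀ j, 12 * (Fintype.card (Fin n) : ℝ) ≤ gapConst * (s j * 2 ^ j) := by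
    intro j
    rw [Fintype.card_fin]
    have h1 : 12 * D * n / 2 ^ j ≤ s j := Nat.le_ceil _
    calc 12 * (n : ℝ) = gapConst * D * (12 * n) := by rw [hγD, one_mul]
      _ = gapConst * (12 * D * n / 2 ^ j * 2 ^ j) := by field_simp
      _ ≤ _ := by gcongr
  -- union bound
  have hsub : {Y | ¬ (hitTime (fun t => metropolis (graphAt Y t)) k ≤
        ENNReal.ofReal (300 * D * (m + lg + n / k)) ∧
      coverTime (fun t => metropolis (graphAt Y t)) k ≤
        ENNReal.ofReal (300 * D * (m + lg + n * lg / k)) ∧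
      coalTime (fun t => metropolis (graphAt Y t)) n ≤ ENNReal.ofReal (300 * D * (m + n)))} ⊆
      {Y : Pair (Fin n) → ℕ → Fin 2 |
          3 < ∑' j, discount (metropolisSeq Y) (T + (ℓ + sh)) T j} ∪
        ({Y | 3 < ∑' j, discount (metropolisSeq Y) (T + (ℓ + sc)) T j} ∪
          {Y | 3 < ∑' j, discount (metropolisSeq Y) (T + W) T j}) := by
    intro Y hY
    by_contra hcon
    rw [Set.mem_union, Set.mem_union, not_or, not_or] at hcon
    obtain ⟨h1, h2, h3⟩ := hcon
    refine hY ⟨?_, ?_, ?_⟩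
    · exact (hitTime_le (metropolisSeq Y) rfl hsh0 hburn hkh).trans
        (mul_le_ofReal_of_le_three (not_lt.1 h1) hLh)
    · exact (coverTime_le (metropolisSeq Y) rfl hsc0 (by rw [Fintype.card_fin]; omega) hburn
        hkc).trans (mul_le_ofReal_of_le_three (not_lt.1 h2) hLc)
    · have hW0 : 0 < T := Nat.ceil_pos.2 (by positivity)
      exact (coalTime_le (metropolisSeq Y) (by omega) (by omega) rfl hsj
        (by rw [Fintype.card_fin]; exact Nat.le_pow_clog (by norm_num) n)
        (Nat.clog_pos (by norm_num) (by omega)) hburn).trans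
        (mul_le_ofReal_of_le_three (not_lt.1 h3) hLl)
  refine (measure_mono hsub).trans ((measure_union_le _ _).trans
    ((add_le_add_right (measure_union_le _ _) _).trans ?_))
  have hb := fun (W' : ℕ) (hW' : (W' : ℝ) ≤ 100 * D * n * lg) =>
    measure_window_bad_le hD1 hn3 hnD hp hpq1 hϖ G₀ hT1 hW'
  refine (add_le_add (hb _ hWh) (add_le_add (hb _ hWc) (hb _ hWl))).trans (le_of_eq ?_)
  rw [← ENNReal.ofReal_add (by positivity) (by positivity),
    ← ENNReal.ofReal_add (by positivity) (by positivity), Real.rpow_neg_one]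
  congr 1
  field_simp
  norm_num
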